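/- **Conventions.** A convex cone in $\mathbb R^n$ is a nonempty set closed under nonnegative linear combinations. A *proper cone* $K\subseteq\mathbb R^n$ is a closed convex cone with $K\cap(-K)=\{0\}$ and nonempty interior. A *face* of $K$ is a subcone $F$ such that $x\in F$, $y\in K$ and $x-y\in K$ imply $y\in F$; $\Phi(S)$ is the smallest face of $K$ containing $S\subseteq K$, and $\Phi(x)=\Phi(\{x\})$. A nonzero $x\in K$ is an *extreme vector* if $\Phi(x)=\{\lambda x:\lambda\ge 0\}$; then $\Phi(x)$ is an *extreme ray*. Let $\mathcal E$ be the set of extreme rays. $\mathcal P(m,n)$ is the set of proper cones in $\mathbb R^n$ with exactly $m$ extreme rays. A *$d$-dimensional minimal cone* is a closed pointed cone (proper in its $d$-dimensional linear span) with exactly $d+1$ extreme rays; so $\mathcal P(n+1,n)$ is the set of $n$-dimensional minimal cones in $\mathbb R^n$. Its extreme vectors $x_1,\dots,x_{d+1}$ (one chosen on each extreme ray) satisfy, up to a scalar, a unique nonzero linear relation, written with positive coefficients on both sides; the relation is *balanced* if the numbers of nonzero terms on its two sides differ by at most $1$. A cone $K$ is the *direct sum* $K_1\oplus K_2$ of subcones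 $K_1,K_2$ if each $x\in K$ is uniquely $x_1+x_2$ with $x_i\in K_i$; $K$ is *decomposable* if it is the direct sum of two nonzero subcones, and otherwise *indecomposable*. An $n\times n$ real matrix $A$ is *$K$-primitive* if $AK\subseteq K$ and $A^p(K\setminus\{0\})\subseteq \operatorname{int}K$ for some positive integer $p$; the least such $p$ is $\gamma(A)$. $\gamma(K)$ is the maximum of $\gamma(A)$ over all $K$-primitive $A$ (it is finite for the cones considered here). A cone $K\in\mathcal P(m,n)$ is *exp-maximal* if $\gamma(K)=\max\{\gamma(K'):K'\in\mathcal P(m,n)\}$, and a $K$-primitive matrix $A$ is *exp-maximal* if $\gamma(A)=\gamma(K)$. The digraph $(\mathcal E,\mathcal P(A,K))$ has vertex set $\mathcal E$ and an arc from $\Phi(x)$ to $\Phi(y)$ whenever $\Phi(y)\subseteq\Phi(Ax)$. For $m\ge 4$ let $D_1$ be the digraph on $x_1,\dots,x_m$ with arcs $x_i\to x_{i+1}$ ($1\le i\le m-1$), $x_m\to x_1$ and $x_m\to x_2$, and let $D_2$ be $D_1$ with the additional arc $x_1\to x_3$. Below $m=n+1$, and "given by $D_i$" means "isomorphic to $D_i$".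 **Theorem.** Let $n\ge 3$ be an integer. (I) $\max\{\gamma(K):K\in\mathcal P(n+1,n)\}$ equals $n^2-n+1$ if $n$ is odd and $n^2-n$ if $n$ is even. (II) Suppose $n$ is odd. (i) An $n$-dimensional minimal cone is exp-maximal if and only if it is indecomposable and the relation for its extreme vectors is balanced. (ii) Let $K$ be an $n$-dimensional exp-maximal minimal cone. A $K$-primitive matrix $A$ is exp-maximal if and only if $(\mathcal E,\mathcal P(A,K))$ is given by $D_1$. (III) Suppose $n$ is even. (i) An $n$-dimensional minimal cone is exp-maximal if and only if either it is indecomposable and has a balanced relation for its extreme vectors, or it is the direct sum of a ray and an indecomposable minimal cone with a balanced relation for its extreme vectors. (ii) Let $K$ be an $n$-dimensional indecomposable exp-maximal minimal cone. A $K$-primitive matrix $A$ is exp-maximal if and only if either $(\mathcal E,\mathcal P(A,K))$ is given by $D_1$, or it is given by $D_2$ with a labelling $\Phi(x_1),\dots,\Phi(x_{n+1})$ of the extreme rays for which $x_1$ and $x_2$ appear on opposite sides of the relation for the extreme vectors of $K$. (iii) Let $K$ be an $n$-dimensional decomposable exp-maximal minimal cone. A $K$-primitive matrix $A$ is exp-maximal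 if and only if $(\mathcal E,\mathcal P(A,K))$ is given by $D_2$. -/

import Mathlib

namespace KCone

section General

variable {E : Type*} [AddCommGroup E] [Module ℝ E]

/-- `Φ(S)`: the face of `K` generated by `S ⊆ K`, the intersection of all faces of `K`
that include `S`. -/
def genFace (K : PointedCone ℝ E) (S : Set E) : PointedCone ℝ E :=
  sInf {F : PointedCone ℝ E | F.IsFaceOf K ∧ S ⊆ (F : Set E)}

/-- `x` is a nonzero extreme vector of `K`: `Φ(x)` consists of the nonnegative multiples of `x`. -/
def IsExtremeVector (K : PointedCone ℝ E) (x : E) : Prop :=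
  x ∈ K ∧ x ≠ 0 ∧ genFace K {x} = PointedCone.hull ℝ {x}

/-- The set of all extreme rays of `K`. -/
def extremeRays (K : PointedCone ℝ E) : Set (PointedCone ℝ E) :=
  {F | ∃ x, IsExtremeVector K x ∧ F = genFace K {x}}

/-- The dimension of a cone: the dimension of its linear span. -/
noncomputable def coneDim (K : PointedCone ℝ E) : ℕ :=
  Module.finrank ℝ (Submodule.span ℝ (K : Set E))

/-- `K ∩ (-K) = {0}`. -/
def IsPointed (K : PointedCone ℝ E) : Prop :=
  ∀ x ∈ K, -x ∈ K → x = 0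

/-- A ray: all nonnegative multiples of one nonzero vector. -/
def IsRay (R : PointedCone ℝ E) : Prop :=
  ∃ x : E, x ≠ 0 ∧ R = PointedCone.hull ℝ {x}

/-- `K = K₁ ⊕ K₂`: `K₁, K₂` are subcones of `K`, and every vector of `K` is in exactly one way
a sum of a vector of `K₁` and a vector of `K₂`. -/
def IsDirectSum (K K₁ K₂ : PointedCone ℝ E) : Prop :=
  K₁ ≤ K ∧ K₂ ≤ K ∧ ∀ x ∈ K, ∃! p : E × E, p.1 ∈ K₁ ∧ p.2 ∈ K₂ ∧ p.1 + p.2 = x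

/-- `K` is the direct sum of two nonzero subcones. -/
def IsDecomposable (K : PointedCone ℝ E) : Prop :=
  ∃ K₁ K₂ : PointedCone ℝ E, K₁ ≠ ⊥ ∧ K₂ ≠ ⊥ ∧ IsDirectSum K K₁ K₂

/-- `K` is not the direct sum of two nonzero subcones. -/
def IsIndecomposable (K : PointedCone ℝ E) : Prop :=
  ¬ IsDecomposable K

/-- `∑ cᵢ xᵢ = 0` is a (nonzero) relation for the extreme vectors of `K`. The pairwise distinct
extreme vectors are `x₁, …, x_m`, one on each extreme ray; the ray of `xᵢ` is `e i`. The terms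
with `cᵢ > 0` form one side of the relation, those with `cᵢ < 0` the other side. For a minimal
cone `c` is determined by `x` up to a nonzero factor, and replacing `x` by another choice
multiplies the entries of `c` by positive numbers. -/
def IsRelation (K : PointedCone ℝ E) {m : ℕ} (e : Fin m ≃ extremeRays K) (x : Fin m → E)
    (c : Fin m → ℝ) : Prop :=
  (∀ i, IsExtremeVector K (x i) ∧ genFace K {x i} = (e i : PointedCone ℝ E)) ∧
    c ≠ 0 ∧ ∑ i, c i • x i = 0

/-- The relation for the extreme vectors of the (minimal) cone `K` is balanced: the numbers of
nonzero terms on its two sides differ by at most `1`. -/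
def HasBalancedRelation (K : PointedCone ℝ E) : Prop :=
  ∃ (m : ℕ) (e : Fin m ≃ extremeRays K) (x : Fin m → E) (c : Fin m → ℝ),
    IsRelation K e x c ∧
    {i | 0 < c i}.ncard ≤ {i | c i < 0}.ncard + 1 ∧
    {i | c i < 0}.ncard ≤ {i | 0 < c i}.ncard + 1

/-- In the relation for the extreme vectors of the (minimal) cone `K`, the extreme vectors on the
rays `e i` and `e j` appear on opposite sides. -/
def OnOppositeSides (K : PointedCone ℝ E) {m : ℕ} (e : Fin m ≃ extremeRays K)
    (i j : Fin m) : Prop :=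
  ∃ (x : Fin m → E) (c : Fin m → ℝ), IsRelation K e x c ∧ c i * c j < 0

/-- A minimal cone: a closed pointed cone whose (finite) number of extreme rays exceeds the
dimension of its linear span by one. (In its span, such a cone has nonempty interior.) -/
def IsMinimalCone [TopologicalSpace E] (K : PointedCone ℝ E) : Prop :=
  IsClosed (K : Set E) ∧ IsPointed K ∧ (extremeRays K).Finite ∧
    (extremeRays K).ncard = coneDim K + 1

/-- A proper cone: closed, pointed and full. -/
def IsProper [TopologicalSpace E] (K : PointedCone ℝ E) : Prop :=
  IsClosed (K : Set E) ∧ IsPointed K ∧ (interior (K : Set E)).Nonempty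

end General

/-- `𝒫(m,n)`: the `n`-dimensional polyhedral (proper) cones with `m` extreme rays, taken in `ℝⁿ`.
The cones in `𝒫(n+1,n)` are the `n`-dimensional minimal cones. -/
def polyCones (m n : ℕ) : Set (PointedCone ℝ (Fin n → ℝ)) :=
  {K | IsProper K ∧ (extremeRays K).Finite ∧ (extremeRays K).ncard = m}

section Matrices

variable {n : ℕ}

open Matrix in
/-- `A ∈ π(K)`: `A` is `K`-nonnegative. -/
def IsKNonneg (K : PointedCone ℝ (Fin n → ℝ)) (A : Matrix (Fin n) (Fin n) ℝ) : Prop :=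
  ∀ x ∈ K, A *ᵥ x ∈ K

open Matrix in
/-- `A` is `K`-positive: it maps `K ∖ {0}` into the interior of `K`. -/
def IsKPositive (K : PointedCone ℝ (Fin n → ℝ)) (A : Matrix (Fin n) (Fin n) ℝ) : Prop :=
  ∀ x ∈ K, x ≠ 0 → A *ᵥ x ∈ interior (K : Set (Fin n → ℝ))

/-- `A` is `K`-primitive: it is `K`-nonnegative and some power of it is `K`-positive. -/
def IsKPrimitive (K : PointedCone ℝ (Fin n → ℝ)) (A : Matrix (Fin n) (Fin n) ℝ) : Prop :=
  IsKNonneg K A ∧ ∃ p : ℕ, 0 < p ∧ IsKPositive K (A ^ p)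

/-- `γ(A) = γ_K(A)`: the least positive `p` for which `A ^ p` is `K`-positive. It is used only for
`K`-primitive `A`. -/
noncomputable def matrixExponent (K : PointedCone ℝ (Fin n → ℝ))
    (A : Matrix (Fin n) (Fin n) ℝ) : ℕ :=
  sInf {p : ℕ | 0 < p ∧ IsKPositive K (A ^ p)}

/-- `γ(K)`: the supremum of the exponents of the `K`-primitive matrices. It takes values in `ℕ∞`,
so that it is `⊤` exactly when these exponents are unbounded; when it is finite and there is a
`K`-primitive matrix, it is the maximum of the exponents. -/
noncomputable def coneExponent (K : PointedCone ℝ (Fin n → ℝ)) : ℕ∞ :=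
  ⨆ A ∈ {A : Matrix (Fin n) (Fin n) ℝ | IsKPrimitive K A}, (matrixExponent K A : ℕ∞)

/-- An exp-maximal cone of `𝒫(m,n)`. -/
def IsExpMaximalCone (m : ℕ) (K : PointedCone ℝ (Fin n → ℝ)) : Prop :=
  K ∈ polyCones m n ∧ IsGreatest (coneExponent '' polyCones m n) (coneExponent K)

/-- An exp-maximal `K`-primitive matrix. -/
def IsExpMaximalMatrix (K : PointedCone ℝ (Fin n → ℝ)) (A : Matrix (Fin n) (Fin n) ℝ) : Prop :=
  IsKPrimitive K A ∧ (matrixExponent K A : ℕ∞) = coneExponent K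

open Matrix in
/-- The digraph `(ℰ, 𝒫(A,K))` of a `K`-nonnegative matrix `A`: its vertices are the extreme rays of
`K`, and `(Φ(x), Φ(y))` is an arc whenever `Φ(y) ⊆ Φ(A x)`. -/
def coneDigraph (K : PointedCone ℝ (Fin n → ℝ)) (A : Matrix (Fin n) (Fin n) ℝ) :
    Digraph (extremeRays K) where
  Adj F G := ∃ x : Fin n → ℝ, IsExtremeVector K x ∧ (F : PointedCone ℝ (Fin n → ℝ)) = genFace K {x} ∧
    (G : PointedCone ℝ (Fin n → ℝ)) ≤ genFace K {A *ᵥ x}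

/-- The labelling `e` of the extreme rays of `K` identifies `D` with `(ℰ, 𝒫(A,K))`. -/
def IsLabelling (K : PointedCone ℝ (Fin n → ℝ)) (A : Matrix (Fin n) (Fin n) ℝ) {m : ℕ}
    (D : Digraph (Fin m)) (e : Fin m ≃ extremeRays K) : Prop :=
  ∀ i j, (coneDigraph K A).Adj (e i) (e j) ↔ D.Adj i j

/-- `(ℰ, 𝒫(A,K))` is given by `D` up to graph isomorphism. -/
def IsGivenBy (K : PointedCone ℝ (Fin n → ℝ)) (A : Matrix (Fin n) (Fin n) ℝ) {m : ℕ}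
    (D : Digraph (Fin m)) : Prop :=
  ∃ e : Fin m ≃ extremeRays K, IsLabelling K A D e

end Matrices

/-- The first digraph. The vertex `x_k` is `k - 1 : Fin m`. The arcs are `x_k → x_{k+1}` for
`1 ≤ k < m`, `x_m → x_1` and `x_m → x_2`. -/
def figure1 (m : ℕ) : Digraph (Fin m) where
  Adj i j := (j : ℕ) = (i : ℕ) + 1 ∨ ((i : ℕ) + 1 = m ∧ ((j : ℕ) = 0 ∨ (j : ℕ) = 1))

/-- The second digraph: the first digraph with the additional arc `x_1 → x_3`. -/
def figure2 (m : ℕ) : Digraph (Fin m) where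
  Adj i j := (figure1 m).Adj i j ∨ ((i : ℕ) = 0 ∧ (j : ℕ) = 2)

end KCone

open KCone

namespace KCone

section ConeBasics

variable {E : Type*} [AddCommGroup E] [Module ℝ E] {K : PointedCone ℝ E}

theorem smul_mem_cone {a : ℝ} {x : E} (ha : 0 ≤ a) (hx : x ∈ K) : a • x ∈ K :=
  PointedCone.smul_mem K ha hx

theorem mem_hull_singleton_iff {x y : E} :
    y ∈ PointedCone.hull ℝ {x} ↔ ∃ a : ℝ, 0 ≤ a ∧ a • x = y := by
  constructor
  · intro h
    obtain ⟨a, ha⟩ := Submodule.mem_span_singleton.1 h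
    exact ⟨a.1, a.2, ha⟩
  · rintro ⟨a, ha, rfl⟩
    exact smul_mem_cone ha (Submodule.mem_span_singleton_self x)

theorem mem_hull_range_iff {ι : Type*} [Fintype ι] {x : ι → E} {y : E} :
    y ∈ PointedCone.hull ℝ (Set.range x) ↔ ∃ b : ι → ℝ, (∀ i, 0 ≤ b i) ∧ ∑ i, b i • x i = y := by
  constructor
  · intro h
    obtain ⟨b, hb⟩ := (Submodule.mem_span_range_iff_exists_fun _).1 h
    exact ⟨fun i => (b i).1, fun i => (b i).2, hb⟩
  · rintro ⟨b, hb, rfl⟩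
    exact Submodule.sum_mem _ fun i _ =>
      smul_mem_cone (hb i) (Submodule.subset_span (Set.mem_range_self i))

theorem genFace_le (S : Set E) (hS : S ⊆ K) : genFace K S ≤ K :=
  sInf_le ⟨PointedCone.IsFaceOf.refl K, hS⟩

/-- The vectors `z ∈ K` with `ε z ≤ y` for some positive `ε`. -/
def dominatedFace (K : PointedCone ℝ E) (y : E) : PointedCone ℝ E where
  carrier := {z | z ∈ K ∧ ∃ ε : ℝ, 0 < ε ∧ y - ε • z ∈ K} ∪ {0}
  zero_mem' := Or.inr rfl
  add_mem' := by
    rintro a b (⟨ha, ε, hε, h⟩ | rfl) (⟨hb, δ, hδ, h'⟩ | rfl)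
    · left
      refine ⟨K.add_mem ha hb, ε * δ / (ε + δ), by positivity, ?_⟩
      have : y - (ε * δ / (ε + δ)) • (a + b) =
          (δ / (ε + δ)) • (y - ε • a) + (ε / (ε + δ)) • (y - δ • b) := by
        match_scalars <;> field_simp
        ring
      rw [this]
      exact K.add_mem (smul_mem_cone (by positivity) h) (smul_mem_cone (by positivity) h')
    · left; rw [add_zero]; exact ⟨ha, ε, hε, h⟩
    · left; rw [zero_add]; exact ⟨hb, δ, hδ, h'⟩
    · right; simp
  smul_mem' := by
    rintro ⟨r, hr⟩ a (⟨ha, ε, hε, h⟩ | rfl)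
    · rcases hr.eq_or_lt with rfl | hr'
      · right
        exact zero_smul ℝ a
      · left
        refine ⟨smul_mem_cone hr ha, ε / r, by positivity, ?_⟩
        have : (ε / r) • ((⟨r, hr⟩ : {r : ℝ // 0 ≤ r}) • a) = ε • a := by
          change (ε / r) • (r • a) = _
          rw [smul_smul]; congr 1; field_simp
        rw [this]; exact h
    · right; simp

theorem mem_genFace_iff {y z : E} (hy : y ∈ K) :
    z ∈ genFace K {y} ↔ z ∈ K ∧ ∃ ε : ℝ, 0 < ε ∧ y - ε • z ∈ K := by
  constructor
  · intro h
    have hF : (dominatedFace K y).IsFaceOf K := by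
      constructor
      · rintro z (⟨hz, -⟩ | rfl)
        · exact hz
        · exact K.zero_mem
      · rintro u v a hu hv ha (⟨h, ε, hε, h'⟩ | h)
        · left
          refine ⟨hu, ε * a, by positivity, ?_⟩
          have : y - (ε * a) • u = (y - ε • (a • u + v)) + ε • v := by module
          rw [this]
          exact K.add_mem h' (smul_mem_cone hε.le hv)
        · left
          refine ⟨hu, a, ha, ?_⟩
          have h0 : a • u + v = 0 := h
          have : y - a • u = y + v := by rw [eq_neg_of_add_eq_zero_left h0]; abel
          rw [this]
          exact K.add_mem hy hv
    have hy' : y ∈ dominatedFace K y := by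
      left
      exact ⟨hy, 1, one_pos, by simp⟩
    have hle : genFace K {y} ≤ dominatedFace K y :=
      sInf_le ⟨hF, by simpa using hy'⟩
    rcases hle h with h | h
    · exact h
    · have : z = 0 := h
      subst this
      exact ⟨K.zero_mem, 1, one_pos, by simpa using hy⟩
  · rintro ⟨hz, ε, hε, h⟩
    refine Submodule.mem_sInf.2 ?_
    rintro F ⟨hF, hyF⟩
    refine hF.mem_of_smul_add_mem hz h hε ?_
    have : ε • z + (y - ε • z) = y := by abel
    rw [this]
    exact hyF rfl

theorem self_mem_genFace (y : E) : y ∈ genFace K {y} := by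
  refine Submodule.mem_sInf.2 ?_
  rintro F ⟨-, hyF⟩
  exact hyF rfl

theorem genFace_isFaceOf {y : E} (hy : y ∈ K) : (genFace K {y}).IsFaceOf K := by
  refine ⟨genFace_le _ (by simpa using hy), fun {u v a} hu hv ha h => ?_⟩
  refine Submodule.mem_sInf.2 ?_
  rintro F ⟨hF, hyF⟩
  exact hF.mem_of_smul_add_mem hu hv ha (Submodule.mem_sInf.1 h F ⟨hF, hyF⟩)

theorem genFace_le_genFace_iff {y z : E} (hy : y ∈ K) :
    genFace K {z} ≤ genFace K {y} ↔ z ∈ genFace K {y} := by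
  constructor
  · intro h
    exact h (self_mem_genFace z)
  · intro h
    exact sInf_le ⟨genFace_isFaceOf hy, by simpa using h⟩

theorem isExtremeVector_iff {x : E} :
    IsExtremeVector K x ↔ x ∈ K ∧ x ≠ 0 ∧ ∀ y ∈ K, x - y ∈ K → ∃ a : ℝ, 0 ≤ a ∧ a • x = y := by
  constructor
  · rintro ⟨hx, h0, h⟩
    refine ⟨hx, h0, fun y hy hxy => ?_⟩
    rw [← mem_hull_singleton_iff, ← h, mem_genFace_iff hx]
    exact ⟨hy, 1, one_pos, by simpa using hxy⟩
  · rintro ⟨hx, h0, h⟩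
    refine ⟨hx, h0, le_antisymm (fun z hz => ?_) ?_⟩
    · rw [mem_genFace_iff hx] at hz
      obtain ⟨hz, ε, hε, h'⟩ := hz
      obtain ⟨a, ha, e⟩ := h _ (smul_mem_cone hε.le hz) h'
      rw [mem_hull_singleton_iff]
      refine ⟨a / ε, by positivity, ?_⟩
      rw [div_eq_inv_mul, mul_smul, e, smul_smul, inv_mul_cancel₀ hε.ne', one_smul]
    · refine Submodule.span_le.2 ?_
      simpa using self_mem_genFace x

theorem hull_singleton_smul {x : E} {a : ℝ} (ha : 0 < a) :
    PointedCone.hull ℝ {a • x} = PointedCone.hull ℝ {x} := by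
  ext y
  simp only [mem_hull_singleton_iff]
  constructor
  · rintro ⟨b, hb, rfl⟩
    exact ⟨b * a, by positivity, by rw [mul_smul]⟩
  · rintro ⟨b, hb, rfl⟩
    exact ⟨b / a, by positivity, by rw [smul_smul]; congr 1; field_simp⟩

theorem hull_singleton_eq_iff {x y : E} (hx : x ≠ 0) :
    PointedCone.hull ℝ {x} = PointedCone.hull ℝ {y} ↔ ∃ a : ℝ, 0 < a ∧ x = a • y := by
  constructor
  · intro h
    have : x ∈ PointedCone.hull ℝ {y} := h ▸ Submodule.mem_span_singleton_self x
    obtain ⟨a, ha, e⟩ := mem_hull_singleton_iff.1 this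
    refine ⟨a, lt_of_le_of_ne ha ?_, e.symm⟩
    rintro rfl
    exact hx (by rw [← e, zero_smul])
  · rintro ⟨a, ha, rfl⟩
    exact hull_singleton_smul ha

theorem IsExtremeVector.smul {x : E} (hx : IsExtremeVector K x) {a : ℝ} (ha : 0 < a) :
    IsExtremeVector K (a • x) := by
  rw [isExtremeVector_iff] at hx ⊢
  obtain ⟨h1, h2, h3⟩ := hx
  refine ⟨smul_mem_cone ha.le h1, smul_ne_zero ha.ne' h2, fun y hy hxy => ?_⟩
  obtain ⟨b, hb, e⟩ := h3 (a⁻¹ • y) (smul_mem_cone (by positivity) hy) (by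
    have : x - a⁻¹ • y = a⁻¹ • (a • x - y) := by
      rw [smul_sub, smul_smul, inv_mul_cancel₀ ha.ne', one_smul]
    rw [this]
    exact smul_mem_cone (by positivity) hxy)
  refine ⟨b, hb, ?_⟩
  rw [smul_comm, e, smul_smul, mul_inv_cancel₀ ha.ne', one_smul]

/-- In a sum of two vectors of `K` that is extreme, both terms are multiples of the sum. -/
theorem IsExtremeVector.of_add {x y z : E} (hx : IsExtremeVector K x) (hy : y ∈ K) (hz : z ∈ K)
    (h : y + z = x) : ∃ a : ℝ, 0 ≤ a ∧ a • x = y :=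
  (isExtremeVector_iff.1 hx).2.2 y hy (by rw [← h]; simpa using hz)

end ConeBasics

/-- The relation `∑ cᵢ xᵢ = 0` is, up to scalar factors, the only linear relation between the
vectors `xᵢ`, and it has at least two terms on each of its two sides. -/
structure MinimalSystem {E ι : Type*} [AddCommGroup E] [Module ℝ E] [Fintype ι]
    (x : ι → E) (c : ι → ℝ) : Prop where
  rel : ∑ i, c i • x i = 0
  unique : ∀ d : ι → ℝ, ∑ i, d i • x i = 0 → ∃ t : ℝ, ∀ i, d i = t * c i
  pos : ∃ i j, i ≠ j ∧ 0 < c i ∧ 0 < c j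
  neg : ∃ i j, i ≠ j ∧ c i < 0 ∧ c j < 0

namespace MinimalSystem

theorem mem {E ι : Type*} [AddCommGroup E] [Module ℝ E] {x : ι → E} (i : ι) :
    x i ∈ PointedCone.hull ℝ (Set.range x) :=
  Submodule.subset_span (Set.mem_range_self i)

variable {E ι : Type*} [AddCommGroup E] [Module ℝ E] [Fintype ι] {x : ι → E} {c : ι → ℝ}

theorem eq_add_mul (S : MinimalSystem x c) {b b' : ι → ℝ}
    (h : ∑ i, b i • x i = ∑ i, b' i • x i) : ∃ t : ℝ, ∀ i, b i = b' i + t * c i := by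
  obtain ⟨t, ht⟩ := S.unique (fun i => b i - b' i) (by simp [sub_smul, h])
  exact ⟨t, fun i => by linarith [ht i]⟩

theorem sum_add_mul (S : MinimalSystem x c) (b : ι → ℝ) (t : ℝ) :
    ∑ i, (b i + t * c i) • x i = ∑ i, b i • x i := by
  simp only [add_smul, Finset.sum_add_distrib, mul_smul, ← Finset.smul_sum, S.rel, smul_zero,
    add_zero]

theorem comp_equiv {κ : Type*} [Fintype κ] (S : MinimalSystem x c) (e : κ ≃ ι) :
    MinimalSystem (x ∘ e) (c ∘ e) where
  rel := by rw [← S.rel]; exact e.sum_comp (fun i => c i • x i)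
  unique d hd := by
    obtain ⟨t, ht⟩ := S.unique (d ∘ e.symm) (by
      rw [← hd, ← e.sum_comp]; simp)
    exact ⟨t, fun i => by simpa using ht (e i)⟩
  pos := by
    obtain ⟨i, j, h, hi, hj⟩ := S.pos
    exact ⟨e.symm i, e.symm j, by simpa using h, by simpa using hi, by simpa using hj⟩
  neg := by
    obtain ⟨i, j, h, hi, hj⟩ := S.neg
    exact ⟨e.symm i, e.symm j, by simpa using h, by simpa using hi, by simpa using hj⟩

theorem exists_pos_ne (S : MinimalSystem x c) (i : ι) : ∃ j, j ≠ i ∧ 0 < c j := by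
  obtain ⟨j, k, h, hj, hk⟩ := S.pos
  by_cases hji : j = i
  · exact ⟨k, fun e => h (hji.trans e.symm), hk⟩
  · exact ⟨j, hji, hj⟩

theorem exists_neg_ne (S : MinimalSystem x c) (i : ι) : ∃ j, j ≠ i ∧ c j < 0 := by
  obtain ⟨j, k, h, hj, hk⟩ := S.neg
  by_cases hji : j = i
  · exact ⟨k, fun e => h (hji.trans e.symm), hk⟩
  · exact ⟨j, hji, hj⟩

/-- A representation with nonnegative coefficients is unique if some coefficients
vanish on both sides of the relation. -/
theorem rep_unique (S : MinimalSystem x c) {b b' : ι → ℝ} (hb' : ∀ i, 0 ≤ b' i)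
    (h : ∑ i, b' i • x i = ∑ i, b i • x i) {p q : ι} (hp : b p = 0) (hq : b q = 0)
    (hcp : 0 < c p) (hcq : c q < 0) : b' = b := by
  obtain ⟨t, ht⟩ := S.eq_add_mul h
  have h1 := hb' p
  have h2 := hb' q
  rw [ht, hp] at h1
  rw [ht, hq] at h2
  have ht0 : t = 0 := by
    apply le_antisymm
    · by_contra! h; nlinarith
    · by_contra! h; nlinarith
  ext i
  rw [ht, ht0]; ring

theorem rep_single_unique (S : MinimalSystem x c) {b : ι → ℝ} (hb : ∀ i, 0 ≤ b i) {k : ι} {a : ℝ}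
    (h : ∑ i, b i • x i = a • x k) {i : ι} (hi : i ≠ k) : b i = 0 := by
  classical
  obtain ⟨p, hp, hcp⟩ := S.exists_pos_ne k
  obtain ⟨q, hq, hcq⟩ := S.exists_neg_ne k
  have := S.rep_unique (b := Pi.single k a) hb (by
    rw [h, Finset.sum_eq_single k] <;> simp +contextual) (p := p) (q := q)
    (by simp [hp]) (by simp [hq]) hcp hcq
  rw [this]; simp [hi]

theorem isPointed (S : MinimalSystem x c) : IsPointed (PointedCone.hull ℝ (Set.range x)) := by
  intro y hy hy'
  obtain ⟨b, hb, rfl⟩ := mem_hull_range_iff.1 hy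
  obtain ⟨b', hb', e⟩ := mem_hull_range_iff.1 hy'
  obtain ⟨p, -, -, hcp, -⟩ := S.pos
  obtain ⟨q, -, -, hcq, -⟩ := S.neg
  have h0 : ∑ i, (b i + b' i) • x i = ∑ i, (0 : ι → ℝ) i • x i := by
    simp [add_smul, Finset.sum_add_distrib, e]
  have := S.rep_unique (b' := fun i => b i + b' i) (fun i => add_nonneg (hb i) (hb' i)) h0
    (p := p) (q := q) rfl rfl hcp hcq
  have hb0 : ∀ i, b i = 0 := fun i => by
    have := congrFun this i
    simp only [Pi.zero_apply] at this
    linarith [hb i, hb' i]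
  simp [hb0]

theorem ne_zero (S : MinimalSystem x c) (i : ι) : x i ≠ 0 := by
  classical
  intro h
  obtain ⟨p, hp, hcp⟩ := S.exists_pos_ne i
  obtain ⟨t, ht⟩ := S.unique (Pi.single i 1) (by
    rw [Finset.sum_eq_single i] <;> simp +contextual [h])
  have h1 := ht p
  have h2 := ht i
  simp only [Pi.single_apply, hp, if_false, if_true] at h1 h2
  have : t = 0 := by
    rcases mul_eq_zero.1 h1.symm with h | h
    · exact h
    · exact absurd h hcp.ne'
  rw [this] at h2; simp at h2

theorem isExtremeVector (S : MinimalSystem x c) (i : ι) :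
    IsExtremeVector (PointedCone.hull ℝ (Set.range x)) (x i) := by
  rw [isExtremeVector_iff]
  refine ⟨mem i, S.ne_zero i, fun y hy hxy => ?_⟩
  obtain ⟨b, hb, rfl⟩ := mem_hull_range_iff.1 hy
  obtain ⟨b', hb', e⟩ := mem_hull_range_iff.1 hxy
  refine ⟨b i, hb i, ?_⟩
  have h0 : ∀ j, j ≠ i → b j = 0 := fun j hj => by
    have := S.rep_single_unique (b := fun i => b i + b' i) (k := i) (a := 1)
      (fun i => add_nonneg (hb i) (hb' i)) (by simp [add_smul, Finset.sum_add_distrib, e]) hj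
    linarith [hb j, hb' j]
  rw [Finset.sum_eq_single i] <;> simp +contextual [h0]

theorem exists_eq_smul_of_isExtremeVector {y : E}
    (hy : IsExtremeVector (PointedCone.hull ℝ (Set.range x)) y) :
    ∃ i, ∃ a : ℝ, 0 < a ∧ y = a • x i := by
  classical
  obtain ⟨h1, h2, h3⟩ := isExtremeVector_iff.1 hy
  obtain ⟨b, hb, e⟩ := mem_hull_range_iff.1 h1
  obtain ⟨i, hi⟩ : ∃ i, b i • x i ≠ 0 := by
    by_contra! h
    exact h2 (by rw [← e]; exact Finset.sum_eq_zero fun i _ => h i)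
  obtain ⟨a, ha, e'⟩ := h3 (b i • x i) (smul_mem_cone (hb i) (mem i)) (by
    have : y - b i • x i = ∑ j ∈ Finset.univ.erase i, b j • x j := by
      rw [← e, ← Finset.add_sum_erase _ _ (Finset.mem_univ i)]; abel
    rw [this]
    exact Submodule.sum_mem _ fun j _ => smul_mem_cone (hb j) (mem j))
  have ha0 : a ≠ 0 := by rintro rfl; exact hi (by rw [← e', zero_smul])
  have hb0 : b i ≠ 0 := by intro h; exact hi (by rw [h, zero_smul])
  have ha' := lt_of_le_of_ne ha ha0.symm
  have hb' := lt_of_le_of_ne (hb i) hb0.symm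
  refine ⟨i, b i / a, by positivity, ?_⟩
  rw [div_eq_inv_mul, mul_smul, ← e', smul_smul, inv_mul_cancel₀ ha0, one_smul]

theorem smul_injective (S : MinimalSystem x c) {i j : ι} {a : ℝ} (h : x i = a • x j) : i = j := by
  classical
  by_contra hij
  have := S.rep_single_unique (b := Pi.single i 1) (k := j) (a := a) (fun k => by
    by_cases hj : k = i
    · subst hj; simp
    · simp [hj]) (by
      rw [← h, Finset.sum_eq_single i] <;> simp +contextual) hij
  simp at this

theorem extremeRays_eq (S : MinimalSystem x c) :
    extremeRays (PointedCone.hull ℝ (Set.range x)) =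
      Set.range fun i => PointedCone.hull ℝ {x i} := by
  ext F
  constructor
  · rintro ⟨y, hy, rfl⟩
    obtain ⟨i, a, ha, rfl⟩ := exists_eq_smul_of_isExtremeVector hy
    exact ⟨i, by rw [hy.2.2, hull_singleton_smul ha]⟩
  · rintro ⟨i, rfl⟩
    exact ⟨x i, S.isExtremeVector i, (S.isExtremeVector i).2.2.symm⟩

theorem hull_injective (S : MinimalSystem x c) :
    Function.Injective fun i => PointedCone.hull ℝ {x i} := by
  intro i j h
  obtain ⟨a, -, e⟩ := (hull_singleton_eq_iff (S.ne_zero i)).1 h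
  exact S.smul_injective e

/-- The labelling of the extreme rays of the cone by the index set. -/
noncomputable def rayEquiv (S : MinimalSystem x c) :
    ι ≃ extremeRays (PointedCone.hull ℝ (Set.range x)) :=
  (Equiv.ofInjective _ S.hull_injective).trans (Equiv.setCongr S.extremeRays_eq.symm)

theorem coe_rayEquiv (S : MinimalSystem x c) (i : ι) :
    (S.rayEquiv i : PointedCone ℝ E) = PointedCone.hull ℝ {x i} := rfl

theorem finite_extremeRays (S : MinimalSystem x c) :
    (extremeRays (PointedCone.hull ℝ (Set.range x))).Finite := by
  rw [S.extremeRays_eq]; exact Set.finite_range _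

theorem ncard_extremeRays (S : MinimalSystem x c) :
    (extremeRays (PointedCone.hull ℝ (Set.range x))).ncard = Fintype.card ι := by
  rw [← Nat.card_coe_set_eq, ← Nat.card_congr S.rayEquiv, Nat.card_eq_fintype_card]

theorem span_hull_range :
    Submodule.span ℝ (PointedCone.hull ℝ (Set.range x) : Set E) =
      Submodule.span ℝ (Set.range x) := by
  apply le_antisymm
  · refine Submodule.span_le.2 fun y hy => ?_
    obtain ⟨b, -, rfl⟩ := mem_hull_range_iff.1 hy
    exact Submodule.sum_mem _ fun i _ =>
      Submodule.smul_mem _ _ (Submodule.subset_span (Set.mem_range_self i))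
  · exact Submodule.span_mono Submodule.subset_span

theorem coneDim_eq (S : MinimalSystem x c) :
    coneDim (PointedCone.hull ℝ (Set.range x)) + 1 = Fintype.card ι := by
  rw [coneDim, span_hull_range, ← Fintype.range_linearCombination ℝ]
  have h := LinearMap.finrank_range_add_finrank_ker (Fintype.linearCombination ℝ x)
  have hk : LinearMap.ker (Fintype.linearCombination ℝ x) = Submodule.span ℝ {c} := by
    ext d
    rw [LinearMap.mem_ker, Fintype.linearCombination_apply, Submodule.mem_span_singleton]
    constructor
    · intro h
      obtain ⟨t, ht⟩ := S.unique d h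
      exact ⟨t, by ext i; simp [ht]⟩
    · rintro ⟨t, rfl⟩
      have := S.sum_add_mul 0 t
      simpa using this
  have hc : c ≠ 0 := by
    obtain ⟨i, -, -, hi, -⟩ := S.pos
    intro h
    rw [h] at hi; simp at hi
  rw [hk, finrank_span_singleton hc] at h
  rw [h, Module.finrank_fintype_fun_eq_card]

end MinimalSystem
end KCone

namespace KCone

section Topology

variable {E : Type*} [NormedAddCommGroup E] [NormedSpace ℝ E]

theorem exists_sub_smul_mem_of_mem_interior {K : PointedCone ℝ E} {y : E}
    (hy : y ∈ interior (K : Set E)) (z : E) : ∃ ε : ℝ, 0 < ε ∧ y - ε • z ∈ K := by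
  have hc : Filter.Tendsto (fun ε : ℝ => y - ε • z) (nhdsWithin 0 (Set.Ioi 0)) (nhds y) := by
    have : Continuous (fun ε : ℝ => y - ε • z) := by fun_prop
    have h := this.tendsto 0
    simp only [zero_smul, sub_zero] at h
    exact h.mono_left nhdsWithin_le_nhds
  have h1 := hc.eventually (mem_interior_iff_mem_nhds.1 hy)
  have h2 : ∀ᶠ ε : ℝ in nhdsWithin 0 (Set.Ioi 0), 0 < ε := eventually_mem_nhdsWithin
  obtain ⟨ε, h, h'⟩ := (h1.and h2).exists
  exact ⟨ε, h', h⟩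

theorem add_mem_interior {K : PointedCone ℝ E} {y z : E}
    (hy : y ∈ interior (K : Set E)) (hz : z ∈ K) : y + z ∈ interior (K : Set E) := by
  have h : (fun w => w + z) '' interior (K : Set E) ⊆ interior (K : Set E) := by
    apply interior_maximal
    · rintro _ ⟨w, hw, rfl⟩
      exact K.add_mem (interior_subset hw) hz
    · exact (Homeomorph.addRight z).isOpenMap _ isOpen_interior
  exact h ⟨y, hy, rfl⟩

theorem smul_mem_interior {K : PointedCone ℝ E} {y : E} {a : ℝ} (ha : 0 < a)
    (hy : y ∈ interior (K : Set E)) : a • y ∈ interior (K : Set E) := by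
  have h : (fun w => a • w) '' interior (K : Set E) ⊆ interior (K : Set E) := by
    apply interior_maximal
    · rintro _ ⟨w, hw, rfl⟩
      exact smul_mem_cone ha.le (interior_subset hw)
    · exact (isOpenMap_smul₀ ha.ne') _ isOpen_interior
  exact h ⟨y, hy, rfl⟩

theorem mem_interior_of_sub_smul_mem {K : PointedCone ℝ E} {y z : E} {ε : ℝ} (hε : 0 < ε)
    (hz : z ∈ interior (K : Set E)) (h : y - ε • z ∈ K) : y ∈ interior (K : Set E) := by
  have := add_mem_interior (smul_mem_interior hε hz) h
  simpa using this

/-- A closed pointed cone has a linear functional that is positive on its nonzero vectors. -/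
theorem exists_strictlyPositive [FiniteDimensional ℝ E] {K : PointedCone ℝ E}
    (hK : IsClosed (K : Set E)) (hp : IsPointed K) :
    ∃ (f : E →L[ℝ] ℝ) (u : ℝ), 0 < u ∧ ∀ y ∈ K, u * ‖y‖ ≤ f y := by
  have : ProperSpace E := FiniteDimensional.proper ℝ E
  set S : Set E := (K : Set E) ∩ Metric.sphere 0 1 with hS
  have hSc : IsCompact S := (isCompact_sphere 0 1).inter_left hK
  have hS0 : ∀ y ∈ S, y ≠ 0 := by
    rintro y ⟨-, hy⟩ rfl
    simp at hy
  have hex : ∀ y ∈ S, ∃ f : E →L[ℝ] ℝ, (∀ z ∈ K, 0 ≤ f z) ∧ 0 < f y := by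
    intro y hy
    have hny : -y ∉ K := fun h => hS0 y hy (hp y hy.1 h)
    obtain ⟨f, hf, hf'⟩ := ProperCone.hyperplane_separation_point (⟨K, hK⟩ : ProperCone ℝ E) hny
    rw [map_neg] at hf'
    exact ⟨f, hf, by linarith⟩
  choose! g hg using hex
  obtain ⟨t, htS⟩ := hSc.elim_nhds_subcover' (fun y _ => {z | 0 < g y z}) (fun y hy =>
    (isOpen_lt continuous_const (g y).continuous).mem_nhds (hg y hy).2)
  set f : E →L[ℝ] ℝ := ∑ y ∈ t, g y with hfdef
  have hf0 : ∀ z ∈ S, 0 < f z := by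
    intro z hz
    obtain ⟨y, hyt, hy⟩ := Set.mem_iUnion₂.1 (htS hz)
    rw [hfdef, sum_apply]
    exact Finset.sum_pos' (fun w _ => (hg w w.2).1 z hz.1) ⟨y, hyt, hy⟩
  obtain ⟨u, hu, hf⟩ : ∃ u : ℝ, 0 < u ∧ ∀ z ∈ S, u ≤ f z := by
    rcases S.eq_empty_or_nonempty with h | h
    · exact ⟨1, one_pos, by simp [h]⟩
    · obtain ⟨w, hw, hmin⟩ := hSc.exists_isMinOn h f.continuous.continuousOn
      exact ⟨f w, hf0 w hw, fun z hz => hmin hz⟩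
  refine ⟨f, u, hu, fun y hy => ?_⟩
  by_cases hy0 : y = 0
  · simp [hy0]
  have hn : 0 < ‖y‖ := norm_pos_iff.2 hy0
  have := hf (‖y‖⁻¹ • y) ⟨smul_mem_cone (by positivity) hy, by
    simp [norm_smul, hn.ne']⟩
  rw [map_smul, smul_eq_mul, le_inv_mul_iff₀ hn] at this
  linarith

/-- A closed pointed cone with finitely many extreme rays is generated by its extreme vectors. -/
theorem le_hull_extremeVectors [FiniteDimensional ℝ E] {K : PointedCone ℝ E}
    (hK : IsClosed (K : Set E)) (hp : IsPointed K) (hfin : (extremeRays K).Finite) :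
    K ≤ PointedCone.hull ℝ {x | IsExtremeVector K x} := by
  have : ProperSpace E := FiniteDimensional.proper ℝ E
  obtain ⟨f, u, hu, hf⟩ := exists_strictlyPositive hK hp
  have hf0 : ∀ y ∈ K, 0 ≤ f y := fun y hy => le_trans (by positivity) (hf y hy)
  have hfz : ∀ y ∈ K, f y ≤ 0 → y = 0 := fun y hy h => by
    have := hf y hy
    by_contra h0
    have : 0 < u * ‖y‖ := mul_pos hu (norm_pos_iff.2 h0)
    linarith
  set B : Set E := (K : Set E) ∩ {y | f y = 1} with hB
  have hBc : IsCompact B := by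
    apply Metric.isCompact_of_isClosed_isBounded
    · exact hK.inter (isClosed_eq f.continuous continuous_const)
    · refine (Metric.isBounded_closedBall (x := (0 : E)) (r := 1 / u)).subset ?_
      rintro y ⟨hy, hy1⟩
      have h1 : f y = 1 := hy1
      have := hf y hy
      rw [mem_closedBall_zero_iff, le_div_iff₀ hu]
      linarith
  have hBconv : Convex ℝ B := by
    refine K.convex.inter ?_
    exact convex_hyperplane f.toLinearMap.isLinear 1
  have hext : ∀ p ∈ B.extremePoints ℝ, IsExtremeVector K p := by
    rintro p ⟨⟨hpK, hp1⟩, hpe⟩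
    have hp1 : f p = 1 := hp1
    rw [isExtremeVector_iff]
    refine ⟨hpK, by rintro rfl; simp at hp1, fun y hy hpy => ?_⟩
    have hs := hf0 y hy
    have hs' := hf0 _ hpy
    rw [map_sub, hp1] at hs'
    rcases hs.eq_or_lt with h | h
    · exact ⟨0, le_rfl, by rw [zero_smul, hfz y hy h.ge]⟩
    rcases hs'.eq_or_lt with h' | h'
    · refine ⟨1, zero_le_one, ?_⟩
      have := hfz _ hpy (by rw [map_sub, hp1]; exact h'.ge)
      rw [one_smul]; exact sub_eq_zero.1 this
    refine ⟨f y, hs, ?_⟩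
    have key := hpe (x₁ := (f y)⁻¹ • y) ⟨smul_mem_cone (by positivity) hy, by
        simp [h.ne']⟩ (x₂ := (1 - f y)⁻¹ • (p - y)) ⟨smul_mem_cone (by positivity) hpy, by
        simp [hp1, h'.ne']⟩
        ⟨f y, 1 - f y, h, h', by ring, by
          rw [smul_smul, smul_smul, mul_inv_cancel₀ h.ne', mul_inv_cancel₀ h'.ne']
          simp⟩
    rw [← key, smul_smul, mul_inv_cancel₀ h.ne', one_smul]
  have hefin : (B.extremePoints ℝ).Finite := by
    refine Set.Finite.of_finite_image (f := fun p => genFace K {p}) (hfin.subset ?_) ?_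
    · rintro _ ⟨p, hp, rfl⟩
      exact ⟨p, hext p hp, rfl⟩
    · intro p hp' q hq h
      have h : genFace K {p} = genFace K {q} := h
      rw [(hext p hp').2.2, (hext q hq).2.2] at h
      obtain ⟨a, -, e⟩ := (hull_singleton_eq_iff (hext p hp').2.1).1 h
      have h1 : f p = 1 := hp'.1.2
      have h2 : f q = 1 := hq.1.2
      rw [e, map_smul, h2] at h1
      simp only [smul_eq_mul, mul_one] at h1
      rw [e, h1, one_smul]
  have hKM := closure_convexHull_extremePoints hBc hBconv
  rw [(hefin.isCompact_convexHull ℝ).isClosed.closure_eq] at hKM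
  have hle : B ⊆ PointedCone.hull ℝ {x | IsExtremeVector K x} := by
    rw [← hKM]
    refine convexHull_min (fun p hp' => Submodule.subset_span (hext p hp'))
      (PointedCone.convex _)
  intro y hy
  by_cases hy0 : y = 0
  · rw [hy0]; exact Submodule.zero_mem _
  have hpos : 0 < f y := by
    by_contra! h
    exact hy0 (hfz y hy h)
  have : y = f y • ((f y)⁻¹ • y) := by rw [smul_smul, mul_inv_cancel₀ hpos.ne', one_smul]
  rw [this]
  exact smul_mem_cone hpos.le (hle ⟨smul_mem_cone (by positivity) hy, by simp [hpos.ne']⟩)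

theorem exists_two_pos {ι : Type*} [Fintype ι] {K : PointedCone ℝ E} (hp : IsPointed K)
    {x : ι → E} (hx : ∀ i, IsExtremeVector K (x i))
    (hinj : ∀ i j (a : ℝ), x i = a • x j → i = j) {c : ι → ℝ} (hc : c ≠ 0)
    (h : ∑ i, c i • x i = 0) : ∃ i j, i ≠ j ∧ 0 < c i ∧ 0 < c j := by
  classical
  have hsum : ∀ i, c i • x i = ∑ j ∈ Finset.univ.erase i, (- c j) • x j := fun i => by
    rw [← Finset.add_sum_erase _ _ (Finset.mem_univ i)] at h
    rw [eq_neg_of_add_eq_zero_left h, ← Finset.sum_neg_distrib]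
    simp
  obtain ⟨p, hpos⟩ : ∃ p, 0 < c p := by
    by_contra! hn
    obtain ⟨i, hi⟩ : ∃ i, c i ≠ 0 := by
      by_contra! h'
      exact hc (funext h')
    have : (-c i) • x i = 0 := hp _ (smul_mem_cone (by linarith [hn i]) (hx i).1) (by
      rw [neg_smul, neg_neg, hsum]
      exact Submodule.sum_mem _ fun j _ => smul_mem_cone (by linarith [hn j]) (hx j).1)
    rcases smul_eq_zero.1 this with h' | h'
    · exact hi (by linarith)
    · exact (hx i).2.1 h'
  by_contra! hn
  have hle : ∀ j, j ≠ p → c j ≤ 0 := fun j hj => hn p j hj.symm hpos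
  obtain ⟨q, hq, hcq⟩ : ∃ q, q ≠ p ∧ c q < 0 := by
    by_contra! h'
    have := hsum p
    rw [Finset.sum_eq_zero fun j hj => by
      have hj := Finset.ne_of_mem_erase hj
      rw [le_antisymm (hle j hj) (h' j hj)]; simp] at this
    rcases smul_eq_zero.1 this with h'' | h''
    · linarith
    · exact (hx p).2.1 h''
  obtain ⟨a, ha, e⟩ := ((hx p).smul hpos).of_add (y := (- c q) • x q)
    (z := ∑ j ∈ (Finset.univ.erase p).erase q, (- c j) • x j)
    (smul_mem_cone (by linarith) (hx q).1)
    (Submodule.sum_mem _ fun j hj => smul_mem_cone (by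
      linarith [hle j (Finset.ne_of_mem_erase (Finset.mem_of_mem_erase hj))]) (hx j).1) (by
      rw [hsum p, Finset.add_sum_erase _ (fun j => (- c j) • x j)]
      exact Finset.mem_erase.2 ⟨hq, Finset.mem_univ q⟩)
  refine hq (hinj q p ((- c q)⁻¹ * (a * c p)) ?_)
  rw [mul_smul, mul_smul, e, smul_smul, inv_mul_cancel₀ (by linarith), one_smul]

/-- One vector on each extreme ray. -/
def IsRaySystem (K : PointedCone ℝ E) {ι : Type*} (e : ι ≃ extremeRays K) (x : ι → E) : Prop :=
  ∀ i, IsExtremeVector K (x i) ∧ genFace K {x i} = (e i : PointedCone ℝ E)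

theorem exists_isRaySystem {K : PointedCone ℝ E} {ι : Type*} (e : ι ≃ extremeRays K) :
    ∃ x : ι → E, IsRaySystem K e x := by
  choose x hx using fun i => (e i).2
  exact ⟨x, fun i => ⟨(hx i).1, (hx i).2.symm⟩⟩

theorem IsRaySystem.eq_of_smul {K : PointedCone ℝ E} {ι : Type*} {e : ι ≃ extremeRays K}
    {x : ι → E} (hx : IsRaySystem K e x) (i j : ι) (a : ℝ) (hp : IsPointed K)
    (h : x i = a • x j) : i = j := by
  have ha : 0 < a := by
    by_contra! ha
    refine (hx i).1.2.1 (hp _ (hx i).1.1 ?_)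
    rw [h, ← neg_smul]
    exact smul_mem_cone (by linarith) (hx j).1.1
  apply e.injective
  apply Subtype.ext
  rw [← (hx i).2, ← (hx j).2, (hx i).1.2.2, (hx j).1.2.2, h, hull_singleton_smul ha]

theorem IsMinimalCone.eq_hull [FiniteDimensional ℝ E] {K : PointedCone ℝ E}
    (hK : IsMinimalCone K) {ι : Type*} {e : ι ≃ extremeRays K} {x : ι → E}
    (hx : IsRaySystem K e x) : K = PointedCone.hull ℝ (Set.range x) := by
  apply le_antisymm
  · refine (le_hull_extremeVectors hK.1 hK.2.1 hK.2.2.1).trans (Submodule.span_le.2 ?_)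
    intro y hy
    obtain ⟨i, hi⟩ := e.surjective ⟨genFace K {y}, y, hy, rfl⟩
    have h : genFace K {x i} = genFace K {y} := by rw [(hx i).2, hi]
    rw [(hx i).1.2.2, hy.2.2] at h
    obtain ⟨a, ha, e'⟩ := (hull_singleton_eq_iff hy.2.1).1 h.symm
    rw [e']
    exact smul_mem_cone ha.le (Submodule.subset_span (Set.mem_range_self i))
  · refine Submodule.span_le.2 ?_
    rintro _ ⟨i, rfl⟩
    exact (hx i).1.1

theorem IsMinimalCone.exists_minimalSystem [FiniteDimensional ℝ E] {K : PointedCone ℝ E}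
    (hK : IsMinimalCone K) {ι : Type*} [Fintype ι] {e : ι ≃ extremeRays K} {x : ι → E}
    (hx : IsRaySystem K e x) : ∃ c : ι → ℝ, MinimalSystem x c := by
  have hcard : Fintype.card ι = coneDim K + 1 := by
    rw [← hK.2.2.2, ← Nat.card_coe_set_eq, ← Nat.card_congr e, Nat.card_eq_fintype_card]
  rw [coneDim, hK.eq_hull hx, MinimalSystem.span_hull_range,
    ← Fintype.range_linearCombination ℝ] at hcard
  have h := LinearMap.finrank_range_add_finrank_ker (Fintype.linearCombination ℝ x)
  rw [Module.finrank_fintype_fun_eq_card, hcard] at h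
  obtain ⟨⟨c, hcm⟩, hc0, hc⟩ := finrank_eq_one_iff'.1 (Nat.add_left_cancel h)
  rw [LinearMap.mem_ker, Fintype.linearCombination_apply] at hcm
  have hc0 : c ≠ 0 := fun h => hc0 (Subtype.ext h)
  refine ⟨c, hcm, fun d hd => ?_, ?_, ?_⟩
  · obtain ⟨t, ht⟩ := hc ⟨d, by rwa [LinearMap.mem_ker, Fintype.linearCombination_apply]⟩
    have ht : t • c = d := congrArg Subtype.val ht
    exact ⟨t, fun i => by rw [← ht]; rfl⟩
  · exact exists_two_pos hK.2.1 (fun i => (hx i).1)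
      (fun i j a h => hx.eq_of_smul i j a hK.2.1 h) hc0 hcm
  · obtain ⟨i, j, h1, h2, h3⟩ := exists_two_pos hK.2.1 (fun i => (hx i).1)
      (fun i j a h => hx.eq_of_smul i j a hK.2.1 h) (c := -c) (neg_ne_zero.2 hc0)
      (by simp [hcm])
    exact ⟨i, j, h1, by simpa using h2, by simpa using h3⟩

theorem MinimalSystem.of_relation {ι : Type*} [Fintype ι] {x : ι → E} {c d : ι → ℝ}
    (S : MinimalSystem x c) (hd : d ≠ 0) (h : ∑ i, d i • x i = 0) : MinimalSystem x d := by
  obtain ⟨t, ht⟩ := S.unique d h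
  have ht0 : t ≠ 0 := by
    rintro rfl
    exact hd (funext fun i => by simp [ht])
  have hu : ∀ d' : ι → ℝ, ∑ i, d' i • x i = 0 → ∃ s : ℝ, ∀ i, d' i = s * d i := fun d' hd' => by
    obtain ⟨s, hs⟩ := S.unique d' hd'
    exact ⟨s / t, fun i => by rw [hs, ht]; field_simp⟩
  rcases lt_or_gt_of_ne ht0 with h' | h'
  · refine ⟨h, hu, ?_, ?_⟩
    · obtain ⟨i, j, h1, h2, h3⟩ := S.neg
      exact ⟨i, j, h1, by rw [ht]; exact mul_pos_of_neg_of_neg h' h2,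
        by rw [ht]; exact mul_pos_of_neg_of_neg h' h3⟩
    · obtain ⟨i, j, h1, h2, h3⟩ := S.pos
      exact ⟨i, j, h1, by rw [ht]; exact mul_neg_of_neg_of_pos h' h2,
        by rw [ht]; exact mul_neg_of_neg_of_pos h' h3⟩
  · refine ⟨h, hu, ?_, ?_⟩
    · obtain ⟨i, j, h1, h2, h3⟩ := S.pos
      exact ⟨i, j, h1, by rw [ht]; exact mul_pos h' h2, by rw [ht]; exact mul_pos h' h3⟩
    · obtain ⟨i, j, h1, h2, h3⟩ := S.neg
      exact ⟨i, j, h1, by rw [ht]; exact mul_neg_of_pos_of_neg h' h2,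
        by rw [ht]; exact mul_neg_of_pos_of_neg h' h3⟩

namespace MinimalSystem

variable {ι : Type*} [Fintype ι] {x : ι → E} {c : ι → ℝ}

theorem isRaySystem (S : MinimalSystem x c) :
    IsRaySystem (PointedCone.hull ℝ (Set.range x)) S.rayEquiv x := fun i =>
  ⟨S.isExtremeVector i, by rw [(S.isExtremeVector i).2.2, coe_rayEquiv]⟩

theorem ne_zero_relation (S : MinimalSystem x c) : c ≠ 0 := by
  obtain ⟨i, -, -, hi, -⟩ := S.pos
  rintro rfl
  simp at hi

theorem exists_rep_zero (S : MinimalSystem x c) {b : ι → ℝ} (hb : ∀ i, 0 ≤ b i) :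
    ∃ j, 0 < c j ∧ ∃ b' : ι → ℝ, (∀ i, 0 ≤ b' i) ∧ b' j = 0 ∧
      ∑ i, b' i • x i = ∑ i, b i • x i := by
  classical
  obtain ⟨p, -, -, hp, -⟩ := S.pos
  obtain ⟨j, hj, hmin⟩ := Finset.exists_min_image (Finset.univ.filter fun i => 0 < c i)
    (fun i => b i / c i) ⟨p, by simpa using hp⟩
  simp only [Finset.mem_filter, Finset.mem_univ, true_and] at hj hmin
  refine ⟨j, hj, fun i => b i + (- (b j / c j)) * c i, fun i => ?_, ?_, S.sum_add_mul b _⟩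
  · have h0 : 0 ≤ b j / c j := div_nonneg (hb j) hj.le
    rcases lt_or_ge 0 (c i) with h | h
    · have := hmin i h
      rw [le_div_iff₀ h] at this
      linarith
    · nlinarith [hb i]
  · field_simp; ring

theorem isClosed [FiniteDimensional ℝ E] (S : MinimalSystem x c) :
    IsClosed (PointedCone.hull ℝ (Set.range x) : Set E) := by
  classical
  let L : ∀ j : ι, ({i // i ≠ j} → ℝ) →ₗ[ℝ] E := fun j =>
    Fintype.linearCombination ℝ (fun i : {i // i ≠ j} => x i)
  have hsub : ∀ (j : ι) (g : ι → E), g j = 0 → ∑ i : {i // i ≠ j}, g i = ∑ i, g i := by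
    intro j g hg
    rw [← Finset.sum_subtype (Finset.univ.erase j) (by simp) g]
    exact Finset.sum_erase _ hg
  have hinj : ∀ j, 0 < c j → LinearMap.ker (L j) = ⊥ := by
    intro j hj
    rw [LinearMap.ker_eq_bot']
    intro d hd
    let d' : ι → ℝ := fun i => if h : i ≠ j then d ⟨i, h⟩ else 0
    have hd' : ∑ i, d' i • x i = 0 := by
      rw [← hsub j _ (by simp [d']), ← hd]
      simp only [L, Fintype.linearCombination_apply]
      refine Finset.sum_congr rfl fun i _ => ?_
      simp [d', i.2]
    obtain ⟨t, ht⟩ := S.unique d' hd'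
    have h1 := ht j
    have h2 : d' j = 0 := by simp [d']
    have ht0 : t = 0 := by
      rw [h2] at h1
      exact (mul_eq_zero.1 h1.symm).resolve_right hj.ne'
    ext i
    have := ht i
    rw [ht0, zero_mul] at this
    simpa [d', i.2] using this
  have hEq : (PointedCone.hull ℝ (Set.range x) : Set E) =
      ⋃ j ∈ {j | 0 < c j}, L j '' {b | ∀ i, 0 ≤ b i} := by
    ext y
    simp only [Set.mem_iUnion, Set.mem_image, Set.mem_ofPred_eq, SetLike.mem_coe,
      mem_hull_range_iff]
    constructor
    · rintro ⟨b, hb, rfl⟩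
      obtain ⟨j, hj, b', hb', hz, h⟩ := S.exists_rep_zero hb
      refine ⟨j, hj, fun i => b' i, fun i => hb' i, ?_⟩
      simp only [L, Fintype.linearCombination_apply]
      rw [hsub j (fun i => b' i • x i) (by simp [hz]), h]
    · rintro ⟨j, hj, b, hb, rfl⟩
      refine ⟨fun i => if h : i ≠ j then b ⟨i, h⟩ else 0, fun i => ?_, ?_⟩
      · by_cases h : i = j
        · simp [h]
        · simpa [h] using hb ⟨i, h⟩
      · rw [← hsub j _ (by simp)]
        simp only [L, Fintype.linearCombination_apply]
        refine Finset.sum_congr rfl fun i _ => ?_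
        simp [i.2]
  rw [hEq]
  refine Set.Finite.isClosed_biUnion (Set.toFinite _) fun j hj => ?_
  refine ((LinearMap.isClosedEmbedding_of_injective (hinj j hj)).isClosed_iff_image_isClosed).1 ?_
  have : {b : {i // i ≠ j} → ℝ | ∀ i, 0 ≤ b i} = ⋂ i, {b | 0 ≤ b i} := by ext; simp
  rw [this]
  exact isClosed_iInter fun i => isClosed_le continuous_const (continuous_apply i)

theorem isMinimalCone [FiniteDimensional ℝ E] (S : MinimalSystem x c) :
    IsMinimalCone (PointedCone.hull ℝ (Set.range x)) :=
  ⟨S.isClosed, S.isPointed, S.finite_extremeRays, by rw [S.ncard_extremeRays, S.coneDim_eq]⟩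

theorem mem_interior_iff [FiniteDimensional ℝ E]
    (hspan : Submodule.span ℝ (Set.range x) = ⊤) {y : E} :
    y ∈ interior (PointedCone.hull ℝ (Set.range x) : Set E) ↔
      ∃ b : ι → ℝ, (∀ i, 0 < b i) ∧ ∑ i, b i • x i = y := by
  constructor
  · intro hy
    obtain ⟨ε, hε, h⟩ := exists_sub_smul_mem_of_mem_interior hy (∑ i, x i)
    obtain ⟨b, hb, e⟩ := mem_hull_range_iff.1 h
    refine ⟨fun i => b i + ε, fun i => by linarith [hb i], ?_⟩
    simp [add_smul, Finset.sum_add_distrib, e, ← Finset.smul_sum]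
  · rintro ⟨b, hb, rfl⟩
    have hs : Function.Surjective (Fintype.linearCombination ℝ x) := by
      rw [← LinearMap.range_eq_top, Fintype.range_linearCombination, hspan]
    have ho := LinearMap.isOpenMap_of_finiteDimensional (Fintype.linearCombination ℝ x) hs
    have hO : IsOpen {b : ι → ℝ | ∀ i, 0 < b i} := by
      have : {b : ι → ℝ | ∀ i, 0 < b i} = ⋂ i, {b | 0 < b i} := by ext; simp
      rw [this]
      exact isOpen_iInter_of_finite fun i => isOpen_lt continuous_const (continuous_apply i)
    refine interior_maximal (s := (PointedCone.hull ℝ (Set.range x) : Set E)) ?_ (ho _ hO)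
      ⟨b, hb, by rw [Fintype.linearCombination_apply]⟩
    rintro _ ⟨d, hd, rfl⟩
    rw [Fintype.linearCombination_apply]
    exact mem_hull_range_iff.2 ⟨d, fun i => (hd i).le, rfl⟩

end MinimalSystem

theorem span_eq_top_of_interior_nonempty {K : PointedCone ℝ E}
    (h : (interior (K : Set E)).Nonempty) : Submodule.span ℝ (K : Set E) = ⊤ := by
  rw [Submodule.eq_top_iff']
  obtain ⟨y, hy⟩ := h
  intro z
  obtain ⟨ε, hε, h⟩ := exists_sub_smul_mem_of_mem_interior hy z
  have : z = ε⁻¹ • (y - (y - ε • z)) := by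
    rw [sub_sub_cancel, smul_smul, inv_mul_cancel₀ hε.ne', one_smul]
  rw [this]
  exact Submodule.smul_mem _ _ (Submodule.sub_mem _ (Submodule.subset_span (interior_subset hy))
    (Submodule.subset_span h))

end Topology

section PolyCones

variable {n : ℕ} {K : PointedCone ℝ (Fin n → ℝ)}

theorem isMinimalCone_of_mem_polyCones (hK : K ∈ polyCones (n + 1) n) : IsMinimalCone K := by
  obtain ⟨⟨h1, h2, h3⟩, h4, h5⟩ := hK
  refine ⟨h1, h2, h4, ?_⟩
  rw [h5, coneDim, span_eq_top_of_interior_nonempty h3]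
  simp

theorem span_range_eq_top (hK : K ∈ polyCones (n + 1) n) {ι : Type*} {e : ι ≃ extremeRays K}
    {x : ι → Fin n → ℝ} (hx : IsRaySystem K e x) [Fintype ι] :
    Submodule.span ℝ (Set.range x) = ⊤ := by
  rw [← MinimalSystem.span_hull_range, ← (isMinimalCone_of_mem_polyCones hK).eq_hull hx]
  exact span_eq_top_of_interior_nonempty hK.1.2.2

theorem MinimalSystem.mem_polyCones {ι : Type*} [Fintype ι] {x : ι → Fin n → ℝ} {c : ι → ℝ}
    (S : MinimalSystem x c) (hι : Fintype.card ι = n + 1) :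
    PointedCone.hull ℝ (Set.range x) ∈ polyCones (n + 1) n := by
  have hspan : Submodule.span ℝ (Set.range x) = ⊤ := by
    apply Submodule.eq_top_of_finrank_eq
    have := S.coneDim_eq
    rw [coneDim, span_hull_range, hι] at this
    simpa using this
  refine ⟨⟨S.isClosed, S.isPointed, ?_⟩, S.finite_extremeRays, by rw [S.ncard_extremeRays, hι]⟩
  exact ⟨∑ i, (1 : ℝ) • x i, (mem_interior_iff hspan).2 ⟨fun _ => 1, fun _ => one_pos, rfl⟩⟩

end PolyCones
end KCone

namespace KCone

section DirectSum

variable {E : Type*} [AddCommGroup E] [Module ℝ E] {K K₁ K₂ : PointedCone ℝ E}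

theorem IsDirectSum.eq_and_eq (h : IsDirectSum K K₁ K₂) {p q r s : E} (hp : p ∈ K₁) (hq : q ∈ K₁)
    (hr : r ∈ K₂) (hs : s ∈ K₂) (he : p + r = q + s) : p = q ∧ r = s := by
  obtain ⟨w, -, hw⟩ := h.2.2 (p + r) (K.add_mem (h.1 hp) (h.2.1 hr))
  have h1 := hw (p, r) ⟨hp, hr, rfl⟩
  have h2 := hw (q, s) ⟨hq, hs, he.symm⟩
  have := h1.trans h2.symm
  exact Prod.ext_iff.1 this

theorem IsDirectSum.eq_zero (h : IsDirectSum K K₁ K₂) {p : E} (hp : p ∈ K₁) (hp' : p ∈ K₂) :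
    p = 0 :=
  (h.eq_and_eq hp K₁.zero_mem K₂.zero_mem hp' (by simp)).1

theorem IsDirectSum.mem_or_mem (h : IsDirectSum K K₁ K₂) {x : E} (hx : IsExtremeVector K x) :
    x ∈ K₁ ∨ x ∈ K₂ := by
  obtain ⟨⟨p, r⟩, ⟨hp, hr, he⟩, -⟩ := h.2.2 x hx.1
  dsimp only at hp hr he
  obtain ⟨a, ha, e⟩ := hx.of_add (h.1 hp) (h.2.1 hr) he
  rcases ha.eq_or_lt with rfl | ha
  · right
    rw [zero_smul] at e
    rw [← he, ← e, zero_add]; exact hr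
  · left
    have : x = a⁻¹ • p := by rw [← e, smul_smul, inv_mul_cancel₀ ha.ne', one_smul]
    rw [this]
    exact smul_mem_cone (by positivity) hp

theorem IsDirectSum.sum_ite_eq_zero {ι : Type*} [Fintype ι] {x : ι → E} {c : ι → ℝ}
    (h : IsDirectSum K K₁ K₂) (hc : ∑ i, c i • x i = 0) (p : ι → Prop) [DecidablePred p]
    (h₁ : ∀ i, p i → x i ∈ K₁) (h₂ : ∀ i, ¬ p i → x i ∈ K₂) :
    ∑ i, (if p i then c i else 0) • x i = 0 := by
  let u : ι → ℝ := fun i => max (c i) 0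
  let v : ι → ℝ := fun i => max (- c i) 0
  have huv : ∀ i, c i = u i - v i := fun i => by
    simp only [u, v]
    rcases le_total 0 (c i) with h | h
    · rw [max_eq_left h, max_eq_right (by linarith)]; ring
    · rw [max_eq_right h, max_eq_left (by linarith)]; ring
  have hm₁ : ∀ w : ι → ℝ, (∀ i, 0 ≤ w i) → ∑ i, (if p i then w i else 0) • x i ∈ K₁ := by
    intro w hw
    refine Submodule.sum_mem _ fun i _ => ?_
    by_cases hi : p i
    · rw [if_pos hi]; exact smul_mem_cone (hw i) (h₁ i hi)
    · rw [if_neg hi, zero_smul]; exact K₁.zero_mem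
  have hm₂ : ∀ w : ι → ℝ, (∀ i, 0 ≤ w i) → ∑ i, (if p i then 0 else w i) • x i ∈ K₂ := by
    intro w hw
    refine Submodule.sum_mem _ fun i _ => ?_
    by_cases hi : p i
    · rw [if_pos hi, zero_smul]; exact K₂.zero_mem
    · rw [if_neg hi]; exact smul_mem_cone (hw i) (h₂ i hi)
  have hsplit : ∀ w : ι → ℝ, ∑ i, (if p i then w i else 0) • x i +
      ∑ i, (if p i then 0 else w i) • x i = ∑ i, w i • x i := by
    intro w
    rw [← Finset.sum_add_distrib]
    refine Finset.sum_congr rfl fun i _ => ?_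
    by_cases hi : p i <;> simp [hi]
  have hu : ∀ i, 0 ≤ u i := fun i => le_max_right _ _
  have hv : ∀ i, 0 ≤ v i := fun i => le_max_right _ _
  have key := (h.eq_and_eq (hm₁ u hu) (hm₁ v hv) (hm₂ u hu) (hm₂ v hv) (by
    rw [hsplit, hsplit, ← sub_eq_zero, ← Finset.sum_sub_distrib, ← hc]
    exact Finset.sum_congr rfl fun i _ => by rw [huv, sub_smul])).1
  rw [← sub_eq_zero, ← Finset.sum_sub_distrib] at key
  rw [← key]
  refine Finset.sum_congr rfl fun i _ => ?_
  by_cases hi : p i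
  · simp only [if_pos hi]; rw [huv i, sub_smul]
  · simp only [if_neg hi]; simp

end DirectSum

namespace MinimalSystem

variable {E ι : Type*} [AddCommGroup E] [Module ℝ E] [Fintype ι] {x : ι → E} {c : ι → ℝ}

theorem sum_restrict (z : ι) {M : Type*} [AddCommMonoid M] [DecidableEq ι] (g : ι → M)
    (hg : g z = 0) : ∑ i : {i // i ≠ z}, g i = ∑ i, g i := by
  rw [← Finset.sum_subtype (Finset.univ.erase z) (by simp) g]
  exact Finset.sum_erase _ hg

theorem mem_hull_restrict_iff (z : ι) {y : E} :
    y ∈ PointedCone.hull ℝ (Set.range fun i : {i // i ≠ z} => x i) ↔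
      ∃ b : ι → ℝ, (∀ i, 0 ≤ b i) ∧ b z = 0 ∧ ∑ i, b i • x i = y := by
  classical
  rw [mem_hull_range_iff]
  constructor
  · rintro ⟨b, hb, rfl⟩
    refine ⟨fun i => if h : i ≠ z then b ⟨i, h⟩ else 0, fun i => ?_, by simp, ?_⟩
    · by_cases h : i = z
      · simp [h]
      · simpa [h] using hb ⟨i, h⟩
    · rw [← sum_restrict z _ (by simp)]
      refine Finset.sum_congr rfl fun i _ => ?_
      simp [i.2]
  · rintro ⟨b, hb, hz, rfl⟩
    exact ⟨fun i => b i, fun i => hb i, sum_restrict z (fun i => b i • x i) (by simp [hz])⟩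

theorem restrict [DecidableEq ι] (S : MinimalSystem x c) {z : ι} (hz : c z = 0) :
    MinimalSystem (fun i : {i // i ≠ z} => x i) (fun i => c i) where
  rel := by rw [sum_restrict z (fun i => c i • x i) (by simp [hz]), S.rel]
  unique d hd := by
    obtain ⟨t, ht⟩ := S.unique (fun i => if h : i ≠ z then d ⟨i, h⟩ else 0) (by
      rw [← sum_restrict z _ (by simp), ← hd]
      refine Finset.sum_congr rfl fun i _ => ?_
      simp [i.2])
    exact ⟨t, fun i => by simpa [i.2] using ht i⟩
  pos := by
    obtain ⟨i, j, h, hi, hj⟩ := S.pos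
    exact ⟨⟨i, by rintro rfl; linarith⟩, ⟨j, by rintro rfl; linarith⟩, by simpa using h, hi, hj⟩
  neg := by
    obtain ⟨i, j, h, hi, hj⟩ := S.neg
    exact ⟨⟨i, by rintro rfl; linarith⟩, ⟨j, by rintro rfl; linarith⟩, by simpa using h, hi, hj⟩

theorem isDirectSum_restrict (S : MinimalSystem x c) {z : ι} (hz : c z = 0) :
    IsDirectSum (PointedCone.hull ℝ (Set.range x)) (PointedCone.hull ℝ {x z})
      (PointedCone.hull ℝ (Set.range fun i : {i // i ≠ z} => x i)) := by
  classical
  refine ⟨?_, ?_, ?_⟩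
  · exact Submodule.span_mono (by simp)
  · refine Submodule.span_mono ?_
    rintro _ ⟨i, rfl⟩
    exact ⟨i, rfl⟩
  · intro y hy
    obtain ⟨b, hb, rfl⟩ := mem_hull_range_iff.1 hy
    have hrep : ∀ (a : ℝ) (d : ι → ℝ), d z = 0 →
        a • x z + ∑ i, d i • x i = ∑ i, (Function.update d z a) i • x i := by
      intro a d hd
      rw [← Finset.add_sum_erase _ _ (Finset.mem_univ z),
        ← Finset.add_sum_erase _ _ (Finset.mem_univ z), hd]
      simp only [zero_smul, zero_add, Function.update_self]
      congr 1
      refine Finset.sum_congr rfl fun i hi => ?_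
      rw [Function.update_of_ne (Finset.ne_of_mem_erase hi)]
    refine ⟨(b z • x z, ∑ i, (Function.update b z 0) i • x i), ⟨?_, ?_, ?_⟩, ?_⟩
    · exact mem_hull_singleton_iff.2 ⟨b z, hb z, rfl⟩
    · refine (mem_hull_restrict_iff z).2 ⟨_, fun i => ?_, by simp, rfl⟩
      by_cases h : i = z
      · subst h; simp
      · rw [Function.update_of_ne h]; exact hb i
    · dsimp only
      rw [hrep _ _ (by simp)]
      simp
    · rintro ⟨p, r⟩ ⟨hp, hr, he⟩
      dsimp only at hp hr he
      obtain ⟨a, ha, rfl⟩ := mem_hull_singleton_iff.1 hp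
      obtain ⟨d, hd, hdz, rfl⟩ := (mem_hull_restrict_iff z).1 hr
      have he' := he
      rw [hrep a d hdz] at he
      obtain ⟨t, ht⟩ := S.eq_add_mul he
      have := ht z
      rw [hz] at this
      simp only [Function.update_self, mul_zero, add_zero] at this
      subst this
      refine Prod.ext rfl ?_
      have h2 := hrep (b z) (Function.update b z 0) (by simp)
      simp only [Function.update_idem, Function.update_eq_self] at h2
      rw [← h2] at he'
      exact add_left_cancel he'

theorem hull_ne_bot {y : E} {s : Set E} (hy : y ≠ 0) (hs : y ∈ s) :
    PointedCone.hull ℝ s ≠ ⊥ := by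
  intro h
  have : y ∈ PointedCone.hull ℝ s := Submodule.subset_span hs
  rw [h] at this
  exact hy ((Submodule.mem_bot _).1 this)

theorem isIndecomposable_iff (S : MinimalSystem x c) :
    IsIndecomposable (PointedCone.hull ℝ (Set.range x)) ↔ ∀ i, c i ≠ 0 := by
  classical
  constructor
  · intro h z hz
    refine h ⟨_, _, ?_, ?_, S.isDirectSum_restrict hz⟩
    · exact hull_ne_bot (S.ne_zero z) rfl
    · obtain ⟨j, hj, -⟩ := S.exists_pos_ne z
      exact hull_ne_bot (S.ne_zero j) ⟨⟨j, hj⟩, rfl⟩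
  · rintro hc ⟨K₁, K₂, h₁, h₂, h⟩
    have hle : ∀ L : PointedCone ℝ E, (∀ i, x i ∈ L) → PointedCone.hull ℝ (Set.range x) ≤ L := by
      intro L hL
      refine Submodule.span_le.2 ?_
      rintro _ ⟨i, rfl⟩
      exact hL i
    have hsum := h.sum_ite_eq_zero S.rel (fun i => x i ∈ K₁) (fun i hi => hi)
      (fun i hi => (h.mem_or_mem (S.isExtremeVector i)).resolve_left hi)
    obtain ⟨t, ht⟩ := S.unique _ hsum
    by_cases hex : ∃ i, x i ∈ K₁
    · obtain ⟨i, hi⟩ := hex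
      have ht1 : t = 1 := by
        have := ht i
        rw [if_pos hi] at this
        have := mul_right_cancel₀ (hc i) ((one_mul _).trans this)
        exact this.symm
      have hall : ∀ i, x i ∈ K₁ := by
        intro j
        by_contra hj
        have := ht j
        rw [if_neg hj, ht1, one_mul] at this
        exact hc j this.symm
      refine h₂ ((Submodule.eq_bot_iff _).2 fun y hy => ?_)
      exact h.eq_zero (hle K₁ hall (h.2.1 hy)) hy
    · push Not at hex
      have hall : ∀ i, x i ∈ K₂ := fun i =>
        (h.mem_or_mem (S.isExtremeVector i)).resolve_left (hex i)
      refine h₁ ((Submodule.eq_bot_iff _).2 fun y hy => ?_)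
      exact h.eq_zero hy (hle K₂ hall (h.1 hy))

end MinimalSystem

/-- The number of positive entries minus the number of negative entries. -/
noncomputable def signSum {ι : Type*} [Fintype ι] (c : ι → ℝ) : ℤ :=
  ∑ i, ((SignType.sign (c i) : SignType) : ℤ)

theorem signSum_eq {ι : Type*} [Fintype ι] (c : ι → ℝ) :
    signSum c = ({i | 0 < c i}.ncard : ℤ) - ({i | c i < 0}.ncard : ℤ) := by
  classical
  have h1 : ({i | 0 < c i}.ncard : ℤ) = ∑ i, if 0 < c i then (1 : ℤ) else 0 := by
    rw [Set.ncard_eq_toFinset_card']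
    simp
  have h2 : ({i | c i < 0}.ncard : ℤ) = ∑ i, if c i < 0 then (1 : ℤ) else 0 := by
    rw [Set.ncard_eq_toFinset_card']
    simp
  rw [signSum, h1, h2, ← Finset.sum_sub_distrib]
  refine Finset.sum_congr rfl fun i _ => ?_
  rcases lt_trichotomy (c i) 0 with h | h | h
  · simp [sign_neg h, h, h.not_gt]
  · simp [h]
  · simp [sign_pos h, h, h.not_gt]

theorem signSum_neg {ι : Type*} [Fintype ι] (c : ι → ℝ) :
    signSum (fun i => - c i) = - signSum c := by
  simp only [signSum, Left.sign_neg, ← Finset.sum_neg_distrib, SignType.coe_neg]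

theorem signSum_mul {ι : Type*} [Fintype ι] {t : ℝ} (ht : 0 < t) (c : ι → ℝ) :
    signSum (fun i => t * c i) = signSum c := by
  simp only [signSum, sign_mul, sign_pos ht, one_mul]

theorem abs_signSum_mul {ι : Type*} [Fintype ι] {t : ℝ} (ht : t ≠ 0) (c : ι → ℝ) :
    |signSum (fun i => t * c i)| = |signSum c| := by
  rcases lt_or_gt_of_ne ht with h | h
  · have : (fun i => t * c i) = fun i => - (-t * c i) := by ext; ring
    rw [this, signSum_neg, signSum_mul (by linarith), abs_neg]
  · rw [signSum_mul h]

theorem abs_signSum_le_one_iff {ι : Type*} [Fintype ι] (c : ι → ℝ) :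
    |signSum c| ≤ 1 ↔ {i | 0 < c i}.ncard ≤ {i | c i < 0}.ncard + 1 ∧
      {i | c i < 0}.ncard ≤ {i | 0 < c i}.ncard + 1 := by
  rw [signSum_eq, abs_le]
  omega

namespace MinimalSystem

variable {E ι : Type*} [NormedAddCommGroup E] [NormedSpace ℝ E] [Fintype ι] {x : ι → E}
  {c : ι → ℝ}

theorem hasBalancedRelation_iff (S : MinimalSystem x c) :
    HasBalancedRelation (PointedCone.hull ℝ (Set.range x)) ↔ |signSum c| ≤ 1 := by
  constructor
  · rintro ⟨m, e, x', c', ⟨hx', hc', hrel⟩, hb⟩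
    rw [← abs_signSum_le_one_iff] at hb
    let σ : Fin m ≃ ι := e.trans S.rayEquiv.symm
    have hσ : ∀ k, ∃ a : ℝ, 0 < a ∧ x' k = a • x (σ k) := fun k => by
      rw [← hull_singleton_eq_iff (hx' k).1.2.1, ← coe_rayEquiv S, ← (hx' k).1.2.2, (hx' k).2]
      simp [σ]
    choose a ha hxa using hσ
    have hrel' : ∑ i, (c' (σ.symm i) * a (σ.symm i)) • x i = 0 := by
      rw [← hrel, ← σ.sum_comp]
      refine Finset.sum_congr rfl fun k _ => ?_
      rw [hxa k, Equiv.symm_apply_apply, mul_smul]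
    obtain ⟨t, ht⟩ := S.unique _ hrel'
    have ht' : ∀ k, c' k * a k = t * c (σ k) := fun k => by simpa using ht (σ k)
    have ht0 : t ≠ 0 := by
      rintro rfl
      refine hc' (funext fun k => ?_)
      have := ht' k
      rw [zero_mul] at this
      exact (mul_eq_zero.1 this).resolve_right (ha k).ne'
    have h1 : signSum c' = signSum fun i => t * c i := by
      rw [signSum, signSum, ← σ.sum_comp]
      refine Finset.sum_congr rfl fun k _ => ?_
      rw [← ht', sign_mul, sign_pos (ha k), mul_one]
    rw [← abs_signSum_mul ht0, ← h1]
    exact hb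
  · intro h
    let e := (Fintype.equivFin ι).symm
    have hr : Set.range (x ∘ e) = Set.range x := e.surjective.range_comp x
    have S' := S.comp_equiv e
    refine ⟨_, e.trans S.rayEquiv, x ∘ e, c ∘ e, ⟨fun i => S.isRaySystem (e i),
      S'.ne_zero_relation, S'.rel⟩, ?_⟩
    rw [← abs_signSum_le_one_iff]
    have : signSum (c ∘ e) = signSum c := by
      rw [signSum, signSum, ← e.sum_comp]; rfl
    rwa [this]

theorem exists_ray_isDirectSum_iff [FiniteDimensional ℝ E] (S : MinimalSystem x c) :
    (∃ R K' : PointedCone ℝ E, IsRay R ∧ IsMinimalCone K' ∧ IsIndecomposable K' ∧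
      HasBalancedRelation K' ∧ IsDirectSum (PointedCone.hull ℝ (Set.range x)) R K') ↔
    (∃ z, ∀ i, c i = 0 ↔ i = z) ∧ |signSum c| ≤ 1 := by
  classical
  have hsum : ∀ z, c z = 0 → signSum (fun i : {i // i ≠ z} => c i) = signSum c := by
    intro z hz
    exact sum_restrict z (fun i => ((SignType.sign (c i) : SignType) : ℤ)) (by simp [hz])
  constructor
  · rintro ⟨_, K', ⟨r, hr, rfl⟩, -, hind, hbal, h⟩
    have hrK : r ∈ PointedCone.hull ℝ {r} := Submodule.mem_span_singleton_self r
    obtain ⟨z, hz⟩ : ∃ z, x z ∈ PointedCone.hull ℝ {r} := by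
      by_contra! hn
      have hall : ∀ i, x i ∈ K' := fun i =>
        (h.mem_or_mem (S.isExtremeVector i)).resolve_left (hn i)
      refine hr (h.eq_zero hrK ?_)
      have hle : PointedCone.hull ℝ (Set.range x) ≤ K' := Submodule.span_le.2 (by
        rintro _ ⟨i, rfl⟩
        exact hall i)
      exact hle (h.1 hrK)
    have hother : ∀ i, i ≠ z → x i ∈ K' := by
      intro i hi
      refine (h.mem_or_mem (S.isExtremeVector i)).resolve_left fun hi' => hi ?_
      obtain ⟨a, ha, e⟩ := mem_hull_singleton_iff.1 hz
      obtain ⟨b, hb, e'⟩ := mem_hull_singleton_iff.1 hi'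
      have ha0 : a ≠ 0 := by
        rintro rfl
        exact S.ne_zero z (by rw [← e, zero_smul])
      refine S.smul_injective (a := b * a⁻¹) ?_
      rw [← e', ← e, smul_smul, mul_assoc, inv_mul_cancel₀ ha0, mul_one]
    have hs := h.sum_ite_eq_zero S.rel (fun i => i = z) (by rintro i rfl; exact hz) hother
    have hcz : c z = 0 := by
      rw [Finset.sum_eq_single z (by simp +contextual) (by simp), if_pos rfl] at hs
      exact (smul_eq_zero.1 hs).resolve_right (S.ne_zero z)
    have hK' : K' = PointedCone.hull ℝ (Set.range fun i : {i // i ≠ z} => x i) := by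
      apply le_antisymm
      · intro y hy
        obtain ⟨⟨p, q⟩, ⟨hp, hq, he⟩, -⟩ := (S.isDirectSum_restrict hcz).2.2 y (h.2.1 hy)
        dsimp only at hp hq he
        have hpR : p ∈ PointedCone.hull ℝ {r} := by
          have : PointedCone.hull ℝ {x z} ≤ PointedCone.hull ℝ {r} :=
            Submodule.span_le.2 (by simpa using hz)
          exact this hp
        have hqK : q ∈ K' := by
          have : PointedCone.hull ℝ (Set.range fun i : {i // i ≠ z} => x i) ≤ K' :=
            Submodule.span_le.2 (by rintro _ ⟨i, rfl⟩; exact hother i i.2)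
          exact this hq
        have := (h.eq_and_eq hpR (Submodule.zero_mem _) hqK hy (by rw [he, zero_add])).2
        rwa [← this]
      · exact Submodule.span_le.2 (by rintro _ ⟨i, rfl⟩; exact hother i i.2)
    have S' := S.restrict hcz
    rw [hK', S'.isIndecomposable_iff] at hind
    rw [hK', S'.hasBalancedRelation_iff, hsum z hcz] at hbal
    refine ⟨⟨z, fun i => ⟨fun hi => ?_, by rintro rfl; exact hcz⟩⟩, hbal⟩
    by_contra hne
    exact hind ⟨i, hne⟩ hi
  · rintro ⟨⟨z, hz⟩, hb⟩
    have hcz : c z = 0 := (hz z).2 rfl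
    have S' := S.restrict hcz
    refine ⟨_, _, ⟨x z, S.ne_zero z, rfl⟩, S'.isMinimalCone, ?_, ?_, S.isDirectSum_restrict hcz⟩
    · rw [S'.isIndecomposable_iff]
      intro i hi
      exact i.2 ((hz i).1 hi)
    · rw [S'.hasBalancedRelation_iff, hsum z hcz]
      exact hb

end MinimalSystem
end KCone

namespace KCone

/-- The set of the heads of the arcs that start in `s`. -/
def outSet {ι : Type*} (T : ι → ι → Prop) (s : Set ι) : Set ι :=
  {j | ∃ i ∈ s, T i j}

open Matrix

section Dominates

variable {n : ℕ} {K : PointedCone ℝ (Fin n → ℝ)} {A : Matrix (Fin n) (Fin n) ℝ}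

/-- A positive multiple of `z` is below `y` in the order of the cone. -/
def Dominates (K : PointedCone ℝ (Fin n → ℝ)) (y z : Fin n → ℝ) : Prop :=
  ∃ ε : ℝ, 0 < ε ∧ y - ε • z ∈ K

theorem Dominates.trans {u v w : Fin n → ℝ} (h : Dominates K u v) (h' : Dominates K v w) :
    Dominates K u w := by
  obtain ⟨ε, hε, h⟩ := h
  obtain ⟨δ, hδ, h'⟩ := h'
  refine ⟨ε * δ, by positivity, ?_⟩
  have : u - (ε * δ) • w = (u - ε • v) + ε • (v - δ • w) := by module
  rw [this]
  exact K.add_mem h (smul_mem_cone hε.le h')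

theorem Dominates.refl (y : Fin n → ℝ) : Dominates K y y :=
  ⟨1, one_pos, by simp⟩

theorem Dominates.mulVec (hA : IsKNonneg K A) {u v : Fin n → ℝ} (h : Dominates K u v) :
    Dominates K (A *ᵥ u) (A *ᵥ v) := by
  obtain ⟨ε, hε, h⟩ := h
  refine ⟨ε, hε, ?_⟩
  have := hA _ h
  rwa [Matrix.mulVec_sub, Matrix.mulVec_smul] at this

theorem Dominates.mem_interior {u v : Fin n → ℝ} (h : Dominates K u v)
    (hv : v ∈ interior (K : Set (Fin n → ℝ))) : u ∈ interior (K : Set (Fin n → ℝ)) := by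
  obtain ⟨ε, hε, h⟩ := h
  exact mem_interior_of_sub_smul_mem hε hv h

theorem IsKNonneg.pow (hA : IsKNonneg K A) (t : ℕ) : IsKNonneg K (A ^ t) := by
  induction t with
  | zero => intro y hy; simpa using hy
  | succ t ih =>
    intro y hy
    rw [pow_succ, ← Matrix.mulVec_mulVec]
    exact ih _ (hA _ hy)

theorem IsKPrimitive.mulVec_mem_interior (hA : IsKPrimitive K A) {y : Fin n → ℝ}
    (hy : y ∈ interior (K : Set (Fin n → ℝ))) {w : Fin n → ℝ} (hw : w ∈ K) (hw0 : w ≠ 0) :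
    A *ᵥ y ∈ interior (K : Set (Fin n → ℝ)) := by
  obtain ⟨hA, p, hp, hpos⟩ := hA
  have h1 : Dominates K y ((A ^ (p - 1)) *ᵥ w) := exists_sub_smul_mem_of_mem_interior hy _
  have h2 := h1.mulVec hA
  rw [Matrix.mulVec_mulVec, ← pow_succ', Nat.sub_add_cancel hp] at h2
  exact h2.mem_interior (hpos w hw hw0)

end Dominates

namespace MinimalSystem

variable {n : ℕ} {ι : Type*} [Fintype ι] {x : ι → Fin n → ℝ} {c : ι → ℝ}
  {A : Matrix (Fin n) (Fin n) ℝ}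

local notation "Kx" => PointedCone.hull ℝ (Set.range x)

theorem ne_zero_of_mem_interior (S : MinimalSystem x c) {y : Fin n → ℝ}
    (hy : y ∈ interior (Kx : Set (Fin n → ℝ))) : y ≠ 0 := by
  rintro rfl
  obtain ⟨i, -, -, -, -⟩ := S.pos
  obtain ⟨ε, hε, h⟩ := exists_sub_smul_mem_of_mem_interior hy (x i)
  rw [zero_sub] at h
  have h0 := S.isPointed _ (smul_mem_cone hε.le (mem i)) h
  rcases smul_eq_zero.1 h0 with h | h
  · exact hε.ne' h
  · exact S.ne_zero i h

theorem isKPositive_iff (S : MinimalSystem x c) (hA : IsKNonneg Kx A) :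
    IsKPositive Kx A ↔ ∀ i, A *ᵥ x i ∈ interior (Kx : Set (Fin n → ℝ)) := by
  classical
  constructor
  · intro h i
    exact h _ (mem i) (S.ne_zero i)
  · intro h y hy hy0
    obtain ⟨b, hb, rfl⟩ := mem_hull_range_iff.1 hy
    obtain ⟨i, hi⟩ : ∃ i, b i ≠ 0 := by
      by_contra! hn
      exact hy0 (by simp [hn])
    have hd : Dominates Kx (∑ i, b i • x i) (x i) := by
      refine ⟨b i, lt_of_le_of_ne (hb i) hi.symm, ?_⟩
      rw [← Finset.add_sum_erase _ _ (Finset.mem_univ i), add_sub_cancel_left]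
      exact Submodule.sum_mem _ fun j _ => smul_mem_cone (hb j) (mem j)
    exact (hd.mulVec hA).mem_interior (h i)

theorem mem_interior_pow_add (S : MinimalSystem x c) (hA : IsKPrimitive Kx A) {s : ℕ} {i : ι}
    (h : (A ^ s) *ᵥ x i ∈ interior (Kx : Set (Fin n → ℝ))) (t : ℕ) :
    (A ^ (s + t)) *ᵥ x i ∈ interior (Kx : Set (Fin n → ℝ)) := by
  induction t with
  | zero => exact h
  | succ t ih =>
    rw [← add_assoc, pow_succ', ← Matrix.mulVec_mulVec]
    exact hA.mulVec_mem_interior ih (mem i) (S.ne_zero i)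

theorem mem_interior_pow_le (S : MinimalSystem x c) (hA : IsKPrimitive Kx A) {s t : ℕ} {i : ι}
    (h : (A ^ s) *ᵥ x i ∈ interior (Kx : Set (Fin n → ℝ))) (hst : s ≤ t) :
    (A ^ t) *ᵥ x i ∈ interior (Kx : Set (Fin n → ℝ)) := by
  obtain ⟨r, rfl⟩ := Nat.exists_eq_add_of_le hst
  exact S.mem_interior_pow_add hA h r

theorem matrixExponent_le_iff (S : MinimalSystem x c) (hA : IsKPrimitive Kx A) {N : ℕ}
    (hN : 0 < N) : matrixExponent Kx A ≤ N ↔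
      ∀ i, (A ^ N) *ᵥ x i ∈ interior (Kx : Set (Fin n → ℝ)) := by
  rw [← S.isKPositive_iff (hA.1.pow N)]
  constructor
  · intro h
    have hne : {p : ℕ | 0 < p ∧ IsKPositive Kx (A ^ p)}.Nonempty := hA.2
    have hmem := Nat.sInf_mem hne
    rw [S.isKPositive_iff (hA.1.pow N)]
    intro i
    exact S.mem_interior_pow_le hA (hmem.2 _ (mem i) (S.ne_zero i)) h
  · intro h
    exact Nat.sInf_le ⟨hN, h⟩

theorem pow_mul_mem_interior (S : MinimalSystem x c) {p : ℕ}
    (hpos : IsKPositive Kx (A ^ p)) {l : ℕ} (hl : 0 < l) (i : ι) :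
    (A ^ (p * l)) *ᵥ x i ∈ interior (Kx : Set (Fin n → ℝ)) := by
  obtain ⟨l, rfl⟩ := Nat.exists_eq_succ_of_ne_zero hl.ne'
  clear hl
  induction l with
  | zero => simpa using hpos _ (mem i) (S.ne_zero i)
  | succ l ih =>
    rw [Nat.mul_succ, add_comm, pow_add, ← Matrix.mulVec_mulVec]
    exact hpos _ (interior_subset ih) (S.ne_zero_of_mem_interior ih)

/-- If `x i` is below a multiple of `A ^ l • x i`, then the Krylov space argument shows that
`A ^ ((n - 1) l)` maps `x i` into the interior. -/
theorem mem_interior_of_dominates_self (S : MinimalSystem x c) (hA : IsKPrimitive Kx A) {l : ℕ}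
    (hl : 0 < l) {i : ι} (h : Dominates Kx ((A ^ l) *ᵥ x i) (x i)) :
    (A ^ ((n - 1) * l)) *ᵥ x i ∈ interior (Kx : Set (Fin n → ℝ)) := by
  obtain ⟨hA0, p, hp, hpos⟩ := hA
  have hchain : ∀ k j, Dominates Kx ((A ^ ((k + j) * l)) *ᵥ x i) ((A ^ (k * l)) *ᵥ x i) := by
    intro k j
    induction j with
    | zero => exact Dominates.refl _
    | succ j ih =>
      refine Dominates.trans ?_ ih
      have := h.mulVec (hA0.pow ((k + j) * l))
      rw [Matrix.mulVec_mulVec, ← pow_add] at this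
      have e : (k + (j + 1)) * l = (k + j) * l + l := by ring
      rwa [e]
  set y := (A ^ ((n - 1) * l)) *ᵥ x i with hy
  have hyK : y ∈ Kx := hA0.pow _ _ (mem i)
  have hdom : ∀ k, k < n → ∃ δ : ℝ, 0 < δ ∧ y - δ • ((A ^ (k * l)) *ᵥ x i) ∈ Kx := by
    intro k hk
    have := hchain k (n - 1 - k)
    rw [Nat.add_sub_cancel' (by omega)] at this
    exact this
  choose! δ hδ hδK using hdom
  have hz := S.pow_mul_mem_interior hpos hl i
  set z := (A ^ (p * l)) *ᵥ x i with hzdef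
  have hdeg : ((Polynomial.X ^ p : Polynomial ℝ) %ₘ (A ^ l).charpoly).natDegree < n ∨ n = 0 := by
    rcases Nat.eq_zero_or_pos n with h0 | h0
    · exact Or.inr h0
    · left
      have := Polynomial.natDegree_modByMonic_lt (Polynomial.X ^ p : Polynomial ℝ)
        (Matrix.charpoly_monic (A ^ l)) (by
          intro h1
          have := Matrix.charpoly_natDegree_eq_dim (A ^ l)
          rw [h1] at this
          simp at this
          omega)
      rwa [Matrix.charpoly_natDegree_eq_dim, Fintype.card_fin] at this
  rcases hdeg with hdeg | h0
  swap
  · subst h0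
    exact absurd (Subsingleton.elim _ _) (S.ne_zero i)
  have hB := Matrix.pow_eq_aeval_mod_charpoly (A ^ l) p
  rw [Polynomial.aeval_eq_sum_range' hdeg, ← pow_mul, mul_comm l p] at hB
  set α := fun k => ((Polynomial.X ^ p : Polynomial ℝ) %ₘ (A ^ l).charpoly).coeff k with hα
  have hzs : z = ∑ k ∈ Finset.range n, α k • ((A ^ (k * l)) *ᵥ x i) := by
    rw [hzdef, hB, Matrix.sum_mulVec]
    refine Finset.sum_congr rfl fun k _ => ?_
    rw [Matrix.smul_mulVec, ← pow_mul, mul_comm l k]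
  have hterm : ∀ k ∈ Finset.range n,
      (|α k| / δ k) • y - α k • ((A ^ (k * l)) *ᵥ x i) ∈ Kx := by
    intro k hk
    have hk := Finset.mem_range.1 hk
    have h1 := hδ k hk
    have e : (|α k| / δ k) • y - α k • ((A ^ (k * l)) *ᵥ x i) =
        (|α k| / δ k) • (y - δ k • ((A ^ (k * l)) *ᵥ x i)) +
          (|α k| - α k) • ((A ^ (k * l)) *ᵥ x i) := by
      match_scalars <;> field_simp
      ring
    rw [e]
    exact Submodule.add_mem _ (smul_mem_cone (by positivity) (hδK k hk))
      (smul_mem_cone (sub_nonneg.2 (le_abs_self _)) (hA0.pow _ _ (mem i)))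
  have hsum := Submodule.sum_mem _ hterm
  rw [Finset.sum_sub_distrib, ← hzs, ← Finset.sum_smul] at hsum
  set C := ∑ k ∈ Finset.range n, |α k| / δ k with hC
  have hC0 : 0 ≤ C := Finset.sum_nonneg fun k hk =>
    div_nonneg (abs_nonneg _) (hδ k (Finset.mem_range.1 hk)).le
  refine mem_interior_of_sub_smul_mem (ε := (C + 1)⁻¹) (by positivity) hz ?_
  have e : y - (C + 1)⁻¹ • z = (C + 1)⁻¹ • ((C • y - z) + y) := by
    match_scalars <;> field_simp
  rw [e]
  exact smul_mem_cone (by positivity) (Submodule.add_mem _ hsum hyK)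

theorem dominates_iterate {ι : Type*} {x : ι → Fin n → ℝ} {K : PointedCone ℝ (Fin n → ℝ)}
    (hx : ∀ i, x i ∈ K) (hA : IsKNonneg K A) {f : ι → ι}
    (hf : ∀ i, x (f i) ∈ genFace K {A *ᵥ x i}) (k : ℕ) (i : ι) :
    Dominates K ((A ^ k) *ᵥ x i) (x (f^[k] i)) := by
  induction k with
  | zero => simpa using Dominates.refl (x i)
  | succ k ih =>
    have h1 := ih.mulVec hA
    rw [Matrix.mulVec_mulVec, ← pow_succ'] at h1
    rw [Function.iterate_succ_apply']
    exact h1.trans ((mem_genFace_iff (hA _ (hx _))).1 (hf _)).2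

theorem mem_interior_of_iterate (S : MinimalSystem x c) (hA : IsKPrimitive Kx A) {f : ι → ι}
    (hf : ∀ i, x (f i) ∈ genFace Kx {A *ᵥ x i}) {d l : ℕ} (hl : 0 < l) {v : ι}
    (h : Function.IsPeriodicPt f l (f^[d] v)) :
    (A ^ (d + (n - 1) * l)) *ᵥ x v ∈ interior (Kx : Set (Fin n → ℝ)) := by
  have h1 := dominates_iterate mem hA.1 hf d v
  have h2 := dominates_iterate mem hA.1 hf l (f^[d] v)
  have h2' : f^[l] (f^[d] v) = f^[d] v := h
  rw [h2'] at h2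
  have h3 := S.mem_interior_of_dominates_self hA hl h2
  have h4 := h1.mulVec (hA.1.pow ((n - 1) * l))
  rw [Matrix.mulVec_mulVec, ← pow_add, add_comm] at h4
  exact h4.mem_interior h3

/-- The nonnegative matrix `M` describes the action of `A` on the vectors `x i`. -/
structure IsRep (x : ι → Fin n → ℝ) (A : Matrix (Fin n) (Fin n) ℝ) (M : Matrix ι ι ℝ) :
    Prop where
  nonneg : ∀ i j, 0 ≤ M i j
  eq : ∀ i, A *ᵥ x i = ∑ j, M i j • x j

theorem IsRep.isKNonneg {M : Matrix ι ι ℝ} (hM : IsRep x A M) : IsKNonneg Kx A := by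
  intro y hy
  obtain ⟨b, hb, rfl⟩ := mem_hull_range_iff.1 hy
  rw [Matrix.mulVec_sum]
  refine Submodule.sum_mem _ fun i _ => ?_
  rw [Matrix.mulVec_smul, hM.eq]
  exact smul_mem_cone (hb i) (Submodule.sum_mem _ fun j _ => smul_mem_cone (hM.nonneg i j) (mem j))

theorem IsRep.pow [DecidableEq ι] {M : Matrix ι ι ℝ} (hM : IsRep x A M) (t : ℕ) :
    IsRep x (A ^ t) (M ^ t) := by
  induction t with
  | zero =>
    refine ⟨fun i j => ?_, fun i => ?_⟩
    · rw [pow_zero, Matrix.one_apply]; split_ifs <;> norm_num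
    · rw [pow_zero, pow_zero, Matrix.one_mulVec, Finset.sum_eq_single i] <;>
        simp +contextual [eq_comm]
  | succ t ih =>
    refine ⟨fun i j => ?_, fun i => ?_⟩
    · rw [pow_succ, Matrix.mul_apply]
      exact Finset.sum_nonneg fun k _ => mul_nonneg (ih.nonneg i k) (hM.nonneg k j)
    · rw [pow_succ', ← Matrix.mulVec_mulVec, ih.eq, Matrix.mulVec_sum, pow_succ]
      simp only [Matrix.mulVec_smul, hM.eq, Matrix.mul_apply, Finset.sum_smul, Finset.smul_sum,
        smul_smul]
      exact Finset.sum_comm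

theorem IsRep.pow_pos_iff [DecidableEq ι] {M : Matrix ι ι ℝ} (hM : IsRep x A M) (t : ℕ) (i j : ι) :
    0 < (M ^ t) i j ↔ j ∈ (outSet fun i j => 0 < M i j)^[t] {i} := by
  induction t generalizing j with
  | zero =>
    rw [pow_zero, Matrix.one_apply]
    by_cases h : i = j
    · subst h; simp
    · simp [h, Ne.symm h]
  | succ t ih =>
    rw [pow_succ, Matrix.mul_apply, Function.iterate_succ_apply']
    have hnn : ∀ k ∈ Finset.univ, 0 ≤ (M ^ t) i k * M k j := fun k _ =>
      mul_nonneg ((hM.pow t).nonneg i k) (hM.nonneg k j)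
    rw [Finset.sum_pos_iff_of_nonneg hnn]
    constructor
    · rintro ⟨k, -, hk⟩
      refine ⟨k, (ih k).1 ?_, ?_⟩
      · exact lt_of_le_of_ne ((hM.pow t).nonneg i k) fun h => by rw [← h] at hk; simp at hk
      · exact lt_of_le_of_ne (hM.nonneg k j) fun h => by rw [← h] at hk; simp at hk
    · rintro ⟨k, hk, hkj⟩
      exact ⟨k, Finset.mem_univ k, mul_pos ((ih k).2 hk) hkj⟩

theorem IsRep.mem_interior_iff (S : MinimalSystem x c)
    (hspan : Submodule.span ℝ (Set.range x) = ⊤) {M : Matrix ι ι ℝ} (hM : IsRep x A M) (i : ι) :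
    A *ᵥ x i ∈ interior (Kx : Set (Fin n → ℝ)) ↔ ∃ s : ℝ, ∀ j, 0 < M i j + s * c j := by
  rw [MinimalSystem.mem_interior_iff hspan, hM.eq]
  constructor
  · rintro ⟨b, hb, h⟩
    obtain ⟨s, hs⟩ := S.eq_add_mul h
    exact ⟨s, fun j => by rw [← hs]; exact hb j⟩
  · rintro ⟨s, hs⟩
    exact ⟨_, hs, S.sum_add_mul _ s⟩

theorem exists_rep_pos_iff {y : Fin n → ℝ} (hy : y ∈ Kx) :
    ∃ b : ι → ℝ, (∀ i, 0 ≤ b i) ∧ ∑ i, b i • x i = y ∧ ∀ i, 0 < b i ↔ x i ∈ genFace Kx {y} := by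
  classical
  have h1 : ∀ j, ∃ b : ι → ℝ, (∀ i, 0 ≤ b i) ∧ ∑ i, b i • x i = y ∧
      (x j ∈ genFace Kx {y} → 0 < b j) := by
    intro j
    by_cases hj : x j ∈ genFace Kx {y}
    · obtain ⟨-, ε, hε, h⟩ := (mem_genFace_iff hy).1 hj
      obtain ⟨b, hb, e⟩ := mem_hull_range_iff.1 h
      refine ⟨fun i => b i + if i = j then ε else 0, fun i => ?_, ?_, fun _ => ?_⟩
      · have := hb i
        dsimp only
        split_ifs <;> linarith
      · simp [add_smul, Finset.sum_add_distrib, e, ite_smul]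
      · simp only [if_true]
        linarith [hb j]
    · obtain ⟨b, hb, e⟩ := mem_hull_range_iff.1 hy
      exact ⟨b, hb, e, fun h => absurd h hj⟩
  choose b hb he hpos using h1
  by_cases hι : IsEmpty ι
  · obtain ⟨b, hb, e⟩ := mem_hull_range_iff.1 hy
    exact ⟨b, hb, e, fun i => (hι.false i).elim⟩
  have hne : Nonempty ι := not_isEmpty_iff.1 hι
  have hcard : (0 : ℝ) < Fintype.card ι := by exact_mod_cast Fintype.card_pos
  refine ⟨fun i => (Fintype.card ι : ℝ)⁻¹ * ∑ j, b j i, fun i => ?_, ?_, fun i => ⟨fun h => ?_, ?_⟩⟩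
  · exact mul_nonneg (by positivity) (Finset.sum_nonneg fun j _ => hb j i)
  · simp only [mul_smul, ← Finset.smul_sum, Finset.sum_smul]
    rw [Finset.sum_comm]
    simp only [he, Finset.sum_const, Finset.card_univ]
    rw [← Nat.cast_smul_eq_nsmul ℝ, smul_smul, inv_mul_cancel₀ hcard.ne', one_smul]
  · have h2 : 0 < ∑ j, b j i := by
      by_contra! h3
      have : (Fintype.card ι : ℝ)⁻¹ * ∑ j, b j i ≤ 0 :=
        mul_nonpos_of_nonneg_of_nonpos (by positivity) h3
      linarith
    obtain ⟨j, -, hj⟩ := (Finset.sum_pos_iff_of_nonneg fun j _ => hb j i).1 h2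
    refine (mem_genFace_iff hy).2 ⟨mem i, b j i, hj, ?_⟩
    rw [← he j, ← Finset.add_sum_erase _ _ (Finset.mem_univ i), add_sub_cancel_left]
    exact Submodule.sum_mem _ fun k _ => smul_mem_cone (hb j k) (mem k)
  · intro h
    refine mul_pos (by positivity) ?_
    exact Finset.sum_pos' (fun j _ => hb j i) ⟨i, Finset.mem_univ i, hpos i h⟩

theorem exists_isRep (hA : IsKNonneg Kx A) : ∃ M : Matrix ι ι ℝ, IsRep x A M ∧
    ∀ i j, 0 < M i j ↔ x j ∈ genFace Kx {A *ᵥ x i} := by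
  choose M h1 h2 h3 using fun i => exists_rep_pos_iff (hA _ (mem i))
  exact ⟨M, ⟨h1, fun i => (h2 i).symm⟩, h3⟩

theorem IsRep.exists_mul_eq (S : MinimalSystem x c) {M : Matrix ι ι ℝ} (hM : IsRep x A M) :
    ∃ r : ℝ, ∀ j, ∑ i, c i * M i j = r * c j := by
  refine S.unique _ ?_
  have : A *ᵥ (∑ i, c i • x i) = 0 := by rw [S.rel, Matrix.mulVec_zero]
  rw [Matrix.mulVec_sum] at this
  rw [← this]
  simp only [Matrix.mulVec_smul, hM.eq, Finset.sum_smul, Finset.smul_sum, smul_smul]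
  exact Finset.sum_comm

/-- Two nonvanishing coefficients on different sides of the relation determine the face. -/
theorem IsRep.mem_genFace_iff (S : MinimalSystem x c) {M : Matrix ι ι ℝ} (hM : IsRep x A M)
    {i p q : ι} (hp : M i p = 0) (hq : M i q = 0) (hpq : c p * c q < 0) (j : ι) :
    x j ∈ genFace Kx {A *ᵥ x i} ↔ 0 < M i j := by
  obtain ⟨b, hb, he, hpos⟩ := exists_rep_pos_iff (hM.isKNonneg _ (mem i))
  have : b = M i := by
    rcases mul_neg_iff.1 hpq with ⟨h1, h2⟩ | ⟨h1, h2⟩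
    · exact S.rep_unique hb (he.trans (hM.eq i)) hp hq h1 h2
    · exact S.rep_unique hb (he.trans (hM.eq i)) hq hp h2 h1
  rw [← hpos, this]

theorem iterate_outSet_ne (S : MinimalSystem x c) (hspan : Submodule.span ℝ (Set.range x) = ⊤)
    (hA : IsKPrimitive Kx A) (i : ι) {k : ℕ} (hk : 0 < k) :
    (outSet fun i j => x j ∈ genFace Kx {A *ᵥ x i})^[k] {i} ≠ {i} := by
  classical
  intro h
  obtain ⟨M, hM, hMp⟩ := exists_isRep hA.1
  have hT : (fun i j => x j ∈ genFace Kx {A *ᵥ x i}) = fun i j => 0 < M i j := by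
    ext i j; rw [hMp]
  rw [hT] at h
  have h0 : ∀ p j, j ≠ i → (M ^ (k * p)) i j = 0 := by
    intro p j hj
    have hs : (outSet fun i j => 0 < M i j)^[k * p] {i} = {i} := by
      rw [Function.iterate_mul]
      exact Function.iterate_fixed h p
    have := hM.pow_pos_iff (k * p) i j
    rw [hs] at this
    by_contra hne
    exact hj (this.1 (lt_of_le_of_ne ((hM.pow (k * p)).nonneg i j) (Ne.symm hne)))
  obtain ⟨p, hp, hpos⟩ := hA.2
  have hint := S.pow_mul_mem_interior hpos hk i
  rw [mul_comm, (hM.pow (k * p)).mem_interior_iff S hspan] at hint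
  obtain ⟨s, hs⟩ := hint
  obtain ⟨q, hq, hcq⟩ := S.exists_pos_ne i
  obtain ⟨r, hr, hcr⟩ := S.exists_neg_ne i
  have h1 := hs q
  have h2 := hs r
  rw [h0 p _ hq] at h1
  rw [h0 p _ hr] at h2
  have : 0 < s := by
    by_contra! hs0
    nlinarith
  nlinarith

theorem isLabelling_iff {K : PointedCone ℝ (Fin n → ℝ)} {m : ℕ} {e : Fin m ≃ extremeRays K}
    {x : Fin m → Fin n → ℝ} (hx : IsRaySystem K e x) (hA : IsKNonneg K A) {D : Digraph (Fin m)} :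
    IsLabelling K A D e ↔ ∀ i j, x j ∈ genFace K {A *ᵥ x i} ↔ D.Adj i j := by
  have key : ∀ i j, (coneDigraph K A).Adj (e i) (e j) ↔ x j ∈ genFace K {A *ᵥ x i} := by
    intro i j
    have hAx := hA _ (hx i).1.1
    constructor
    · rintro ⟨y, hy, h1, h2⟩
      rw [← (hx i).2, (hx i).1.2.2, hy.2.2] at h1
      obtain ⟨a, ha, rfl⟩ := (hull_singleton_eq_iff hy.2.1).1 h1.symm
      rw [← (hx j).2, Matrix.mulVec_smul,
        genFace_le_genFace_iff (smul_mem_cone ha.le hAx),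
        mem_genFace_iff (smul_mem_cone ha.le hAx)] at h2
      obtain ⟨hj, ε, hε, h⟩ := h2
      rw [KCone.mem_genFace_iff hAx]
      refine ⟨hj, a⁻¹ * ε, by positivity, ?_⟩
      have : A *ᵥ x i - (a⁻¹ * ε) • x j = a⁻¹ • (a • (A *ᵥ x i) - ε • x j) := by
        rw [smul_sub, smul_smul, smul_smul, inv_mul_cancel₀ ha.ne', one_smul]
      rw [this]
      exact smul_mem_cone (by positivity) h
    · intro h
      refine ⟨x i, (hx i).1, (hx i).2.symm, ?_⟩
      rw [← (hx j).2, genFace_le_genFace_iff hAx]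
      exact h
  exact forall₂_congr fun i j => by rw [key]

end MinimalSystem
end KCone

namespace KCone

section Walks

/-- The lengths of the closed walks that consist of `k` cycles of length `n` or `n + 1`. -/
def IsCycleSum (n u : ℕ) : Prop :=
  ∃ k b, b ≤ k ∧ u = k * n + b

theorem IsCycleSum.add_left {n u : ℕ} (h : IsCycleSum n u) : IsCycleSum n (u + n) := by
  obtain ⟨k, b, hb, rfl⟩ := h
  exact ⟨k + 1, b, by omega, by ring⟩

theorem IsCycleSum.add_succ {n u : ℕ} (h : IsCycleSum n u) : IsCycleSum n (u + n + 1) := by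
  obtain ⟨k, b, hb, rfl⟩ := h
  exact ⟨k + 1, b + 1, by omega, by ring⟩

theorem IsCycleSum.exists_of_pos {n u : ℕ} (h : IsCycleSum n u) (hu : 0 < u) :
    ∃ w, IsCycleSum n w ∧ (u = w + n ∨ u = w + n + 1) := by
  obtain ⟨k, b, hb, rfl⟩ := h
  rcases Nat.eq_zero_or_pos k with rfl | hk
  · simp at hu; omega
  obtain ⟨k, rfl⟩ := Nat.exists_eq_succ_of_ne_zero hk.ne'
  by_cases hbk : b ≤ k
  · exact ⟨k * n + b, ⟨k, b, hbk, rfl⟩, Or.inl (by rw [Nat.succ_mul]; ring)⟩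
  · obtain ⟨b, rfl⟩ := Nat.exists_eq_succ_of_ne_zero (by omega : b ≠ 0)
    exact ⟨k * n + b, ⟨k, b, by omega, rfl⟩, Or.inr (by rw [Nat.succ_mul, Nat.succ_eq_add_one]; ring)⟩

theorem not_isCycleSum {n q r : ℕ} (hqr : q < r) (hr : r < n) : ¬ IsCycleSum n (q * n + r) := by
  rintro ⟨k, b, hb, h⟩
  rcases lt_trichotomy k q with hk | rfl | hk
  · have : (k + 1) * n ≤ q * n := Nat.mul_le_mul_right _ hk
    have h2 : k * n + n = (k + 1) * n := by ring
    omega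
  · omega
  · have : (q + 1) * n ≤ k * n := Nat.mul_le_mul_right _ hk
    have h2 : q * n + n = (q + 1) * n := by ring
    omega

theorem isCycleSum_of_le {n u : ℕ} (hn : 0 < n) (h : (n - 1) * n ≤ u) : IsCycleSum n u := by
  refine ⟨u / n, u % n, ?_, ?_⟩
  · have h1 : u % n < n := Nat.mod_lt _ hn
    have h2 : n - 1 ≤ u / n := (Nat.le_div_iff_mul_le hn).2 h
    omega
  · rw [mul_comm]; exact (Nat.div_add_mod u n).symm

/-- The heads of the walks of length `t` from the vertex `1` in the two digraphs. -/
def walkSet (n t : ℕ) : Set (Fin (n + 1)) :=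
  {v | ∃ u, IsCycleSum n u ∧ (((v : ℕ) = 0 ∧ u + n = t) ∨ (0 < (v : ℕ) ∧ v + u = t + 1))}

/-- A relation between the arcs of the first and of the second digraph. -/
def IsBetween (n : ℕ) (T : Fin (n + 1) → Fin (n + 1) → Prop) : Prop :=
  (∀ i j, (figure1 (n + 1)).Adj i j → T i j) ∧ ∀ i j, T i j → (figure2 (n + 1)).Adj i j

theorem isBetween_figure1 (n : ℕ) : IsBetween n (figure1 (n + 1)).Adj :=
  ⟨fun _ _ h => h, fun _ _ h => Or.inl h⟩

theorem isBetween_figure2 (n : ℕ) : IsBetween n (figure2 (n + 1)).Adj :=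
  ⟨fun _ _ h => Or.inl h, fun _ _ h => h⟩

theorem outSet_walkSet {n : ℕ} (hn : 2 ≤ n) {T : Fin (n + 1) → Fin (n + 1) → Prop}
    (hT : IsBetween n T) (t : ℕ) : outSet T (walkSet n t) = walkSet n (t + 1) := by
  ext j
  constructor
  · rintro ⟨i, ⟨u, hu, hi⟩, hij⟩
    rcases hT.2 i j hij with (h | ⟨h, h' | h'⟩) | ⟨h, h'⟩
    · rcases hi with ⟨h0, h1⟩ | ⟨h0, h1⟩
      · exact ⟨u + n + 1, hu.add_succ, by omega⟩
      · exact ⟨u, hu, by omega⟩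
    · exact ⟨u, hu, by omega⟩
    · exact ⟨u + n, hu.add_left, by omega⟩
    · exact ⟨u + n, hu.add_left, by omega⟩
  · rintro ⟨u, hu, hj⟩
    have hjn := j.2
    by_cases hj0 : (j : ℕ) = 0
    · refine ⟨Fin.last n, ⟨u, hu, ?_⟩, hT.1 _ _ (Or.inr ⟨by simp, Or.inl hj0⟩)⟩
      simp only [Fin.val_last]
      omega
    by_cases hj1 : (j : ℕ) = 1
    · obtain ⟨w, hw, h⟩ := hu.exists_of_pos (by omega)
      rcases h with h | h
      · refine ⟨Fin.last n, ⟨w, hw, ?_⟩, hT.1 _ _ (Or.inr ⟨by simp, Or.inr hj1⟩)⟩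
        simp only [Fin.val_last]
        omega
      · refine ⟨0, ⟨w, hw, ?_⟩, hT.1 _ _ (Or.inl (by simp [hj1]))⟩
        exact Or.inl ⟨rfl, by omega⟩
    · refine ⟨⟨j - 1, by omega⟩, ⟨u, hu, ?_⟩, hT.1 _ _ (Or.inl ?_)⟩
      · dsimp only
        omega
      · dsimp only
        omega

theorem iterate_outSet_one {n : ℕ} (hn : 2 ≤ n) {T : Fin (n + 1) → Fin (n + 1) → Prop}
    (hT : IsBetween n T) (t : ℕ) : (outSet T)^[t] {1} = walkSet n t := by
  induction t with
  | zero =>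
    ext v
    have h1 : ((1 : Fin (n + 1)) : ℕ) = 1 := by
      rw [Fin.val_one']; exact Nat.mod_eq_of_lt (by omega)
    simp only [Function.iterate_zero, id, Set.mem_singleton_iff, Fin.ext_iff, h1]
    constructor
    · intro h
      exact ⟨0, ⟨0, 0, le_rfl, by simp⟩, by omega⟩
    · rintro ⟨u, -, h⟩
      omega
  | succ t ih => rw [Function.iterate_succ_apply', ih, outSet_walkSet hn hT]

theorem mem_walkSet_of_le {n t : ℕ} (hn : 0 < n) (ht : n * n ≤ t) (v : Fin (n + 1)) :
    v ∈ walkSet n t := by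
  have h1 : n * n = (n - 1) * n + n := by
    obtain ⟨k, rfl⟩ : ∃ k, n = k + 1 := ⟨n - 1, by omega⟩
    simp only [Nat.add_sub_cancel]; ring
  have hv := v.2
  by_cases h : (v : ℕ) = 0
  · exact ⟨t - n, isCycleSum_of_le hn (by omega), Or.inl ⟨h, by omega⟩⟩
  · exact ⟨t + 1 - v, isCycleSum_of_le hn (by omega), Or.inr ⟨by omega, by omega⟩⟩

theorem mem_walkSet_iff {n : ℕ} (hn : 3 ≤ n) (v : Fin (n + 1)) :
    v ∈ walkSet n (n ^ 2 - n - 1) ↔ 2 ≤ (v : ℕ) := by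
  obtain ⟨k, rfl⟩ := Nat.exists_eq_add_of_le hn
  have hv := v.2
  have ht : (3 + k) ^ 2 - (3 + k) - 1 = (k + 1) * (3 + k) + (k + 2) := by
    have : (3 + k) ^ 2 = (k + 1) * (3 + k) + (k + 2) + 1 + (3 + k) := by ring
    omega
  have e : (k + 1) * (3 + k) = k * (3 + k) + (3 + k) := by ring
  rw [ht]
  constructor
  · rintro ⟨u, hu, h⟩
    by_contra hlt
    rcases h with ⟨h0, h1⟩ | ⟨h0, h1⟩
    · exact not_isCycleSum (q := k) (r := k + 2) (n := 3 + k) (by omega) (by omega)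
        (by convert hu using 1; omega)
    · exact not_isCycleSum (q := k + 1) (r := k + 2) (n := 3 + k) (by omega) (by omega)
        (by convert hu using 1; omega)
  · intro h
    refine ⟨(k + 1) * (3 + k) + (k + 3 - v), ⟨k + 1, k + 3 - v, by omega, rfl⟩,
      Or.inr ⟨by omega, by omega⟩⟩

theorem zero_last_notMem_walkSet {n : ℕ} (hn : 3 ≤ n) :
    (0 : Fin (n + 1)) ∉ walkSet n (n ^ 2 - n - 2) ∧
      Fin.last n ∉ walkSet n (n ^ 2 - n - 2) := by
  obtain ⟨k, rfl⟩ := Nat.exists_eq_add_of_le hn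
  have ht : (3 + k) ^ 2 - (3 + k) - 2 = (k + 1) * (3 + k) + (k + 1) := by
    have : (3 + k) ^ 2 = (k + 1) * (3 + k) + (k + 1) + 2 + (3 + k) := by ring
    omega
  have e : (k + 1) * (3 + k) = k * (3 + k) + (3 + k) := by ring
  rw [ht]
  constructor
  · rintro ⟨u, hu, h⟩
    simp only [Fin.val_zero] at h
    exact not_isCycleSum (q := k) (r := k + 1) (n := 3 + k) (by omega) (by omega)
      (by convert hu using 1; omega)
  · rintro ⟨u, hu, h⟩
    simp only [Fin.val_last] at h
    exact not_isCycleSum (q := k) (r := k + 2) (n := 3 + k) (by omega) (by omega)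
      (by convert hu using 1; omega)

theorem mem_iterate_outSet_add {ι : Type*} {T : ι → ι → Prop} {s t : ℕ} {i j k : ι}
    (h : j ∈ (outSet T)^[s] {i}) (h' : k ∈ (outSet T)^[t] {j}) :
    k ∈ (outSet T)^[s + t] {i} := by
  have hmono : ∀ (t : ℕ) (u v : Set ι), u ⊆ v → (outSet T)^[t] u ⊆ (outSet T)^[t] v := by
    intro t
    induction t with
    | zero => exact fun u v h => h
    | succ t ih =>
      intro u v h
      rw [Function.iterate_succ_apply, Function.iterate_succ_apply]
      exact ih _ _ fun a ⟨b, hb, hab⟩ => ⟨b, h hb, hab⟩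
  rw [add_comm, Function.iterate_add_apply]
  exact hmono t _ _ (by simpa using h) h'

theorem mem_iterate_outSet_step {n : ℕ} {T : Fin (n + 1) → Fin (n + 1) → Prop}
    (hT : IsBetween n T) (i : ℕ) (s : ℕ) (h : i + s < n + 1) :
    (⟨i + s, h⟩ : Fin (n + 1)) ∈ (outSet T)^[s] {⟨i, by omega⟩} := by
  induction s with
  | zero => simp
  | succ s ih =>
    rw [Function.iterate_succ_apply']
    exact ⟨_, ih (by omega), hT.1 _ _ (Or.inl rfl)⟩

theorem exists_one_mem_iterate_outSet {n : ℕ} (hn : 2 ≤ n)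
    {T : Fin (n + 1) → Fin (n + 1) → Prop} (hT : IsBetween n T) (i : Fin (n + 1)) :
    ∃ s, s ≤ n ∧ 1 ∈ (outSet T)^[s] {i} := by
  have h1 : ((1 : Fin (n + 1)) : ℕ) = 1 := by
    rw [Fin.val_one']; exact Nat.mod_eq_of_lt (by omega)
  by_cases hi : (i : ℕ) = 0
  · refine ⟨1, by omega, i, rfl, hT.1 _ _ (Or.inl ?_)⟩
    rw [h1, hi]
  · refine ⟨n - i + 1, by omega, ?_⟩
    rw [Function.iterate_succ_apply']
    have hi' := i.2
    refine ⟨_, mem_iterate_outSet_step hT i (n - i) (by omega), hT.1 _ _ (Or.inr ⟨?_, ?_⟩)⟩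
    · dsimp only
      omega
    · exact Or.inr h1

theorem mem_iterate_outSet_of_le {n : ℕ} (hn : 2 ≤ n) {T : Fin (n + 1) → Fin (n + 1) → Prop}
    (hT : IsBetween n T) (i j : Fin (n + 1)) : j ∈ (outSet T)^[n * n + n] {i} := by
  obtain ⟨s, hs, h⟩ := exists_one_mem_iterate_outSet hn hT i
  have h2 : j ∈ (outSet T)^[n * n + n - s] {1} := by
    rw [iterate_outSet_one hn hT]
    exact mem_walkSet_of_le (by omega) (by omega) j
  have := mem_iterate_outSet_add h h2
  rwa [show s + (n * n + n - s) = n * n + n by omega] at this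

end Walks
end KCone

namespace KCone

section Signs

theorem fin_val_one {n : ℕ} (hn : 1 ≤ n) : ((1 : Fin (n + 1)) : ℕ) = 1 := by
  rw [Fin.val_one']; exact Nat.mod_eq_of_lt (by omega)

/-- The column sums of a matrix whose digraph lies between the two digraphs. -/
theorem sum_mul_col {n : ℕ} (hn : 3 ≤ n) {M : Matrix (Fin (n + 1)) (Fin (n + 1)) ℝ}
    (hM : ∀ i j, ¬ (figure2 (n + 1)).Adj i j → M i j = 0) (c : Fin (n + 1) → ℝ) :
    (∑ i, c i * M i 0 = c (Fin.last n) * M (Fin.last n) 0) ∧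
    (∑ i, c i * M i 1 = c 0 * M 0 1 + c (Fin.last n) * M (Fin.last n) 1) ∧
    (∑ i, c i * M i ⟨2, by omega⟩ = c 0 * M 0 ⟨2, by omega⟩ + c 1 * M 1 ⟨2, by omega⟩) ∧
    ∀ k (h : k < n), 2 ≤ k → ∑ i, c i * M i ⟨k + 1, by omega⟩ =
      c ⟨k, by omega⟩ * M ⟨k, by omega⟩ ⟨k + 1, by omega⟩ := by
  have h1 := fin_val_one (n := n) (by omega)
  have h0 : ((0 : Fin (n + 1)) : ℕ) = 0 := rfl
  have hz : ∀ i j, ¬ (figure2 (n + 1)).Adj i j → c i * M i j = 0 := fun i j h => by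
    rw [hM i j h, mul_zero]
  refine ⟨?_, ?_, ?_, ?_⟩
  · refine Fintype.sum_eq_single _ fun i hi => hz _ _ ?_
    have := Fin.val_ne_of_ne hi
    rw [Fin.val_last] at this
    simp only [figure2, figure1]
    omega
  · refine Fintype.sum_eq_add _ _ (Fin.ne_of_val_ne (by rw [Fin.val_last]; omega))
      fun i hi => hz _ _ ?_
    have ha := Fin.val_ne_of_ne hi.1
    have hb := Fin.val_ne_of_ne hi.2
    rw [Fin.val_last] at hb
    simp only [figure2, figure1]
    omega
  · refine Fintype.sum_eq_add _ _ (Fin.ne_of_val_ne (by omega)) fun i hi => hz _ _ ?_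
    have ha := Fin.val_ne_of_ne hi.1
    have hb := Fin.val_ne_of_ne hi.2
    simp only [figure2, figure1]
    omega
  · intro k hk h2
    refine Fintype.sum_eq_single _ fun i hi => hz _ _ ?_
    have := Fin.val_ne_of_ne hi
    dsimp only at this
    simp only [figure2, figure1]
    omega

/-- The signs of the coefficients alternate along the cycle `1, 3, 4, …, n + 1` of the
second digraph. -/
def altSign (n k : ℕ) : ℤ :=
  if k = 0 then - (-1) ^ n else (-1) ^ k

theorem altSign_eq_or (n k : ℕ) : altSign n k = 1 ∨ altSign n k = -1 := by
  unfold altSign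
  split_ifs
  · rcases neg_one_pow_eq_or ℤ n with h | h <;> simp [h]
  · exact neg_one_pow_eq_or ℤ k

/-- Apart from the entry with index `1`, the signs of `c` are those of `altSign`, up to a
common factor. -/
def HasAltSigns (n : ℕ) (σ : ℝ) (c : Fin (n + 1) → ℝ) : Prop :=
  ∀ k : Fin (n + 1), (k : ℕ) ≠ 1 → 0 < σ * altSign n k * c k

theorem HasAltSigns.mul_neg {n : ℕ} {σ : ℝ} {c : Fin (n + 1) → ℝ} (h : HasAltSigns n σ c)
    {i j : Fin (n + 1)} (hi : (i : ℕ) ≠ 1) (hj : (j : ℕ) ≠ 1)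
    (hij : altSign n i * altSign n j = -1) : c i * c j < 0 := by
  have h1 := mul_pos (h i hi) (h j hj)
  have h2 : (altSign n i : ℝ) * altSign n j = -1 := by exact_mod_cast hij
  have h3 : σ * altSign n i * c i * (σ * altSign n j * c j) =
      (altSign n i * altSign n j) * (σ ^ 2 * (c i * c j)) := by ring
  rw [h3, h2] at h1
  by_contra! h4
  have := mul_nonneg (sq_nonneg σ) h4
  linarith

theorem HasAltSigns.ne_zero {n : ℕ} {σ : ℝ} {c : Fin (n + 1) → ℝ} (h : HasAltSigns n σ c)
    {i : Fin (n + 1)} (hi : (i : ℕ) ≠ 1) : c i ≠ 0 := by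
  intro h0
  have := h i hi
  rw [h0] at this
  simp at this

theorem HasAltSigns.mul_succ_neg {n : ℕ} {σ : ℝ} {c : Fin (n + 1) → ℝ} (h : HasAltSigns n σ c)
    {k : ℕ} (hk : 2 ≤ k) (hkn : k < n) : c ⟨k, by omega⟩ * c ⟨k + 1, by omega⟩ < 0 := by
  refine h.mul_neg (by dsimp only; omega) (by dsimp only; omega) ?_
  simp only [altSign]
  rw [if_neg (by omega), if_neg (by omega), pow_succ]
  rcases neg_one_pow_eq_or ℤ k with h | h <;> simp [h]

theorem HasAltSigns.mul_last_zero_neg {n : ℕ} (hn : 2 ≤ n) {σ : ℝ} {c : Fin (n + 1) → ℝ}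
    (h : HasAltSigns n σ c) : c (Fin.last n) * c 0 < 0 := by
  refine h.mul_neg (by rw [Fin.val_last]; omega) (by rw [Fin.val_zero]; omega) ?_
  simp only [altSign, Fin.val_last, Fin.val_zero]
  rw [if_neg (by omega), if_pos trivial]
  rcases neg_one_pow_eq_or ℤ n with h | h <;> simp [h]

theorem exists_hasAltSigns {n : ℕ} (hn : 3 ≤ n) {M : Matrix (Fin (n + 1)) (Fin (n + 1)) ℝ}
    (hM0 : ∀ i j, 0 ≤ M i j) (hM : IsBetween n fun i j => 0 < M i j) {c : Fin (n + 1) → ℝ}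
    {r : ℝ} (hr : ∀ j, ∑ i, c i * M i j = r * c j) (hpos : ∃ i, 0 < c i) (hneg : ∃ i, c i < 0) :
    (∃ σ : ℝ, σ ≠ 0 ∧ HasAltSigns n σ c) ∧
      (M 0 ⟨2, by omega⟩ = 0 → c 1 * c ⟨2, by omega⟩ < 0) := by
  have h1 := fin_val_one (n := n) (by omega)
  obtain ⟨e0, e1, e2, e3⟩ := sum_mul_col hn (M := M) (fun i j h =>
    le_antisymm (not_lt.1 fun h' => h (hM.2 i j h')) (hM0 i j)) c
  rw [hr] at e0 e1 e2
  simp only [hr] at e3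
  have p0 : 0 < M (Fin.last n) 0 := hM.1 _ _ (Or.inr ⟨by simp, Or.inl rfl⟩)
  have p1 : 0 < M (Fin.last n) 1 := hM.1 _ _ (Or.inr ⟨by simp, Or.inr h1⟩)
  have p2 : 0 < M 0 1 := hM.1 _ _ (Or.inl (by rw [h1]; rfl))
  have p3 : 0 < M 1 ⟨2, by omega⟩ := hM.1 _ _ (Or.inl (by rw [h1]))
  have p4 : ∀ k (h : k < n), 2 ≤ k → 0 < M ⟨k, by omega⟩ ⟨k + 1, by omega⟩ :=
    fun k h _ => hM.1 _ _ (Or.inl rfl)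
  have cover : ∀ p : Fin (n + 1) → Prop, (∀ k (h : k < n + 1), 2 ≤ k → p ⟨k, h⟩) → p 0 → p 1 →
      ∀ i, p i := by
    intro p h2 h0 h1' i
    by_cases hi0 : (i : ℕ) = 0
    · have : i = 0 := Fin.ext hi0
      rwa [this]
    by_cases hi1 : (i : ℕ) = 1
    · have : i = 1 := Fin.ext (by rw [hi1, h1])
      rwa [this]
    exact h2 i i.2 (by omega)
  have hlast : (⟨n, by omega⟩ : Fin (n + 1)) = Fin.last n := rfl
  -- positivity spreads from the entry `2` if `r` is positive
  have spread : 0 < r → ∀ s : ℝ, 0 ≤ s * c ⟨2, by omega⟩ → ∀ i, 0 ≤ s * c i := by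
    intro hr0 s hs
    have ht : ∀ k (h : k < n + 1), 2 ≤ k → 0 ≤ s * c ⟨k, h⟩ := by
      intro k h hk
      induction k, hk using Nat.le_induction with
      | base => exact hs
      | succ k hk ih =>
        have ih := ih (by omega)
        have := e3 k (by omega) hk
        have h2 : r * (s * c ⟨k + 1, h⟩) =
            (s * c ⟨k, by omega⟩) * M ⟨k, by omega⟩ ⟨k + 1, by omega⟩ := by
          linear_combination s * this
        have h3 : 0 ≤ r * (s * c ⟨k + 1, h⟩) := by
          rw [h2]; exact mul_nonneg ih (hM0 _ _)
        exact nonneg_of_mul_nonneg_right h3 hr0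
    have hl := ht n (by omega) (by omega)
    rw [hlast] at hl
    have h0 : 0 ≤ s * c 0 := by
      have h2 : r * (s * c 0) = (s * c (Fin.last n)) * M (Fin.last n) 0 := by
        linear_combination s * e0
      exact nonneg_of_mul_nonneg_right (by rw [h2]; exact mul_nonneg hl (hM0 _ _)) hr0
    refine cover _ ht h0 ?_
    have h2 : r * (s * c 1) = (s * c 0) * M 0 1 + (s * c (Fin.last n)) * M (Fin.last n) 1 := by
      linear_combination s * e1
    exact nonneg_of_mul_nonneg_right (by
      rw [h2]; exact add_nonneg (mul_nonneg h0 (hM0 _ _)) (mul_nonneg hl (hM0 _ _))) hr0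
  have hne : ¬ ∀ i, c i = 0 := by
    intro h
    obtain ⟨i, hi⟩ := hpos
    rw [h i] at hi
    exact lt_irrefl _ hi
  have hrneg : r < 0 := by
    rcases lt_trichotomy r 0 with h | h | h
    · exact h
    · exfalso
      subst h
      simp only [zero_mul] at e0 e1 e2 e3
      have hl : c (Fin.last n) = 0 := (mul_eq_zero.1 e0.symm).resolve_right p0.ne'
      rw [hl, zero_mul, add_zero] at e1
      have h0 : c 0 = 0 := (mul_eq_zero.1 e1.symm).resolve_right p2.ne'
      rw [h0, zero_mul, zero_add] at e2
      have h1' : c 1 = 0 := (mul_eq_zero.1 e2.symm).resolve_right p3.ne'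
      refine hne (cover _ (fun k hk h2 => ?_) h0 h1')
      by_cases hkn : k = n
      · subst hkn; exact hl
      · exact (mul_eq_zero.1 (e3 k (by omega) h2).symm).resolve_right (p4 k (by omega) h2).ne'
    · exfalso
      rcases le_total 0 (c ⟨2, by omega⟩) with h2 | h2
      · obtain ⟨i, hi⟩ := hneg
        have := spread h 1 (by linarith) i
        linarith
      · obtain ⟨i, hi⟩ := hpos
        have := spread h (-1) (by linarith) i
        linarith
  have hc2 : c ⟨2, by omega⟩ ≠ 0 := by
    intro h
    have ht : ∀ k (h : k < n + 1), 2 ≤ k → c ⟨k, h⟩ = 0 := by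
      intro k hk h2
      induction k, h2 using Nat.le_induction with
      | base => exact h
      | succ k h2 ih =>
        have := e3 k (by omega) h2
        rw [ih (by omega), zero_mul] at this
        exact (mul_eq_zero.1 this).resolve_left hrneg.ne
    have hl := ht n (by omega) (by omega)
    rw [hlast] at hl
    rw [hl, zero_mul] at e0
    have h0 := (mul_eq_zero.1 e0).resolve_left hrneg.ne
    rw [h0, hl, zero_mul, zero_mul, add_zero] at e1
    exact hne (cover _ ht h0 ((mul_eq_zero.1 e1).resolve_left hrneg.ne))
  refine ⟨⟨c ⟨2, by omega⟩, hc2, ?_⟩, ?_⟩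
  · have ht : ∀ k (h : k < n + 1), 2 ≤ k → 0 < c ⟨2, by omega⟩ * (-1) ^ k * c ⟨k, h⟩ := by
      intro k hk h2
      induction k, h2 using Nat.le_induction with
      | base => norm_num; exact hc2
      | succ k h2 ih =>
        have := e3 k (by omega) h2
        have h3 : r * (c ⟨2, by omega⟩ * (-1) ^ (k + 1) * c ⟨k + 1, hk⟩) =
            - ((c ⟨2, by omega⟩ * (-1) ^ k * c ⟨k, by omega⟩) *
              M ⟨k, by omega⟩ ⟨k + 1, by omega⟩) := by
          rw [pow_succ]
          linear_combination (- c ⟨2, by omega⟩ * (-1) ^ k) * this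
        have h4 := mul_pos (ih (by omega)) (p4 k (by omega) h2)
        by_contra! h5
        have := mul_nonneg_of_nonpos_of_nonpos hrneg.le h5
        linarith
    have hl := ht n (by omega) (by omega)
    rw [hlast] at hl
    have h0 : 0 < c ⟨2, by omega⟩ * (- (-1) ^ n) * c 0 := by
      have h3 : r * (c ⟨2, by omega⟩ * (- (-1) ^ n) * c 0) =
          - ((c ⟨2, by omega⟩ * (-1) ^ n * c (Fin.last n)) * M (Fin.last n) 0) := by
        linear_combination (- c ⟨2, by omega⟩ * (-1) ^ n) * e0
      have h4 := mul_pos hl p0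
      by_contra! h5
      have := mul_nonneg_of_nonpos_of_nonpos hrneg.le h5
      linarith
    refine cover _ (fun k h hk _ => ?_) (fun _ => ?_) (fun h => absurd h1 h)
    · have := ht k h hk
      simp only [altSign]
      rw [if_neg (by omega)]
      push_cast
      exact this
    · simp only [altSign, Fin.val_zero, if_true]
      push_cast
      exact h0
  · intro h02
    rw [h02, mul_zero, zero_add] at e2
    have h3 : (c 1 * c ⟨2, by omega⟩) * M 1 ⟨2, by omega⟩ = r * (c ⟨2, by omega⟩) ^ 2 := by
      linear_combination (- c ⟨2, by omega⟩) * e2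
    have h4 : r * (c ⟨2, by omega⟩) ^ 2 < 0 := mul_neg_of_neg_of_pos hrneg (by positivity)
    by_contra! h5
    have := mul_nonneg h5 p3.le
    linarith

theorem signSum_of_hasAltSigns {n : ℕ} (hn : 2 ≤ n) {σ : ℝ} {c : Fin (n + 1) → ℝ}
    (h : HasAltSigns n σ c) :
    signSum c = (if Even n then 0 else ((SignType.sign σ : SignType) : ℤ)) +
      ((SignType.sign (c 1) : SignType) : ℤ) := by
  obtain ⟨m, rfl⟩ : ∃ m, n = m + 2 := ⟨n - 2, by omega⟩
  have hs : ∀ k : Fin (m + 2 + 1), (k : ℕ) ≠ 1 → ((SignType.sign (c k) : SignType) : ℤ) =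
      ((SignType.sign σ : SignType) : ℤ) * altSign (m + 2) k := by
    intro k hk
    have h1 := h k hk
    rcases altSign_eq_or (m + 2) k with h2 | h2
    · rw [h2] at h1 ⊢
      simp only [Int.cast_one, mul_one] at h1 ⊢
      rcases pos_and_pos_or_neg_and_neg_of_mul_pos h1 with ⟨a, b⟩ | ⟨a, b⟩
      · rw [sign_pos a, sign_pos b]
      · rw [sign_neg a, sign_neg b]
    · rw [h2] at h1 ⊢
      simp only [Int.cast_neg, Int.cast_one, mul_neg, mul_one, neg_mul] at h1 ⊢
      have h3 : σ * c k < 0 := by linarith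
      rcases mul_neg_iff.1 h3 with ⟨a, b⟩ | ⟨a, b⟩
      · rw [sign_pos a, sign_neg b]; rfl
      · rw [sign_neg a, sign_pos b]; rfl
  rw [signSum, Fin.sum_univ_succ, Fin.sum_univ_succ, hs 0 (by simp)]
  have htail : ∑ i : Fin (m + 1), ((SignType.sign (c i.succ.succ) : SignType) : ℤ) =
      ((SignType.sign σ : SignType) : ℤ) * if Even (m + 1) then 0 else 1 := by
    have : ∀ i : Fin (m + 1), ((SignType.sign (c i.succ.succ) : SignType) : ℤ) =
        ((SignType.sign σ : SignType) : ℤ) * (-1) ^ (i : ℕ) := by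
      intro i
      rw [hs _ (by simp)]
      congr 1
      simp only [altSign, Fin.val_succ]
      rw [if_neg (by omega), pow_succ, pow_succ]
      ring
    rw [Finset.sum_congr rfl fun i _ => this i, ← Finset.mul_sum,
      Fin.sum_univ_eq_sum_range (fun k => (-1 : ℤ) ^ k), neg_one_geom_sum]
  rw [htail]
  have h10 : (Fin.succ 0 : Fin (m + 2 + 1)) = 1 := rfl
  rw [h10]
  simp only [altSign, Fin.val_zero, if_true]
  by_cases he : Even m
  · have h1 : Even (m + 2) := he.add (by decide)
    have h2 : ¬ Even (m + 1) := by rw [Nat.even_add_one]; simpa using he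
    rw [if_pos h1, if_neg h2, h1.neg_one_pow]
    ring
  · have h1 : ¬ Even (m + 2) := by rwa [Nat.even_add, iff_true_right (by decide)]
    have h2 : Even (m + 1) := by rw [Nat.even_add_one]; exact he
    rw [if_neg h1, if_pos h2, (Nat.not_even_iff_odd.1 h1).neg_one_pow]
    ring

theorem card_sign_add {ι : Type*} [Fintype ι] (c : ι → ℝ) :
    {i | 0 < c i}.ncard + {i | c i < 0}.ncard + {i | c i = 0}.ncard = Fintype.card ι := by
  classical
  have h1 : {i | 0 < c i}.ncard + {i | c i < 0}.ncard = ({i | 0 < c i} ∪ {i | c i < 0}).ncard := by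
    rw [Set.ncard_union_eq]
    rw [Set.disjoint_left]
    intro i h1 h2
    have h1 : 0 < c i := h1
    have h2 : c i < 0 := h2
    exact lt_asymm h1 h2
  rw [h1, ← Set.ncard_union_eq, ← Nat.card_eq_fintype_card, ← Set.ncard_univ]
  · congr 1
    ext i
    have := lt_trichotomy (c i) 0
    simp only [Set.mem_union, Set.mem_ofPred_eq, Set.mem_univ, iff_true]
    tauto
  · rw [Set.disjoint_left]
    rintro i (h1 | h1) h2
    · exact h1.ne' h2
    · exact h1.ne h2

theorem exists_perm_sign_eq {ι : Type*} [Fintype ι] {c d : ι → ℝ} (h : signSum c = signSum d)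
    (h0 : {i | c i = 0}.ncard = {i | d i = 0}.ncard) :
    ∃ e : ι ≃ ι, ∀ i, SignType.sign (c (e i)) = SignType.sign (d i) := by
  classical
  have hc := card_sign_add c
  have hd := card_sign_add d
  rw [signSum_eq, signSum_eq] at h
  have key : ∀ s : SignType, Nonempty ({i // SignType.sign (d i) = s} ≃
      {i // SignType.sign (c i) = s}) := by
    intro s
    rw [← Fintype.card_eq, ← Nat.card_eq_fintype_card, ← Nat.card_eq_fintype_card]
    have e : ∀ (b : ι → ℝ) (p : ι → Prop), (∀ i, SignType.sign (b i) = s ↔ p i) →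
        Nat.card {i // SignType.sign (b i) = s} = {i | p i}.ncard := by
      intro b p hp
      rw [← Nat.card_coe_set_eq]
      exact Nat.card_congr (Equiv.subtypeEquivRight hp)
    rcases s with _ | _ | _
    · rw [e d (fun i => d i = 0) (fun i => sign_eq_zero_iff),
        e c (fun i => c i = 0) (fun i => sign_eq_zero_iff), h0]
    · rw [e d (fun i => d i < 0) (fun i => sign_eq_neg_one_iff),
        e c (fun i => c i < 0) (fun i => sign_eq_neg_one_iff)]
      omega
    · rw [e d (fun i => 0 < d i) (fun i => sign_eq_one_iff),
        e c (fun i => 0 < c i) (fun i => sign_eq_one_iff)]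
      omega
  exact ⟨Equiv.ofFiberEquiv fun s => (key s).some, fun i =>
    Equiv.ofFiberEquiv_map (f := fun i => SignType.sign (d i)) (g := fun i => SignType.sign (c i)) _ i⟩

/-- The model for the signs, with value `τ` at the index `1`. -/
noncomputable def altModel (n : ℕ) (τ : ℝ) (k : Fin (n + 1)) : ℝ :=
  if (k : ℕ) = 1 then τ else altSign n k

theorem altModel_one {n : ℕ} (hn : 1 ≤ n) (τ : ℝ) : altModel n τ 1 = τ :=
  if_pos (fin_val_one hn)

theorem hasAltSigns_altModel (n : ℕ) (τ : ℝ) : HasAltSigns n 1 (altModel n τ) := by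
  intro k hk
  rw [altModel, if_neg hk]
  rcases altSign_eq_or n k with h | h <;> simp [h]

theorem HasAltSigns.of_sign_eq {n : ℕ} {σ : ℝ} {c d : Fin (n + 1) → ℝ} (h : HasAltSigns n σ d)
    (hs : ∀ k, SignType.sign (c k) = SignType.sign (d k)) : HasAltSigns n σ c := by
  intro k hk
  have h1 := h k hk
  rw [← sign_eq_one_iff, sign_mul] at h1 ⊢
  rw [hs k]; exact h1

theorem HasAltSigns.neg_right {n : ℕ} {σ : ℝ} {c : Fin (n + 1) → ℝ}
    (h : HasAltSigns n σ fun i => - c i) : HasAltSigns n (-σ) c := by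
  intro k hk
  have := h k hk
  linarith

theorem exists_perm_hasAltSigns {n : ℕ} (hn : 3 ≤ n) {c : Fin (n + 1) → ℝ}
    (hc : ∀ i, c i ≠ 0) (hb : |signSum c| ≤ 1) :
    ∃ e : Fin (n + 1) ≃ Fin (n + 1), (∃ σ, HasAltSigns n σ (c ∘ e)) ∧
      c (e 1) * c (e ⟨2, by omega⟩) < 0 := by
  have h1 := fin_val_one (n := n) (by omega)
  have hmodel : ∀ i, altModel n (-1) i ≠ 0 := by
    intro i
    by_cases hi : (i : ℕ) = 1
    · rw [altModel, if_pos hi]; norm_num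
    · exact (hasAltSigns_altModel n (-1)).ne_zero hi
  have hzero : ∀ d : Fin (n + 1) → ℝ, (∀ i, d i ≠ 0) → {i | d i = 0}.ncard = 0 := by
    intro d hd
    have : {i | d i = 0} = ∅ := by ext i; simp [hd i]
    rw [this, Set.ncard_empty]
  have hsum := signSum_of_hasAltSigns (by omega) (hasAltSigns_altModel n (-1))
  rw [altModel_one (by omega)] at hsum
  have key : ∀ d : Fin (n + 1) → ℝ, (∀ i, d i ≠ 0) → signSum d = signSum (altModel n (-1)) →
      ∃ e : Fin (n + 1) ≃ Fin (n + 1), HasAltSigns n 1 (d ∘ e) ∧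
        d (e 1) * d (e ⟨2, by omega⟩) < 0 := by
    intro d hd h
    obtain ⟨e, he⟩ := exists_perm_sign_eq h (by rw [hzero d hd, hzero _ hmodel])
    have hA : HasAltSigns n 1 (d ∘ e) := (hasAltSigns_altModel n (-1)).of_sign_eq he
    refine ⟨e, hA, ?_⟩
    have h2 := hA ⟨2, by omega⟩ (by simp)
    simp only [altSign] at h2
    norm_num at h2
    have h3 := he 1
    rw [altModel_one (by omega), sign_neg (by norm_num : (-1 : ℝ) < 0), sign_eq_neg_one_iff] at h3
    exact mul_neg_of_neg_of_pos h3 h2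
  by_cases h : signSum c = signSum (altModel n (-1))
  · obtain ⟨e, he, h⟩ := key c hc h
    exact ⟨e, ⟨1, he⟩, h⟩
  · obtain ⟨e, he, h⟩ := key (fun i => - c i) (fun i => neg_ne_zero.2 (hc i)) (by
      rw [signSum_neg]
      have hcard := card_sign_add c
      rw [hzero c hc, Fintype.card_fin] at hcard
      rw [sign_pos one_pos, sign_neg (by norm_num : (-1 : ℝ) < 0)] at hsum
      simp only [SignType.coe_one, SignType.coe_neg] at hsum
      rw [abs_le] at hb
      have hsc := signSum_eq c
      split_ifs at hsum with hev
      · obtain ⟨m, hm⟩ := hev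
        omega
      · rw [Nat.not_even_iff_odd] at hev
        obtain ⟨m, hm⟩ := hev
        omega)
    exact ⟨e, ⟨-1, he.neg_right⟩, by simpa using h⟩

theorem exists_perm_hasAltSigns_zero {n : ℕ} (hn : 3 ≤ n) (hev : Even n) {c : Fin (n + 1) → ℝ}
    (hc : ∃ z, ∀ i, c i = 0 ↔ i = z) (hb : |signSum c| ≤ 1) :
    ∃ e : Fin (n + 1) ≃ Fin (n + 1), (∃ σ, HasAltSigns n σ (c ∘ e)) ∧ c (e 1) = 0 := by
  obtain ⟨z, hz⟩ := hc
  have h1 : {i | c i = 0}.ncard = 1 := by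
    have : {i | c i = 0} = {z} := by ext i; simp [hz i]
    rw [this, Set.ncard_singleton]
  have h2 : {i | altModel n 0 i = 0}.ncard = 1 := by
    have : {i | altModel n 0 i = 0} = {1} := by
      ext i
      simp only [Set.mem_ofPred_eq, Set.mem_singleton_iff, Fin.ext_iff, fin_val_one (n := n)
        (by omega)]
      constructor
      · intro h
        by_contra hne
        exact (hasAltSigns_altModel n 0).ne_zero hne h
      · intro h
        rw [altModel, if_pos h]
    rw [this, Set.ncard_singleton]
  have hsum := signSum_of_hasAltSigns (by omega) (hasAltSigns_altModel n 0)
  rw [altModel_one (by omega), if_pos hev, sign_zero, SignType.coe_zero, add_zero] at hsum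
  obtain ⟨e, he⟩ := exists_perm_sign_eq (c := c) (d := altModel n 0) (by
    rw [hsum]
    have hcard := card_sign_add c
    rw [h1, Fintype.card_fin] at hcard
    rw [abs_le] at hb
    have hsc := signSum_eq c
    obtain ⟨m, hm⟩ := hev
    omega) (by rw [h1, h2])
  refine ⟨e, ⟨1, (hasAltSigns_altModel n 0).of_sign_eq he⟩, ?_⟩
  have := he 1
  rwa [altModel_one (by omega), sign_zero, sign_eq_zero_iff] at this

end Signs
end KCone

namespace KCone
open Matrix

namespace MinimalSystem

section Existence

variable {n : ℕ} {ι : Type*} [Fintype ι] {x : ι → Fin n → ℝ} {c : ι → ℝ}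
  {A : Matrix (Fin n) (Fin n) ℝ}

theorem exists_isRep_of_relation (S : MinimalSystem x c)
    (hspan : Submodule.span ℝ (Set.range x) = ⊤) {M : Matrix ι ι ℝ} (hM : ∀ i j, 0 ≤ M i j)
    {r : ℝ} (hr : ∀ j, ∑ i, c i * M i j = r * c j) :
    ∃ A : Matrix (Fin n) (Fin n) ℝ, IsRep x A M := by
  classical
  have hs : Function.Surjective (Fintype.linearCombination ℝ x) := by
    rw [← LinearMap.range_eq_top, Fintype.range_linearCombination, hspan]
  obtain ⟨g, hg⟩ := LinearMap.exists_rightInverse_of_surjective _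
    (LinearMap.range_eq_top.2 hs)
  let y : ι → Fin n → ℝ := fun i => ∑ j, M i j • x j
  let B := (Fintype.linearCombination ℝ y) ∘ₗ g
  refine ⟨LinearMap.toMatrix' B, hM, fun i => ?_⟩
  rw [LinearMap.toMatrix'_mulVec]
  have h1 : Fintype.linearCombination ℝ x (g (x i)) = x i := LinearMap.congr_fun hg (x i)
  rw [Fintype.linearCombination_apply] at h1
  obtain ⟨t, ht⟩ := S.eq_add_mul (b := g (x i)) (b' := Pi.single i 1) (by
    rw [h1, Finset.sum_eq_single i] <;> simp +contextual)
  have h2 : ∑ j, c j • y j = 0 := by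
    have : ∑ j, c j • y j = r • ∑ j, c j • x j := by
      simp only [y, Finset.smul_sum, smul_smul]
      rw [Finset.sum_comm]
      refine Finset.sum_congr rfl fun j _ => ?_
      rw [← Finset.sum_smul, hr]
    rw [this, S.rel, smul_zero]
  change Fintype.linearCombination ℝ y (g (x i)) = y i
  rw [Fintype.linearCombination_apply]
  simp only [ht, add_smul, Finset.sum_add_distrib, mul_smul, ← Finset.smul_sum, h2, smul_zero,
    add_zero]
  rw [Finset.sum_eq_single i] <;> simp +contextual

end Existence

section Figures

variable {n : ℕ} {x : Fin (n + 1) → Fin n → ℝ} {c : Fin (n + 1) → ℝ}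
  {A : Matrix (Fin n) (Fin n) ℝ} {M : Matrix (Fin (n + 1)) (Fin (n + 1)) ℝ}

theorem IsRep.isKPrimitive (hn : 2 ≤ n) (S : MinimalSystem x c)
    (hspan : Submodule.span ℝ (Set.range x) = ⊤) (hM : IsRep x A M)
    (hT : IsBetween n fun i j => 0 < M i j) :
    IsKPrimitive (PointedCone.hull ℝ (Set.range x)) A := by
  refine ⟨hM.isKNonneg, n * n + n, by positivity, ?_⟩
  rw [S.isKPositive_iff (hM.isKNonneg.pow _)]
  intro i
  rw [(hM.pow _).mem_interior_iff S hspan]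
  refine ⟨0, fun j => ?_⟩
  rw [zero_mul, add_zero, hM.pow_pos_iff]
  exact mem_iterate_outSet_of_le hn hT i j

theorem exists_pos_combination {a b : ℝ} (h : b * a < 0) (α : ℝ) :
    ∃ p q : ℝ, 0 < p ∧ 0 < q ∧ a * p + b * q = α := by
  have ha : a ≠ 0 := by rintro rfl; simp at h
  have hb : b ≠ 0 := by rintro rfl; simp at h
  have hab : 0 < - b / a := by
    have : - b / a = - (b * a) / a ^ 2 := by field_simp
    rw [this]
    exact div_pos (by linarith) (by positivity)
  have hq : 0 < (|α / a| + 1) / (- b / a) := by positivity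
  refine ⟨α / a + (- b / a) * ((|α / a| + 1) / (- b / a)), _, ?_, hq, ?_⟩
  · rw [mul_div_cancel₀ _ hab.ne']
    linarith [neg_abs_le (α / a)]
  · field_simp
    ring

theorem neg_div_pos_of_mul_neg {a b : ℝ} (h : a * b < 0) : 0 < - b / a := by
  have ha : a ≠ 0 := by rintro rfl; simp at h
  have : - b / a = - (a * b) / a ^ 2 := by field_simp
  rw [this]
  exact div_pos (by linarith) (by positivity)

open Classical in
theorem exists_nonneg_matrix (hn : 3 ≤ n) {σ : ℝ} (hc : HasAltSigns n σ c)
    {D : Digraph (Fin (n + 1))} (hD : IsBetween n D.Adj)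
    (h : (c 1 * c ⟨2, by omega⟩ < 0 ∧ ¬ D.Adj 0 ⟨2, by omega⟩) ∨
      (Even n ∧ c 1 = 0 ∧ D.Adj 0 ⟨2, by omega⟩)) :
    ∃ M : Matrix (Fin (n + 1)) (Fin (n + 1)) ℝ, (∀ i j, 0 ≤ M i j) ∧
      (∀ i j, 0 < M i j ↔ D.Adj i j) ∧ ∀ j, ∑ i, c i * M i j = -1 * c j := by
  have h1 := fin_val_one (n := n) (by omega)
  have hl0 := hc.mul_last_zero_neg (by omega)
  have hcl : c (Fin.last n) ≠ 0 := hc.ne_zero (by rw [Fin.val_last]; omega)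
  have hc0 : c 0 ≠ 0 := hc.ne_zero (by rw [Fin.val_zero]; omega)
  obtain ⟨p, q, hp, hq, hpq⟩ := exists_pos_combination hl0 (- c 1)
  let w : Fin (n + 1) → Fin (n + 1) → ℝ := fun i j =>
    if (j : ℕ) = 0 then - c 0 / c (Fin.last n)
    else if (j : ℕ) = 1 then (if (i : ℕ) = 0 then p else q)
    else if (j : ℕ) = 2 then (if (i : ℕ) = 0 then - c j / c 0 else
      if c 1 = 0 then 1 else - c j / c 1)
    else - c j / c i
  have hw : ∀ i j, D.Adj i j → 0 < w i j := by
    intro i j hij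
    have hadj := hD.2 i j hij
    have hi := i.2
    simp only [w]
    split_ifs with a1 a2 a3 a4 a5 a6
    · exact neg_div_pos_of_mul_neg hl0
    · exact hp
    · exact hq
    · have ej : j = ⟨2, by omega⟩ := Fin.ext a4
      have ei : i = 0 := Fin.ext a5
      rw [ej, ei] at hij
      rcases h with h | h
      · exact absurd hij h.2
      · refine neg_div_pos_of_mul_neg (hc.mul_neg (by rw [Fin.val_zero]; omega) (by omega) ?_)
        simp only [altSign, Fin.val_zero, if_true, a4]
        rw [h.1.neg_one_pow]
        norm_num
    · exact one_pos
    · rcases h with h | h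
      · have ej : j = ⟨2, by omega⟩ := Fin.ext a4
        rw [ej]
        exact neg_div_pos_of_mul_neg h.1
      · exact absurd h.2.1 a6
    · have hij' : (j : ℕ) = i + 1 := by
        simp only [figure2, figure1] at hadj
        omega
      have ei : i = ⟨i, by omega⟩ := rfl
      have ej : j = ⟨i + 1, by omega⟩ := Fin.ext hij'
      rw [ej]
      exact neg_div_pos_of_mul_neg (hc.mul_succ_neg (k := i) (by omega) (by omega))
  refine ⟨fun i j => if D.Adj i j then w i j else 0, fun i j => ?_, fun i j => ?_, ?_⟩
  · dsimp only
    split_ifs with h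
    · exact (hw i j h).le
    · exact le_rfl
  · dsimp only
    split_ifs with h
    · exact iff_of_true (hw i j h) h
    · exact iff_of_false (lt_irrefl _) h
  · obtain ⟨e0, e1, e2, e3⟩ := sum_mul_col hn (M := fun i j => if D.Adj i j then w i j else 0)
      (fun i j h' => if_neg fun h'' => h' (hD.2 i j h'')) c
    have d0 : D.Adj (Fin.last n) 0 := hD.1 _ _ (Or.inr ⟨by simp, Or.inl rfl⟩)
    have d1 : D.Adj (Fin.last n) 1 := hD.1 _ _ (Or.inr ⟨by simp, Or.inr h1⟩)
    have d2 : D.Adj 0 1 := hD.1 _ _ (Or.inl (by rw [h1]; rfl))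
    have d3 : D.Adj 1 ⟨2, by omega⟩ := hD.1 _ _ (Or.inl (by rw [h1]))
    intro j
    by_cases hj0 : (j : ℕ) = 0
    · have ej : j = 0 := Fin.ext hj0
      rw [ej, e0, if_pos d0]
      simp only [w, Fin.val_zero, if_true]
      field_simp
    by_cases hj1 : (j : ℕ) = 1
    · have ej : j = 1 := Fin.ext (by rw [hj1, h1])
      rw [ej, e1, if_pos d1, if_pos d2]
      simp only [w, Fin.val_zero, if_true, h1, Fin.val_last, one_ne_zero, if_false]
      rw [if_neg (by omega), hpq]
      ring
    by_cases hj2 : (j : ℕ) = 2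
    · have ej : j = ⟨2, by omega⟩ := Fin.ext hj2
      rw [ej, e2, if_pos d3]
      simp only [w, Fin.val_zero, if_true, h1, one_ne_zero, if_false, OfNat.ofNat_ne_zero,
        OfNat.ofNat_ne_one]
      rcases h with h | h
      · have hc1 : c 1 ≠ 0 := by
          intro h0
          have := h.1
          rw [h0] at this
          simp at this
        rw [if_neg h.2, if_neg hc1]
        field_simp
        ring
      · rw [if_pos h.2.2, h.2.1]
        field_simp
        simp
    · have hjn := j.2
      have ej : j = ⟨(j : ℕ) - 1 + 1, by omega⟩ := Fin.ext (by dsimp only; omega)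
      have hck : c ⟨(j : ℕ) - 1, by omega⟩ ≠ 0 := hc.ne_zero (by dsimp only; omega)
      rw [ej, e3 ((j : ℕ) - 1) (by omega) (by omega), if_pos (hD.1 _ _ (Or.inl rfl))]
      simp only [w]
      rw [if_neg (by omega), if_neg (by omega), if_neg (by omega)]
      field_simp

theorem IsRep.arc_iff (hn : 3 ≤ n) (S : MinimalSystem x c) {σ : ℝ} (hc : HasAltSigns n σ c)
    (hM : IsRep x A M) (hT : IsBetween n fun i j => 0 < M i j) (i j : Fin (n + 1)) :
    x j ∈ genFace (PointedCone.hull ℝ (Set.range x)) {A *ᵥ x i} ↔ 0 < M i j := by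
  have hz : ∀ i j, ¬ (figure2 (n + 1)).Adj i j → M i j = 0 := fun i j h =>
    le_antisymm (not_lt.1 fun h' => h (hT.2 i j h')) (hM.nonneg i j)
  have hi := i.2
  by_cases h0 : (i : ℕ) = 0
  · refine hM.mem_genFace_iff S (p := Fin.last n) (q := 0) (hz _ _ ?_) (hz _ _ ?_)
      (hc.mul_last_zero_neg (by omega)) j
    · simp only [figure2, figure1, Fin.val_last]; omega
    · simp only [figure2, figure1, Fin.val_zero]; omega
  by_cases hl : (i : ℕ) = n
  · refine hM.mem_genFace_iff S (p := ⟨2, by omega⟩) (q := ⟨3, by omega⟩) (hz _ _ ?_) (hz _ _ ?_)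
      (hc.mul_succ_neg (k := 2) le_rfl (by omega)) j
    · simp only [figure2, figure1]; omega
    · simp only [figure2, figure1]; omega
  · obtain ⟨p, hp, hcp⟩ := S.exists_pos_ne ⟨i + 1, by omega⟩
    obtain ⟨q, hq, hcq⟩ := S.exists_neg_ne ⟨i + 1, by omega⟩
    have hp := Fin.val_ne_of_ne hp
    have hq := Fin.val_ne_of_ne hq
    dsimp only at hp hq
    refine hM.mem_genFace_iff S (p := p) (q := q) (hz _ _ ?_) (hz _ _ ?_)
      (mul_neg_of_pos_of_neg hcp hcq) j
    · simp only [figure2, figure1]; omega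
    · simp only [figure2, figure1]; omega

/-- There is a primitive matrix with a prescribed one of the two digraphs. -/
theorem exists_isKPrimitive (hn : 3 ≤ n) (S : MinimalSystem x c)
    (hspan : Submodule.span ℝ (Set.range x) = ⊤) {σ : ℝ} (hc : HasAltSigns n σ c)
    {D : Digraph (Fin (n + 1))} (hD : IsBetween n D.Adj)
    (h : (c 1 * c ⟨2, by omega⟩ < 0 ∧ ¬ D.Adj 0 ⟨2, by omega⟩) ∨
      (Even n ∧ c 1 = 0 ∧ D.Adj 0 ⟨2, by omega⟩)) :
    ∃ A : Matrix (Fin n) (Fin n) ℝ, IsKPrimitive (PointedCone.hull ℝ (Set.range x)) A ∧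
      ∀ i j, x j ∈ genFace (PointedCone.hull ℝ (Set.range x)) {A *ᵥ x i} ↔ D.Adj i j := by
  obtain ⟨M, h0, hMD, hr⟩ := exists_nonneg_matrix hn hc hD h
  obtain ⟨A, hA⟩ := S.exists_isRep_of_relation hspan h0 hr
  have hT : IsBetween n fun i j => 0 < M i j := by
    simp only [hMD]
    exact hD
  exact ⟨A, hA.isKPrimitive (by omega) S hspan hT, fun i j => by
    rw [hA.arc_iff hn S hc hT, hMD]⟩

end Figures

section Exponents

variable {n : ℕ} {x : Fin (n + 1) → Fin n → ℝ} {c : Fin (n + 1) → ℝ}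
  {A : Matrix (Fin n) (Fin n) ℝ}

local notation "Kx" => PointedCone.hull ℝ (Set.range x)

theorem dominates_of_mem_iterate {ι : Type*} [Fintype ι] {x : ι → Fin n → ℝ}
    (hA : IsKNonneg (PointedCone.hull ℝ (Set.range x)) A) {t : ℕ} {i j : ι}
    (h : j ∈ (outSet fun i j => x j ∈ genFace (PointedCone.hull ℝ (Set.range x)) {A *ᵥ x i})^[t]
      {i}) :
    Dominates (PointedCone.hull ℝ (Set.range x)) ((A ^ t) *ᵥ x i) (x j) := by
  induction t generalizing j with
  | zero =>
    have : j = i := by simpa using h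
    rw [this]
    simpa using Dominates.refl (x i)
  | succ t ih =>
    rw [Function.iterate_succ_apply'] at h
    obtain ⟨k, hk, hkj⟩ := h
    have h1 := (ih hk).mulVec hA
    rw [Matrix.mulVec_mulVec, ← pow_succ'] at h1
    exact h1.trans ((KCone.mem_genFace_iff (hA _ (mem _))).1 hkj).2

theorem Dominates.mem_interior_pow {K : PointedCone ℝ (Fin n → ℝ)} (hA : IsKNonneg K A)
    {u v : Fin n → ℝ} {s : ℕ} (h : Dominates K ((A ^ s) *ᵥ u) v) {t : ℕ}
    (hv : (A ^ t) *ᵥ v ∈ interior (K : Set (Fin n → ℝ))) :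
    (A ^ (t + s)) *ᵥ u ∈ interior (K : Set (Fin n → ℝ)) := by
  have h1 := h.mulVec (hA.pow t)
  rw [Matrix.mulVec_mulVec, ← pow_add] at h1
  exact h1.mem_interior hv

theorem mem_interior_of_ne_zero (hn : 3 ≤ n) (S : MinimalSystem x c) (hA : IsKPrimitive Kx A)
    (hT : IsBetween n fun i j => x j ∈ genFace Kx {A *ᵥ x i}) {v : Fin (n + 1)} (hv : (v : ℕ) ≠ 0) :
    (A ^ (n ^ 2 - n)) *ᵥ x v ∈ interior (Kx : Set (Fin n → ℝ)) := by
  have h1 := fin_val_one (n := n) (by omega)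
  have hvn := v.2
  have e : n ^ 2 - n = (n - 1) * n := by rw [sq, Nat.sub_mul, one_mul]
  rw [e]
  refine S.mem_interior_of_dominates_self hA (by omega) (dominates_of_mem_iterate hA.1 ?_)
  have w1 := mem_iterate_outSet_step hT v (n - v) (by omega)
  have w2 : (1 : Fin (n + 1)) ∈ (outSet fun i j => x j ∈ genFace Kx {A *ᵥ x i})^[n - v + 1] {v} := by
    rw [Function.iterate_succ_apply']
    exact ⟨_, w1, hT.1 _ _ (Or.inr ⟨by dsimp only; omega, Or.inr h1⟩)⟩
  have w3 := mem_iterate_outSet_step hT 1 (v - 1) (by omega)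
  have e1 : (⟨1, by omega⟩ : Fin (n + 1)) = 1 := Fin.ext h1.symm
  have e2 : (⟨1 + (v - 1), by omega⟩ : Fin (n + 1)) = v := Fin.ext (by dsimp only; omega)
  rw [e1, e2] at w3
  have := mem_iterate_outSet_add w2 w3
  rwa [show n - v + 1 + (v - 1) = n by omega] at this

theorem mem_interior_of_arc (hn : 3 ≤ n) (S : MinimalSystem x c) (hA : IsKPrimitive Kx A)
    (hT : IsBetween n fun i j => x j ∈ genFace Kx {A *ᵥ x i})
    (h02 : x ⟨2, by omega⟩ ∈ genFace Kx {A *ᵥ x 0}) :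
    (A ^ (n ^ 2 - n)) *ᵥ x 0 ∈ interior (Kx : Set (Fin n → ℝ)) := by
  have e : n ^ 2 - n = (n - 1) * n := by rw [sq, Nat.sub_mul, one_mul]
  rw [e]
  refine S.mem_interior_of_dominates_self hA (by omega) (dominates_of_mem_iterate hA.1 ?_)
  have w1 := mem_iterate_outSet_step hT 2 (n - 2) (by omega)
  have w2 : (0 : Fin (n + 1)) ∈ (outSet fun i j => x j ∈ genFace Kx {A *ᵥ x i})^[n - 2 + 1]
      {⟨2, by omega⟩} := by
    rw [Function.iterate_succ_apply']
    exact ⟨_, w1, hT.1 _ _ (Or.inr ⟨by dsimp only; omega, Or.inl rfl⟩)⟩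
  have := mem_iterate_outSet_add (s := 1) (i := (0 : Fin (n + 1))) (by exact ⟨0, rfl, h02⟩) w2
  rwa [show 1 + (n - 2 + 1) = n by omega] at this

theorem matrixExponent_le_add_one (hn : 3 ≤ n) (S : MinimalSystem x c) (hA : IsKPrimitive Kx A)
    (hT : IsBetween n fun i j => x j ∈ genFace Kx {A *ᵥ x i}) :
    matrixExponent Kx A ≤ n ^ 2 - n + 1 := by
  have h1 := fin_val_one (n := n) (by omega)
  rw [S.matrixExponent_le_iff hA (by omega)]
  intro i
  by_cases hi : (i : ℕ) = 0
  · have ei : i = 0 := Fin.ext hi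
    rw [ei]
    refine Dominates.mem_interior_pow hA.1 (dominates_of_mem_iterate hA.1 (t := 1) ?_)
      (S.mem_interior_of_ne_zero hn hA hT (v := 1) (by omega))
    exact ⟨0, rfl, hT.1 _ _ (Or.inl (by rw [h1]; rfl))⟩
  · exact S.mem_interior_pow_le hA (S.mem_interior_of_ne_zero hn hA hT hi) (by omega)

theorem matrixExponent_le_of_arc (hn : 3 ≤ n) (S : MinimalSystem x c) (hA : IsKPrimitive Kx A)
    (hT : IsBetween n fun i j => x j ∈ genFace Kx {A *ᵥ x i})
    (h02 : x ⟨2, by omega⟩ ∈ genFace Kx {A *ᵥ x 0}) :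
    matrixExponent Kx A ≤ n ^ 2 - n := by
  have hpos : 0 < n ^ 2 - n := by
    have : n * 1 < n * n := by nlinarith
    rw [sq]; omega
  rw [S.matrixExponent_le_iff hA hpos]
  intro i
  by_cases hi : (i : ℕ) = 0
  · have ei : i = 0 := Fin.ext hi
    rw [ei]
    exact S.mem_interior_of_arc hn hA hT h02
  · exact S.mem_interior_of_ne_zero hn hA hT hi

theorem mulVec_eq_smul_of_isBetween {M : Matrix (Fin (n + 1)) (Fin (n + 1)) ℝ}
    (hM : IsRep x A M) {i k : Fin (n + 1)} (h : ∀ j, j ≠ k → ¬ 0 < M i j) :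
    A *ᵥ x i = M i k • x k := by
  rw [hM.eq]
  refine Fintype.sum_eq_single _ fun j hj => ?_
  rw [le_antisymm (not_lt.1 (h j hj)) (hM.nonneg i j), zero_smul]

theorem arc_eq_smul (hA : IsKNonneg Kx A) {i k : Fin (n + 1)}
    (h : ∀ j, x j ∈ genFace Kx {A *ᵥ x i} ↔ j = k) : ∃ a : ℝ, 0 < a ∧ A *ᵥ x i = a • x k := by
  obtain ⟨M, hM, hMT⟩ := exists_isRep hA
  refine ⟨M i k, by rw [hMT, h], mulVec_eq_smul_of_isBetween hM fun j hj hpos => hj ?_⟩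
  rwa [hMT, h] at hpos

theorem mem_interior_one_iff (hn : 3 ≤ n) (S : MinimalSystem x c)
    (hspan : Submodule.span ℝ (Set.range x) = ⊤) (hA : IsKPrimitive Kx A)
    (hT : IsBetween n fun i j => x j ∈ genFace Kx {A *ᵥ x i}) :
    (A ^ (n ^ 2 - n - 1)) *ᵥ x 1 ∈ interior (Kx : Set (Fin n → ℝ)) ↔ 0 < c 0 * c 1 := by
  have h1 := fin_val_one (n := n) (by omega)
  obtain ⟨M, hM, hMT⟩ := exists_isRep hA.1
  have hT' : IsBetween n fun i j => 0 < M i j := by simpa only [hMT] using hT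
  have hpos : ∀ j, 0 < (M ^ (n ^ 2 - n - 1)) 1 j ↔ 2 ≤ (j : ℕ) := fun j => by
    rw [hM.pow_pos_iff, iterate_outSet_one (by omega) hT', mem_walkSet_iff hn]
  have hnn := fun j => (hM.pow (n ^ 2 - n - 1)).nonneg 1 j
  rw [(hM.pow _).mem_interior_iff S hspan]
  constructor
  · rintro ⟨s, hs⟩
    have z0 : (M ^ (n ^ 2 - n - 1)) 1 0 = 0 :=
      le_antisymm (not_lt.1 fun h => by
        have := (hpos _).1 h
        rw [Fin.val_zero] at this
        omega) (hnn 0)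
    have z1 : (M ^ (n ^ 2 - n - 1)) 1 1 = 0 :=
      le_antisymm (not_lt.1 fun h => by
        have := (hpos _).1 h
        rw [h1] at this
        omega) (hnn 1)
    have h2 := hs 0
    have h3 := hs 1
    rw [z0, zero_add] at h2
    rw [z1, zero_add] at h3
    have h4 := mul_pos h2 h3
    by_contra! h5
    have := mul_nonpos_of_nonneg_of_nonpos (sq_nonneg s) h5
    nlinarith
  · intro h01
    have hev : ∀ᶠ s : ℝ in nhdsWithin 0 (Set.Ioi 0),
        ∀ j, 0 < (M ^ (n ^ 2 - n - 1)) 1 j + (s * c 0) * c j := by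
      rw [Filter.eventually_all]
      intro j
      by_cases hj : 2 ≤ (j : ℕ)
      · have hc : Continuous fun s : ℝ => (M ^ (n ^ 2 - n - 1)) 1 j + (s * c 0) * c j := by fun_prop
        have h2 := hc.tendsto 0
        simp only [zero_mul, add_zero] at h2
        exact (h2.mono_left nhdsWithin_le_nhds).eventually (lt_mem_nhds ((hpos j).2 hj))
      · have hs : ∀ᶠ s : ℝ in nhdsWithin 0 (Set.Ioi 0), 0 < s := eventually_mem_nhdsWithin
        filter_upwards [hs] with s hs
        have h2 : 0 < c 0 * c j := by
          by_cases hj0 : (j : ℕ) = 0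
          · have ej : j = 0 := Fin.ext hj0
            rw [ej]
            have : c 0 ≠ 0 := by
              intro h
              rw [h] at h01
              simp at h01
            exact mul_self_pos.2 this
          · have ej : j = 1 := Fin.ext (by omega)
            rwa [ej]
        have := mul_pos hs h2
        linarith [hnn j]
    obtain ⟨s, hs⟩ := hev.exists
    exact ⟨_, hs⟩

theorem notMem_interior_one (hn : 3 ≤ n) (S : MinimalSystem x c)
    (hspan : Submodule.span ℝ (Set.range x) = ⊤) (hA : IsKPrimitive Kx A)
    (hT : IsBetween n fun i j => x j ∈ genFace Kx {A *ᵥ x i}) {σ : ℝ} (hc : HasAltSigns n σ c) :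
    (A ^ (n ^ 2 - n - 2)) *ᵥ x 1 ∉ interior (Kx : Set (Fin n → ℝ)) := by
  obtain ⟨M, hM, hMT⟩ := exists_isRep hA.1
  have hT' : IsBetween n fun i j => 0 < M i j := by simpa only [hMT] using hT
  have hpos : ∀ j, 0 < (M ^ (n ^ 2 - n - 2)) 1 j → j ∈ walkSet n (n ^ 2 - n - 2) := fun j => by
    rw [hM.pow_pos_iff, iterate_outSet_one (by omega) hT']
    exact id
  have hnn := fun j => (hM.pow (n ^ 2 - n - 2)).nonneg 1 j
  obtain ⟨w0, wl⟩ := zero_last_notMem_walkSet hn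
  rw [(hM.pow _).mem_interior_iff S hspan]
  rintro ⟨s, hs⟩
  have h2 := hs 0
  have h3 := hs (Fin.last n)
  rw [le_antisymm (not_lt.1 fun h => w0 (hpos _ h)) (hnn 0), zero_add] at h2
  rw [le_antisymm (not_lt.1 fun h => wl (hpos _ h)) (hnn _), zero_add] at h3
  have h4 := mul_pos h2 h3
  have h5 := mul_nonpos_of_nonneg_of_nonpos (sq_nonneg s) (hc.mul_last_zero_neg (by omega)).le
  nlinarith

/-- The signs of the relation in the presence of a matrix with one of the two digraphs. -/
theorem exists_hasAltSigns (hn : 3 ≤ n) (S : MinimalSystem x c) (hA : IsKNonneg Kx A)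
    (hT : IsBetween n fun i j => x j ∈ genFace Kx {A *ᵥ x i}) :
    (∃ σ : ℝ, σ ≠ 0 ∧ HasAltSigns n σ c) ∧
      (x ⟨2, by omega⟩ ∉ genFace Kx {A *ᵥ x 0} → c 1 * c ⟨2, by omega⟩ < 0) := by
  obtain ⟨M, hM, hMT⟩ := exists_isRep hA
  obtain ⟨r, hr⟩ := hM.exists_mul_eq S
  obtain ⟨i, -, -, hi, -⟩ := S.pos
  obtain ⟨j, -, -, hj, -⟩ := S.neg
  obtain ⟨h1, h2⟩ := KCone.exists_hasAltSigns hn hM.nonneg (by simpa only [hMT] using hT) hr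
    ⟨i, hi⟩ ⟨j, hj⟩
  refine ⟨h1, fun h => h2 ?_⟩
  rw [← hMT] at h
  exact le_antisymm (not_lt.1 h) (hM.nonneg _ _)

end Exponents

end MinimalSystem
end KCone

namespace KCone
open Matrix

namespace MinimalSystem

section FigureExponents

variable {n : ℕ} {x : Fin (n + 1) → Fin n → ℝ} {c : Fin (n + 1) → ℝ}
  {A : Matrix (Fin n) (Fin n) ℝ}

local notation "Kx" => PointedCone.hull ℝ (Set.range x)

theorem lt_sq_sub {n : ℕ} (hn : 3 ≤ n) : n + 2 < n ^ 2 - n := by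
  have h1 : 3 * n ≤ n * n := Nat.mul_le_mul_right n hn
  rw [sq]
  omega

theorem not_figure1_zero_two (hn : 3 ≤ n) : ¬ (figure1 (n + 1)).Adj 0 ⟨2, by omega⟩ := by
  simp only [figure1, Fin.val_zero]
  omega

theorem figure2_zero_two (hn : 3 ≤ n) : (figure2 (n + 1)).Adj 0 ⟨2, by omega⟩ :=
  Or.inr ⟨rfl, rfl⟩

theorem smul_mem_interior_iff {K : PointedCone ℝ (Fin n → ℝ)} {y : Fin n → ℝ} {a : ℝ} (ha : 0 < a) :
    a • y ∈ interior (K : Set (Fin n → ℝ)) ↔ y ∈ interior (K : Set (Fin n → ℝ)) := by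
  constructor
  · intro h
    have := smul_mem_interior (inv_pos.2 ha) h
    rwa [smul_smul, inv_mul_cancel₀ ha.ne', one_smul] at this
  · exact smul_mem_interior ha

theorem matrixExponent_eq_of_not_le {N : ℕ} {K : PointedCone ℝ (Fin n → ℝ)}
    (h : matrixExponent K A ≤ N) (h' : ¬ matrixExponent K A ≤ N - 1) :
    matrixExponent K A = N := by omega

theorem pow_mulVec_zero_mem_interior_iff (hn : 3 ≤ n) (hA : IsKNonneg Kx A)
    (hL : ∀ i j, x j ∈ genFace Kx {A *ᵥ x i} ↔ (figure1 (n + 1)).Adj i j) (t : ℕ) :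
    (A ^ (t + 1)) *ᵥ x 0 ∈ interior (Kx : Set (Fin n → ℝ)) ↔
      (A ^ t) *ᵥ x 1 ∈ interior (Kx : Set (Fin n → ℝ)) := by
  have h1 := fin_val_one (n := n) (by omega)
  obtain ⟨a, ha, e⟩ := arc_eq_smul hA (i := 0) (k := 1) fun j => by
    rw [hL, Fin.ext_iff, h1]
    simp only [figure1, Fin.val_zero]
    omega
  rw [pow_succ, ← Matrix.mulVec_mulVec, e, Matrix.mulVec_smul, smul_mem_interior_iff ha]

theorem figure1_signs (hn : 3 ≤ n) (S : MinimalSystem x c) (hA : IsKNonneg Kx A)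
    (hL : ∀ i j, x j ∈ genFace Kx {A *ᵥ x i} ↔ (figure1 (n + 1)).Adj i j) :
    (∃ σ : ℝ, σ ≠ 0 ∧ HasAltSigns n σ c) ∧ c 1 * c ⟨2, by omega⟩ < 0 := by
  have hT : IsBetween n fun i j => x j ∈ genFace Kx {A *ᵥ x i} := by
    simpa only [hL] using isBetween_figure1 n
  obtain ⟨h1, h2⟩ := S.exists_hasAltSigns hn hA hT
  exact ⟨h1, h2 (by rw [hL]; exact not_figure1_zero_two hn)⟩

theorem figure2_signs (hn : 3 ≤ n) (S : MinimalSystem x c) (hA : IsKNonneg Kx A)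
    (hL : ∀ i j, x j ∈ genFace Kx {A *ᵥ x i} ↔ (figure2 (n + 1)).Adj i j) :
    ∃ σ : ℝ, σ ≠ 0 ∧ HasAltSigns n σ c := by
  have hT : IsBetween n fun i j => x j ∈ genFace Kx {A *ᵥ x i} := by
    simpa only [hL] using isBetween_figure2 n
  exact (S.exists_hasAltSigns hn hA hT).1

theorem HasAltSigns.mul_two_zero {n : ℕ} (hn : 3 ≤ n) {σ : ℝ} {c : Fin (n + 1) → ℝ}
    (h : HasAltSigns n σ c) : (Even n → c 0 * c ⟨2, by omega⟩ < 0) ∧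
      (Odd n → 0 < c 0 * c ⟨2, by omega⟩) := by
  constructor
  · intro hev
    refine h.mul_neg (by rw [Fin.val_zero]; omega) (by simp) ?_
    simp only [altSign, Fin.val_zero, if_true, hev.neg_one_pow]
    norm_num
  · intro hodd
    have h0 := h 0 (by rw [Fin.val_zero]; omega)
    have h2 := h ⟨2, by omega⟩ (by simp)
    simp only [altSign, Fin.val_zero, if_true, hodd.neg_one_pow] at h0 h2
    norm_num at h0 h2
    have h3 := mul_pos h0 h2
    have h4 : σ * c 0 * (σ * c ⟨2, by omega⟩) = σ ^ 2 * (c 0 * c ⟨2, by omega⟩) := by ring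
    rw [h4] at h3
    exact pos_of_mul_pos_right h3 (sq_nonneg σ)

theorem matrixExponent_figure1_of_odd (hn : 3 ≤ n) (hodd : Odd n) (S : MinimalSystem x c)
    (hspan : Submodule.span ℝ (Set.range x) = ⊤) (hA : IsKPrimitive Kx A)
    (hL : ∀ i j, x j ∈ genFace Kx {A *ᵥ x i} ↔ (figure1 (n + 1)).Adj i j) :
    matrixExponent Kx A = n ^ 2 - n + 1 := by
  have hT : IsBetween n fun i j => x j ∈ genFace Kx {A *ᵥ x i} := by
    simpa only [hL] using isBetween_figure1 n
  have hlt := lt_sq_sub hn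
  refine matrixExponent_eq_of_not_le (S.matrixExponent_le_add_one hn hA hT) ?_
  rw [Nat.add_sub_cancel, S.matrixExponent_le_iff hA (by omega)]
  intro h
  have h0 := h 0
  obtain ⟨⟨σ, -, hσ⟩, h12⟩ := S.figure1_signs hn hA.1 hL
  have h02 := (HasAltSigns.mul_two_zero hn hσ).2 hodd
  rw [show n ^ 2 - n = n ^ 2 - n - 1 + 1 by omega,
    pow_mulVec_zero_mem_interior_iff hn hA.1 hL, S.mem_interior_one_iff hn hspan hA hT] at h0
  have h3 := mul_pos h0 h02
  have h4 : c 0 * c 1 * (c 0 * c ⟨2, by omega⟩) = c 0 ^ 2 * (c 1 * c ⟨2, by omega⟩) := by ring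
  rw [h4] at h3
  exact absurd (pos_of_mul_pos_right h3 (sq_nonneg _)) h12.not_gt

theorem matrixExponent_figure1_of_even (hn : 3 ≤ n) (hev : Even n) (S : MinimalSystem x c)
    (hspan : Submodule.span ℝ (Set.range x) = ⊤) (hA : IsKPrimitive Kx A)
    (hL : ∀ i j, x j ∈ genFace Kx {A *ᵥ x i} ↔ (figure1 (n + 1)).Adj i j) :
    matrixExponent Kx A = n ^ 2 - n := by
  have hT : IsBetween n fun i j => x j ∈ genFace Kx {A *ᵥ x i} := by
    simpa only [hL] using isBetween_figure1 n
  have hlt := lt_sq_sub hn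
  obtain ⟨⟨σ, -, hσ⟩, h12⟩ := S.figure1_signs hn hA.1 hL
  have h02 := (HasAltSigns.mul_two_zero hn hσ).1 hev
  have h01 : 0 < c 0 * c 1 := by
    have h3 := mul_pos_of_neg_of_neg h02 h12
    have h4 : c 0 * c ⟨2, by omega⟩ * (c 1 * c ⟨2, by omega⟩) =
        (c ⟨2, by omega⟩) ^ 2 * (c 0 * c 1) := by ring
    rw [h4] at h3
    exact pos_of_mul_pos_right h3 (sq_nonneg _)
  refine matrixExponent_eq_of_not_le ?_ ?_
  · rw [S.matrixExponent_le_iff hA (by omega)]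
    intro i
    by_cases hi : (i : ℕ) = 0
    · have ei : i = 0 := Fin.ext hi
      rw [ei, show n ^ 2 - n = n ^ 2 - n - 1 + 1 by omega,
        pow_mulVec_zero_mem_interior_iff hn hA.1 hL, S.mem_interior_one_iff hn hspan hA hT]
      exact h01
    · exact S.mem_interior_of_ne_zero hn hA hT hi
  · rw [S.matrixExponent_le_iff hA (by omega)]
    intro h
    have h0 := h 0
    rw [show n ^ 2 - n - 1 = n ^ 2 - n - 2 + 1 by omega,
      pow_mulVec_zero_mem_interior_iff hn hA.1 hL] at h0
    exact S.notMem_interior_one hn hspan hA hT hσ h0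

theorem matrixExponent_figure2_le (hn : 3 ≤ n) (S : MinimalSystem x c) (hA : IsKPrimitive Kx A)
    (hL : ∀ i j, x j ∈ genFace Kx {A *ᵥ x i} ↔ (figure2 (n + 1)).Adj i j) :
    matrixExponent Kx A ≤ n ^ 2 - n := by
  have hT : IsBetween n fun i j => x j ∈ genFace Kx {A *ᵥ x i} := by
    simpa only [hL] using isBetween_figure2 n
  exact S.matrixExponent_le_of_arc hn hA hT (by rw [hL]; exact figure2_zero_two hn)

theorem pow_mulVec_one_eq_smul (hA : IsKNonneg Kx A)
    (hL : ∀ i j, x j ∈ genFace Kx {A *ᵥ x i} ↔ (figure2 (n + 1)).Adj i j) (k : ℕ) (hk : k < n) :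
    ∃ a : ℝ, 0 < a ∧ (A ^ k) *ᵥ x 1 = a • x ⟨k + 1, by omega⟩ := by
  have h1 := fin_val_one (n := n) (by omega)
  induction k with
  | zero =>
    have : (⟨0 + 1, by omega⟩ : Fin (n + 1)) = 1 := Fin.ext (by rw [h1])
    exact ⟨1, one_pos, by rw [this]; simp⟩
  | succ k ih =>
    obtain ⟨a, ha, e⟩ := ih (by omega)
    obtain ⟨b, hb, e'⟩ := arc_eq_smul hA (i := ⟨k + 1, by omega⟩) (k := ⟨k + 1 + 1, by omega⟩)
      fun j => by
        rw [hL, Fin.ext_iff]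
        simp only [figure2, figure1]
        omega
    refine ⟨a * b, by positivity, ?_⟩
    rw [pow_succ', ← Matrix.mulVec_mulVec, e, Matrix.mulVec_smul, e', smul_smul]

/-- For even `n`, the exponent of a matrix with the second digraph is maximal if and only if the
first two extreme vectors do not appear on the same side of the relation. -/
theorem matrixExponent_figure2_of_even (hn : 3 ≤ n) (S : MinimalSystem x c)
    (hspan : Submodule.span ℝ (Set.range x) = ⊤) (hA : IsKPrimitive Kx A)
    (hL : ∀ i j, x j ∈ genFace Kx {A *ᵥ x i} ↔ (figure2 (n + 1)).Adj i j) :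
    matrixExponent Kx A = n ^ 2 - n ↔ ¬ 0 < c 0 * c 1 := by
  have h1 := fin_val_one (n := n) (by omega)
  have hT : IsBetween n fun i j => x j ∈ genFace Kx {A *ᵥ x i} := by
    simpa only [hL] using isBetween_figure2 n
  have hlt := lt_sq_sub hn
  rw [← S.mem_interior_one_iff hn hspan hA hT]
  constructor
  · intro h hint
    have hle : matrixExponent Kx A ≤ n ^ 2 - n - 1 := by
      rw [S.matrixExponent_le_iff hA (by omega)]
      have hpos : ∀ v (hv : v < n), (A ^ (n ^ 2 - n - 1 - v)) *ᵥ x ⟨v + 1, by omega⟩ ∈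
          interior (Kx : Set (Fin n → ℝ)) := by
        intro v hv
        obtain ⟨a, ha, e⟩ := pow_mulVec_one_eq_smul hA.1 hL v hv
        rwa [show n ^ 2 - n - 1 = n ^ 2 - n - 1 - v + v by omega, pow_add,
          ← Matrix.mulVec_mulVec, e, Matrix.mulVec_smul, smul_mem_interior_iff ha] at hint
      intro i
      have hi' := i.2
      by_cases hi : (i : ℕ) = 0
      · have ei : i = 0 := Fin.ext hi
        have h2 := hpos 1 (by omega)
        rw [ei, show n ^ 2 - n - 1 = n ^ 2 - n - 1 - 1 + 1 by omega]
        refine Dominates.mem_interior_pow hA.1 (dominates_of_mem_iterate hA.1 (t := 1) ?_) h2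
        exact ⟨0, rfl, (hL _ _).2 (figure2_zero_two hn)⟩
      · have h2 := hpos (i - 1) (by omega)
        have ei : (⟨(i : ℕ) - 1 + 1, by omega⟩ : Fin (n + 1)) = i :=
          Fin.ext (by dsimp only; omega)
        rw [ei] at h2
        exact S.mem_interior_pow_le hA h2 (by omega)
    omega
  · intro h
    refine matrixExponent_eq_of_not_le (S.matrixExponent_figure2_le hn hA hL) ?_
    rw [S.matrixExponent_le_iff hA (by omega)]
    exact fun h' => h (h' 1)

end FigureExponents

end MinimalSystem
end KCone

namespace KCone
open Function

section Classification

variable {ι : Type*}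

theorem exists_iterate_mem {f g : ι → ι} {m : Set ι} (hfg : ∀ i, i ∉ m → g i = f i) {v : ι}
    (h : ∃ a, f^[a] v ∈ m) : ∃ a, g^[a] v ∈ m := by
  by_contra! hn
  have hs : ∀ a, g^[a] v = f^[a] v := by
    intro a
    induction a with
    | zero => rfl
    | succ a ih => rw [iterate_succ_apply', hfg _ (hn a), ih, iterate_succ_apply']
  obtain ⟨a, ha⟩ := h
  exact hn a (by rwa [hs])

theorem iterate_congr {f g : ι → ι} {k : ℕ} {j : ι} (h : ∀ b, b < k → g (f^[b] j) = f (f^[b] j)) :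
    g^[k] j = f^[k] j := by
  induction k with
  | zero => rfl
  | succ k ih =>
    rw [iterate_succ_apply', ih fun b hb => h b (by omega), h k (by omega), iterate_succ_apply']

theorem iterate_ne_of_lt {f : ι → ι} {i : ι} {a b : ℕ} (ha : a < minimalPeriod f i)
    (hb : b < minimalPeriod f i) (hab : a ≠ b) : f^[a] i ≠ f^[b] i := fun h =>
  hab ((iterate_eq_iterate_iff_of_lt_minimalPeriod ha hb).1 h)

theorem iterate_ne_self {f : ι → ι} {i : ι} {a : ℕ} (ha : a < minimalPeriod f i)
    (h0 : 0 < a) : f^[a] i ≠ i := fun h =>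
  iterate_ne_of_lt ha (by omega) h0.ne' h

/-- The arcs `i → f i` are arcs of `T`. -/
def IsSelection (T : ι → ι → Prop) (f : ι → ι) : Prop :=
  ∀ i, T i (f i)

theorem IsSelection.update [DecidableEq ι] {T : ι → ι → Prop} {f : ι → ι} (hf : IsSelection T f)
    {i j : ι} (h : T i j) : IsSelection T (Function.update f i j) := by
  intro k
  by_cases hk : k = i
  · subst hk; simpa using h
  · rw [update_of_ne hk]; exact hf k

/-- Each choice of one arc at each vertex leads from `v` to a cycle of length at least `n`. -/
def HasLongCycles (n : ℕ) (T : ι → ι → Prop) (v : ι) : Prop :=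
  ∀ f, IsSelection T f → ∀ s l, 0 < l → IsPeriodicPt f l (f^[s] v) → n ≤ l

/-- A cycle that uses a chord of the given cycle. -/
theorem HasLongCycles.chord_le {n P : ℕ} {T : ι → ι → Prop} {v : ι} (hB : HasLongCycles n T v)
    {f : ι → ι} (hf : IsSelection T f) {i : ι} (hi : ∃ s, f^[s] v = i)
    (hP : minimalPeriod f i = P) {b : ℕ} (hb : 1 ≤ b) (hbP : b ≤ P) (hT : T i (f^[b] i)) :
    n ≤ P - b + 1 := by
  classical
  obtain ⟨s, hs⟩ := exists_iterate_mem (f := f) (g := Function.update f i (f^[b] i)) (m := {i})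
    (fun k hk => update_of_ne hk _ _) (v := v) hi
  refine hB _ (hf.update hT) s _ (by omega) ?_
  have hs : (Function.update f i (f^[b] i))^[s] v = i := hs
  rw [hs, IsPeriodicPt, IsFixedPt, iterate_succ_apply, update_self, iterate_congr (f := f),
    ← iterate_add_apply, Nat.sub_add_cancel hbP, ← hP]
  · exact iterate_minimalPeriod
  · intro k hk
    rw [← iterate_add_apply]
    exact update_of_ne (iterate_ne_self (by omega) (by omega)) _ _

section Hamiltonian

variable {n : ℕ} {T : ι → ι → Prop} {v : ι} {f : ι → ι}

theorem hamiltonian_arc (hB : HasLongCycles n T v)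
    (hf : IsSelection T f) (hper : ∀ i, minimalPeriod f i = n + 1)
    (hcov : ∀ i j, ∃ a, a < n + 1 ∧ f^[a] i = j) {i j : ι} (h : T i j) :
    j = f i ∨ j = f (f i) := by
  obtain ⟨b, hb1, hb2, rfl⟩ : ∃ b, 1 ≤ b ∧ b ≤ n + 1 ∧ f^[b] i = j := by
    obtain ⟨a, ha, rfl⟩ := hcov i j
    rcases Nat.eq_zero_or_pos a with rfl | h0
    · refine ⟨n + 1, by omega, le_rfl, ?_⟩
      rw [← hper i, iterate_minimalPeriod]; rfl
    · exact ⟨a, h0, ha.le, rfl⟩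
  obtain ⟨s, -, hs⟩ := hcov v i
  have := hB.chord_le hf ⟨s, hs⟩ (hper i) hb1 hb2 h
  have hb : b = 1 ∨ b = 2 := by omega
  rcases hb with rfl | rfl
  · exact Or.inl rfl
  · exact Or.inr rfl

theorem hamiltonian_chords (hB : HasLongCycles n T v)
    (hf : IsSelection T f) (hper : ∀ i, minimalPeriod f i = n + 1)
    (hcov : ∀ i j, ∃ a, a < n + 1 ∧ f^[a] i = j) {i : ι} (hi : T i (f (f i))) {a : ℕ}
    (ha : a < n + 1) (hia : T (f^[a] i) (f (f (f^[a] i)))) : a = 0 ∨ a = 1 ∨ a = n := by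
  classical
  by_contra! hne
  obtain ⟨a0, a1, an⟩ := hne
  have hper' := hper i
  have hii : f^[a] i ≠ i := iterate_ne_self (by omega) (by omega)
  set g := Function.update (Function.update f i (f (f i))) (f^[a] i) (f (f (f^[a] i))) with hg
  have hgsel : IsSelection T g := (hf.update hi).update hia
  have hgoff : ∀ k, k ≠ i → k ≠ f^[a] i → g k = f k := fun k h1 h2 => by
    rw [hg, update_of_ne h2, update_of_ne h1]
  have hgi : g i = f (f i) := by rw [hg, update_of_ne hii.symm, update_self]
  have hgi' : g (f^[a] i) = f (f (f^[a] i)) := by rw [hg, update_self]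
  have e1 : g^[a - 1] i = f^[a] i := by
    rw [show a - 1 = a - 2 + 1 by omega, iterate_succ_apply, hgi, iterate_congr (f := f)]
    · rw [← iterate_succ_apply, ← iterate_succ_apply]
      congr 2; omega
    · intro b hb
      have : f^[b] (f (f i)) = f^[b + 2] i := rfl
      rw [this]
      exact hgoff _ (iterate_ne_self (by omega) (by omega))
        (iterate_ne_of_lt (by omega) (by omega) (by omega))
  have e2 : g^[n - a] (f^[a] i) = i := by
    rw [show n - a = n - 1 - a + 1 by omega, iterate_succ_apply, hgi', iterate_congr (f := f)]
    · rw [← iterate_succ_apply, ← iterate_succ_apply, ← iterate_add_apply,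
        show n - 1 - a + 1 + 1 + a = n + 1 by omega, ← hper', iterate_minimalPeriod]
    · intro b hb
      have : f^[b] (f (f (f^[a] i))) = f^[b + 2 + a] i := by
        rw [iterate_add_apply]; rfl
      rw [this]
      exact hgoff _ (iterate_ne_self (by omega) (by omega))
        (iterate_ne_of_lt (by omega) (by omega) (by omega))
  have hreach : ∃ s, g^[s] v = i := by
    obtain ⟨s0, -, hs0⟩ := hcov v i
    obtain ⟨s, hs⟩ := exists_iterate_mem (f := f) (g := g) (m := {i, f^[a] i}) (fun k hk => by
      simp only [Set.mem_insert_iff, Set.mem_singleton_iff, not_or] at hk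
      exact hgoff k hk.1 hk.2) (v := v) ⟨s0, Or.inl hs0⟩
    rcases hs with hs | hs
    · exact ⟨s, hs⟩
    · refine ⟨n - a + s, ?_⟩
      have hs : g^[s] v = f^[a] i := hs
      rw [iterate_add_apply, hs, e2]
  obtain ⟨s, hs⟩ := hreach
  have hcyc : IsPeriodicPt g (n - a + (a - 1)) i := by
    rw [IsPeriodicPt, IsFixedPt, iterate_add_apply, e1, e2]
  rw [← hs] at hcyc
  have := hB g hgsel s _ (by omega) hcyc
  omega

theorem iterate_outSet_eq_singleton {f : ι → ι} {i : ι} {k : ℕ}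
    (h : ∀ b, b < k → ∀ j, T (f^[b] i) j ↔ j = f^[b + 1] i) :
    (outSet T)^[k] {i} = {f^[k] i} := by
  induction k with
  | zero => rfl
  | succ k ih =>
    rw [iterate_succ_apply', ih fun b hb => h b (by omega)]
    ext j
    simp only [outSet, Set.mem_singleton_iff, exists_eq_left]
    exact h k (by omega) j

theorem exists_figure_of_hamiltonian [Fintype ι] (hn : 3 ≤ n) (hcard : Fintype.card ι = n + 1)
    (hB : HasLongCycles n T v) (hX : ∀ i k, 0 < k → (outSet T)^[k] {i} ≠ {i})
    (hf : IsSelection T f) {u : ι} (hu : minimalPeriod f u = n + 1) :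
    ∃ e : Fin (n + 1) ≃ ι, (∀ i j, T (e i) (e j) ↔ (figure1 (n + 1)).Adj i j) ∨
      ∀ i j, T (e i) (e j) ↔ (figure2 (n + 1)).Adj i j := by
  have hbij : ∀ i, minimalPeriod f i = n + 1 →
      Function.Bijective fun k : Fin (n + 1) => f^[k] i := by
    intro i hi
    rw [Fintype.bijective_iff_injective_and_card, Fintype.card_fin, hcard]
    refine ⟨fun a b hab => Fin.ext ?_, rfl⟩
    exact (iterate_eq_iterate_iff_of_lt_minimalPeriod (by omega) (by omega)).1 hab
  have hper : ∀ i, minimalPeriod f i = n + 1 := by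
    intro i
    obtain ⟨k, rfl⟩ := (hbij u hu).2 i
    dsimp only
    rw [minimalPeriod_apply_iterate, hu]
    exact minimalPeriod_pos_iff_mem_periodicPts.1 (by omega)
  have hcov : ∀ i j, ∃ a, a < n + 1 ∧ f^[a] i = j := by
    intro i j
    obtain ⟨k, hk⟩ := (hbij i (hper i)).2 j
    exact ⟨k, k.2, hk⟩
  have harc : ∀ {i j}, T i j → j = f i ∨ j = f (f i) := fun h =>
    hamiltonian_arc hB hf hper hcov h
  obtain ⟨i1, hi1⟩ : ∃ i, T i (f (f i)) := by
    by_contra! hno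
    refine hX u (n + 1) (by omega) ?_
    rw [iterate_outSet_eq_singleton (f := f), ← hu, iterate_minimalPeriod]
    intro b _ j
    rw [iterate_succ_apply']
    constructor
    · intro h
      rcases harc h with h' | h'
      · exact h'
      · exact absurd (h' ▸ h) (hno _)
    · rintro rfl
      exact hf _
  have hcl : ∀ i, T i (f (f i)) → ∀ a, a < n + 1 → T (f^[a] i) (f (f (f^[a] i))) →
      a = 0 ∨ a = 1 ∨ a = n := fun i hi a ha h =>
    hamiltonian_chords hB hf hper hcov hi ha h
  obtain ⟨i0, hi0, hi0'⟩ : ∃ i, T i (f (f i)) ∧ ∀ a, a < n + 1 → T (f^[a] i) (f (f (f^[a] i))) →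
      a = 0 ∨ a = 1 := by
    by_cases hp : T (f^[n] i1) (f (f (f^[n] i1)))
    · refine ⟨f^[n] i1, hp, fun a ha h => ?_⟩
      have hback : f (f^[n] i1) = i1 := by
        have h := iterate_minimalPeriod (f := f) (x := i1)
        rwa [hper i1, iterate_succ_apply'] at h
      rcases hcl _ hp a ha h with h0 | h0 | h0
      · exact Or.inl h0
      · exact Or.inr h0
      · exfalso
        have e : f^[a] (f^[n] i1) = f^[n - 1] i1 := by
          rw [h0, show n = n - 1 + 1 by omega, iterate_succ_apply, Nat.sub_add_cancel (by omega),
            hback]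
        rw [e] at h
        have := hcl _ hi1 (n - 1) (by omega) h
        omega
    · refine ⟨i1, hi1, fun a ha h => ?_⟩
      rcases hcl _ hi1 a ha h with h0 | h0 | h0
      · exact Or.inl h0
      · exact Or.inr h0
      · exact absurd (h0 ▸ h) hp
  let e := Equiv.ofBijective _ (hbij (f i0) (hper _))
  have he : ∀ k, e k = f^[(k : ℕ) + 1] i0 := fun k => rfl
  have hend : f^[n + 1] i0 = i0 := by rw [← hper i0, iterate_minimalPeriod]
  have hinj : ∀ a b, a ≤ n → b ≤ n → (f^[a] i0 = f^[b] i0 ↔ a = b) := fun a b ha hb =>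
    iterate_eq_iterate_iff_of_lt_minimalPeriod (by rw [hper]; omega) (by rw [hper]; omega)
  have hstep : ∀ i j : Fin (n + 1), e j = f (e i) ↔
      ((j : ℕ) = i + 1 ∨ ((i : ℕ) = n ∧ (j : ℕ) = 0)) := by
    intro i j
    have hi := i.2
    have hj := j.2
    have h1 : f (e i) = f^[(i : ℕ) + 1] (f i0) := by rw [he, ← iterate_succ_apply' f]; rfl
    have h2 : e j = f^[(j : ℕ)] (f i0) := rfl
    by_cases hin : (i : ℕ) = n
    · have h3 : f (e i) = f^[0] (f i0) := by
        rw [h1, hin, ← hper (f i0), iterate_minimalPeriod]; rfl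
      rw [h2, h3, iterate_eq_iterate_iff_of_lt_minimalPeriod (by rw [hper]; omega)
        (by rw [hper]; omega)]
      omega
    · rw [h2, h1, iterate_eq_iterate_iff_of_lt_minimalPeriod (by rw [hper]; omega)
        (by rw [hper]; omega)]
      omega
  have hstep2 : ∀ i j : Fin (n + 1), (i : ℕ) = n ∨ (i : ℕ) = 0 → (e j = f (f (e i)) ↔
      (((i : ℕ) = n ∧ (j : ℕ) = 1) ∨ ((i : ℕ) = 0 ∧ (j : ℕ) = 2))) := by
    intro i j h
    have hj := j.2
    have h2 : e j = f^[(j : ℕ)] (f i0) := rfl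
    rcases h with h | h
    · have h3 : f (f (e i)) = f^[1] (f i0) := by
        rw [he, h, hend]; rfl
      rw [h2, h3, iterate_eq_iterate_iff_of_lt_minimalPeriod (by rw [hper]; omega)
        (by rw [hper]; omega)]
      omega
    · have h3 : f (f (e i)) = f^[2] (f i0) := by
        rw [he, h]; rfl
      rw [h2, h3, iterate_eq_iterate_iff_of_lt_minimalPeriod (by rw [hper]; omega)
        (by rw [hper]; omega)]
      omega
  have hchord : ∀ i : Fin (n + 1), T (e i) (f (f (e i))) → (i : ℕ) = n ∨ (i : ℕ) = 0 := by
    intro i h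
    by_cases hin : (i : ℕ) = n
    · exact Or.inl hin
    · have hi := i.2
      rw [he] at h
      have := hi0' ((i : ℕ) + 1) (by omega) h
      omega
  have hTn : T (e (Fin.last n)) (f (f (e (Fin.last n)))) := by
    rw [he, Fin.val_last, hend]; exact hi0
  have hT : ∀ i j : Fin (n + 1), T (e i) (e j) ↔ e j = f (e i) ∨
      (e j = f (f (e i)) ∧ T (e i) (f (f (e i)))) := by
    intro i j
    constructor
    · intro h
      rcases harc h with h' | h'
      · exact Or.inl h'
      · exact Or.inr ⟨h', h' ▸ h⟩
    · rintro (h | ⟨h, h'⟩)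
      · rw [h]; exact hf _
      · rw [h]; exact h'
  have hlast : ∀ i : Fin (n + 1), (i : ℕ) = n → T (e i) (f (f (e i))) := by
    intro i h
    have : i = Fin.last n := Fin.ext h
    rw [this]; exact hTn
  refine ⟨e, ?_⟩
  by_cases h0 : T (e 0) (f (f (e 0)))
  · right
    have h0' : ∀ i : Fin (n + 1), (i : ℕ) = 0 → T (e i) (f (f (e i))) := by
      intro i h
      have : i = 0 := Fin.ext h
      rw [this]; exact h0
    intro i j
    rw [hT, hstep]
    constructor
    · rintro (h | ⟨h, h'⟩)
      · simp only [figure2, figure1]; omega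
      · rw [hstep2 i j (hchord i h')] at h
        simp only [figure2, figure1]; omega
    · intro h
      simp only [figure2, figure1] at h
      by_cases hs : (j : ℕ) = i + 1 ∨ ((i : ℕ) = n ∧ (j : ℕ) = 0)
      · exact Or.inl hs
      · right
        have hi : (i : ℕ) = n ∨ (i : ℕ) = 0 := by omega
        refine ⟨(hstep2 i j hi).2 (by omega), ?_⟩
        rcases hi with hi | hi
        · exact hlast i hi
        · exact h0' i hi
  · left
    intro i j
    rw [hT, hstep]
    constructor
    · rintro (h | ⟨h, h'⟩)
      · simp only [figure1]; omega
      · have hi := hchord i h'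
        rw [hstep2 i j hi] at h
        rcases hi with hi | hi
        · simp only [figure1]; omega
        · have : i = 0 := Fin.ext hi
          rw [this] at h'
          exact absurd h' h0
    · intro h
      simp only [figure1] at h
      by_cases hs : (j : ℕ) = i + 1 ∨ ((i : ℕ) = n ∧ (j : ℕ) = 0)
      · exact Or.inl hs
      · right
        have hi : (i : ℕ) = n := by omega
        exact ⟨(hstep2 i j (Or.inl hi)).2 (by omega), hlast i hi⟩

end Hamiltonian

theorem exists_hamiltonian_of_cycle {n : ℕ} {T : ι → ι → Prop} {v : ι} [Fintype ι] (hn : 3 ≤ n)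
    (hcard : Fintype.card ι = n + 1) (hB : HasLongCycles n T v)
    (hX : ∀ i k, 0 < k → (outSet T)^[k] {i} ≠ {i}) {f : ι → ι} (hf : IsSelection T f)
    {s : ℕ} (hu : minimalPeriod f (f^[s] v) = n) :
    ∃ g, IsSelection T g ∧ ∃ s, minimalPeriod g (g^[s] v) = n + 1 := by
  classical
  by_contra! hA
  set u := f^[s] v with hudef
  have huper : f^[n] u = u := by rw [← hu, iterate_minimalPeriod]
  have hup : u ∈ periodicPts f := minimalPeriod_pos_iff_mem_periodicPts.1 (by omega)
  let C : Finset ι := Finset.univ.image fun k : Fin n => f^[(k : ℕ)] u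
  have hCcard : C.card = n := by
    rw [Finset.card_image_of_injective, Finset.card_univ, Fintype.card_fin]
    intro a b hab
    exact Fin.ext ((iterate_eq_iterate_iff_of_lt_minimalPeriod (by omega) (by omega)).1 hab)
  have hmemC : ∀ i, i ∈ C ↔ ∃ p, p < n ∧ f^[p] u = i := by
    intro i
    simp only [C, Finset.mem_image, Finset.mem_univ, true_and]
    exact ⟨fun ⟨k, hk⟩ => ⟨k, k.2, hk⟩, fun ⟨p, hp, h⟩ => ⟨⟨p, hp⟩, h⟩⟩
  have hitC : ∀ p, f^[p] u ∈ C := by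
    intro p
    rw [hmemC]
    refine ⟨p % n, Nat.mod_lt _ (by omega), ?_⟩
    conv_lhs => rw [← hu]
    exact iterate_mod_minimalPeriod_eq
  have hitC' : ∀ i ∈ C, ∀ p, f^[p] i ∈ C := by
    intro i hi p
    obtain ⟨q, -, rfl⟩ := (hmemC i).1 hi
    rw [← iterate_add_apply]; exact hitC _
  obtain ⟨w, hw⟩ : ∃ w, Cᶜ = {w} := by
    rw [← Finset.card_eq_one, Finset.card_compl, hcard, hCcard]; omega
  have hwC : ∀ i, i ∉ C ↔ i = w := by
    intro i
    rw [← Finset.mem_compl, hw, Finset.mem_singleton]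
  have hwnot : w ∉ C := (hwC w).2 rfl
  have hperC : ∀ i ∈ C, minimalPeriod f i = n := by
    intro i hi
    obtain ⟨q, -, rfl⟩ := (hmemC i).1 hi
    rw [minimalPeriod_apply_iterate hup, hu]
  have hreachC : ∀ i ∈ C, ∃ a, f^[a] v = i := by
    intro i hi
    obtain ⟨q, -, rfl⟩ := (hmemC i).1 hi
    exact ⟨q + s, by rw [iterate_add_apply]⟩
  have hcovC : ∀ i ∈ C, ∀ j ∈ C, ∃ b, 1 ≤ b ∧ b ≤ n ∧ f^[b] i = j := by
    intro i hi j hj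
    obtain ⟨p, hp, rfl⟩ := (hmemC i).1 hi
    obtain ⟨q, hq, rfl⟩ := (hmemC j).1 hj
    by_cases hpq : p < q
    · refine ⟨q - p, by omega, by omega, ?_⟩
      rw [← iterate_add_apply, Nat.sub_add_cancel hpq.le]
    · refine ⟨q + n - p, by omega, by omega, ?_⟩
      rw [← iterate_add_apply, Nat.sub_add_cancel (by omega), iterate_add_apply, huper]
  have hend : ∀ i ∈ C, f^[n] i = i := fun i hi => by
    conv_lhs => rw [← hperC i hi]
    exact iterate_minimalPeriod
  have hchord : ∀ i ∈ C, ∀ j ∈ C, T i j → j = f i := by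
    intro i hi j hj h
    obtain ⟨b, hb1, hb2, rfl⟩ := hcovC i hi j hj
    have := hB.chord_le hf (hreachC i hi) (hperC i hi) hb1 hb2 h
    have hb : b = 1 := by omega
    rw [hb]; rfl
  obtain ⟨i0, hi0, hi0w⟩ : ∃ i ∈ C, T i w := by
    by_contra! hno
    refine hX u n (by omega) ?_
    rw [iterate_outSet_eq_singleton (f := f), huper]
    intro b _ j
    rw [iterate_succ_apply']
    constructor
    · intro h
      refine hchord _ (hitC b) _ ?_ h
      by_contra hj
      exact hno _ (hitC b) ((hwC j).1 hj ▸ h)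
    · rintro rfl
      exact hf _
  have hi0ne : i0 ≠ w := fun h => hwnot (h ▸ hi0)
  have hp0 := hperC i0 hi0
  have hmod : ∀ j, T w j → IsSelection T (Function.update (Function.update f i0 w) w j) :=
    fun j h => (hf.update hi0w).update h
  have hreach : ∀ j, ∃ a, (Function.update (Function.update f i0 w) w j)^[a] v = w := by
    intro j
    obtain ⟨a0, ha0⟩ := hreachC i0 hi0
    obtain ⟨a, ha⟩ := exists_iterate_mem (f := f)
      (g := Function.update (Function.update f i0 w) w j) (m := {i0, w}) (fun k hk => by
        simp only [Set.mem_insert_iff, Set.mem_singleton_iff, not_or] at hk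
        rw [update_of_ne hk.2, update_of_ne hk.1]) (v := v) ⟨a0, Or.inl ha0⟩
    rcases ha with ha | ha
    · refine ⟨a + 1, ?_⟩
      rw [iterate_succ_apply', ha, update_of_ne hi0ne, update_self]
    · exact ⟨a, ha⟩
  have hTw : ∀ j, T w j → j = f (f i0) := by
    intro j hj
    obtain ⟨a, ha⟩ := hreach j
    have hsel := hmod j hj
    by_cases hjw : j = w
    · subst hjw
      have := hB _ hsel a 1 one_pos (by
        rw [ha, IsPeriodicPt, IsFixedPt, iterate_one, update_self])
      omega
    have hjC : j ∈ C := by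
      by_contra h
      exact hjw ((hwC j).1 h)
    obtain ⟨b, hb1, hb2, rfl⟩ := hcovC i0 hi0 j hjC
    set g := Function.update (Function.update f i0 w) w (f^[b] i0) with hg
    have hcyc : IsPeriodicPt g (n - b + 2) w := by
      rw [IsPeriodicPt, IsFixedPt, iterate_succ_apply, iterate_succ_apply']
      rw [hg, update_self, ← hg, iterate_congr (f := f), ← iterate_add_apply,
        Nat.sub_add_cancel hb2, hend i0 hi0, hg, update_of_ne hi0ne, update_self]
      intro k hk
      rw [← iterate_add_apply, hg, update_of_ne, update_of_ne]
      · exact iterate_ne_self (by omega) (by omega)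
      · intro h
        exact hwnot (h ▸ hitC' i0 hi0 _)
    have hcyc' := hcyc
    rw [← ha] at hcyc'
    have hle := hB _ hsel a _ (by omega) hcyc'
    have hb : b = 1 ∨ b = 2 := by omega
    rcases hb with rfl | rfl
    · exfalso
      refine hA g hsel a ?_
      have hpos : 0 < minimalPeriod g (g^[a] v) := hcyc'.minimalPeriod_pos (by omega)
      have h1 := hB _ hsel a _ hpos (isPeriodicPt_minimalPeriod _ _)
      obtain ⟨d, hd⟩ := hcyc'.minimalPeriod_dvd
      rw [show n - 1 + 2 = n + 1 by omega] at hd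
      have hd1 : d = 1 := by
        rcases d with _ | _ | d
        · omega
        · rfl
        · have : n * 2 ≤ minimalPeriod g (g^[a] v) * (d + 1 + 1) := Nat.mul_le_mul h1 (by omega)
          omega
      rw [hd1, mul_one] at hd
      exact hd.symm
    · rfl
  have hTi : ∀ i ∈ C, i ≠ i0 → ∀ j, T i j ↔ j = f i := by
    intro i hi hne j
    constructor
    · intro h
      refine hchord i hi j ?_ h
      by_contra hj
      rw [hwC] at hj
      subst hj
      -- the same analysis at the vertex `i` shows that the two vertices agree
      obtain ⟨b, hb1, hb2, rfl⟩ := hcovC i0 hi0 i hi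
      have hlt : b < n := by
        rcases hb2.lt_or_eq with h' | h'
        · exact h'
        · rw [h', hend i0 hi0] at hne
          exact absurd rfl hne
      set g := Function.update (Function.update f (f^[b] i0) j) j (f (f i0)) with hg
      have hTj : T j (f (f i0)) := by
        have := hf j
        rwa [hTw _ this] at this
      have hsel : IsSelection T g := (hf.update h).update hTj
      have hbne : f^[b] i0 ≠ j := fun h' => hwnot (h' ▸ hitC' i0 hi0 b)
      have hoff : ∀ k, k ≠ f^[b] i0 → k ≠ j → g k = f k := fun k h1 h2 => by
        rw [hg, update_of_ne h2, update_of_ne h1]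
      obtain ⟨a0, ha0⟩ := hreachC _ hi
      obtain ⟨a, ha⟩ : ∃ a, g^[a] v = j := by
        obtain ⟨a, ha⟩ := exists_iterate_mem (f := f) (g := g) (m := {f^[b] i0, j}) (fun k hk => by
          simp only [Set.mem_insert_iff, Set.mem_singleton_iff, not_or] at hk
          exact hoff k hk.1 hk.2) (v := v) ⟨a0, Or.inl ha0⟩
        rcases ha with ha | ha
        · refine ⟨a + 1, ?_⟩
          rw [iterate_succ_apply', ha, hg, update_of_ne hbne, update_self]
        · exact ⟨a, ha⟩
      have hz : ∀ k, f^[k] (f (f i0)) = f^[k + 2] i0 := fun k => rfl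
      by_cases hb : b = 1
      · -- the cycle is `j`, `f (f i0)`, …, `i0`, `f i0`
        have hcyc : IsPeriodicPt g (n - 1 + 1 + 1) j := by
          rw [IsPeriodicPt, IsFixedPt, iterate_succ_apply, iterate_succ_apply', hg, update_self,
            ← hg, iterate_congr (f := f), hz, show n - 1 + 2 = b + n by omega, iterate_add_apply,
            hend i0 hi0, hg, update_of_ne hbne, update_self]
          intro k hk
          rw [hz]
          by_cases hk2 : k + 2 = n
          · rw [hk2, hend i0 hi0]
            exact hoff _ hne.symm hi0ne
          · exact hoff _ (iterate_ne_of_lt (by omega) (by omega) (by omega))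
              fun h' => hwnot (h' ▸ hitC' i0 hi0 _)
        have hcyc' := hcyc
        rw [← ha] at hcyc'
        refine hA g hsel a ?_
        have hpos : 0 < minimalPeriod g (g^[a] v) := hcyc'.minimalPeriod_pos (by omega)
        have h1 := hB _ hsel a _ hpos (isPeriodicPt_minimalPeriod _ _)
        obtain ⟨d, hd⟩ := hcyc'.minimalPeriod_dvd
        rw [show n - 1 + 1 + 1 = n + 1 by omega] at hd
        have hd1 : d = 1 := by
          rcases d with _ | _ | d
          · omega
          · rfl
          · have : n * 2 ≤ minimalPeriod g (g^[a] v) * (d + 1 + 1) := Nat.mul_le_mul h1 (by omega)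
            omega
        rw [hd1, mul_one] at hd
        exact hd.symm
      · have hcyc : IsPeriodicPt g (b - 2 + 1 + 1) j := by
          rw [IsPeriodicPt, IsFixedPt, iterate_succ_apply, iterate_succ_apply', hg, update_self,
            ← hg, iterate_congr (f := f), hz, show b - 2 + 2 = b by omega, hg,
            update_of_ne hbne, update_self]
          intro k hk
          rw [hz]
          exact hoff _ (iterate_ne_of_lt (by omega) (by omega) (by omega))
            fun h' => hwnot (h' ▸ hitC' i0 hi0 _)
        rw [← ha] at hcyc
        have := hB _ hsel a _ (by omega) hcyc
        omega
    · rintro rfl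
      exact hf _
  have hTwf : T w (f (f i0)) := by
    have := hf w
    rwa [hTw _ this] at this
  have hz : ∀ k, f^[k] (f (f i0)) = f^[k + 2] i0 := fun k => rfl
  refine hX (f (f i0)) (n - 2 + 1 + 1) (by omega) ?_
  rw [iterate_succ_apply', iterate_succ_apply', iterate_outSet_eq_singleton (f := f), hz,
    Nat.sub_add_cancel (by omega), hend i0 hi0]
  · have hfi0 : f i0 ≠ i0 := iterate_ne_self (a := 1) (by omega) one_pos
    have h1 : outSet T {i0} = {f i0, w} := by
      ext j
      simp only [outSet, Set.mem_singleton_iff, exists_eq_left, Set.mem_insert_iff]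
      constructor
      · intro h
        by_cases hj : j ∈ C
        · exact Or.inl (hchord i0 hi0 j hj h)
        · exact Or.inr ((hwC j).1 hj)
      · rintro (rfl | rfl)
        · exact hf i0
        · exact hi0w
    rw [h1]
    ext j
    simp only [outSet, Set.mem_singleton_iff, Set.mem_insert_iff, exists_eq_or_imp,
      exists_eq_left, Set.mem_ofPred_eq]
    constructor
    · rintro (h | h)
      · exact (hTi (f i0) (hitC' i0 hi0 1) hfi0 j).1 h
      · exact hTw j h
    · rintro rfl
      exact Or.inr hTwf
  · intro b hb j
    have hC : f^[b] (f (f i0)) ∈ C := hitC' i0 hi0 (b + 2)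
    rw [hTi _ hC (by rw [hz]; exact iterate_ne_self (by omega) (by omega)), iterate_succ_apply']

/-- The digraphs without short cycles in which no vertex returns only to itself. -/
theorem exists_figure {n : ℕ} {T : ι → ι → Prop} {v : ι} [Fintype ι] (hn : 3 ≤ n)
    (hcard : Fintype.card ι = n + 1) (hout : ∀ i, ∃ j, T i j) (hB : HasLongCycles n T v)
    (hX : ∀ i k, 0 < k → (outSet T)^[k] {i} ≠ {i}) :
    ∃ e : Fin (n + 1) ≃ ι, (∀ i j, T (e i) (e j) ↔ (figure1 (n + 1)).Adj i j) ∨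
      ∀ i j, T (e i) (e j) ↔ (figure2 (n + 1)).Adj i j := by
  choose f hf using hout
  have hf : IsSelection T f := hf
  obtain ⟨a, b, hab, hEq⟩ : ∃ a b, a < b ∧ f^[a] v = f^[b] v := by
    obtain ⟨a, b, hne, h⟩ := Finite.exists_ne_map_eq_of_infinite fun k : ℕ => f^[k] v
    rcases lt_or_gt_of_ne hne with h' | h'
    · exact ⟨a, b, h', h⟩
    · exact ⟨b, a, h', h.symm⟩
  have hper : IsPeriodicPt f (b - a) (f^[a] v) := by
    rw [IsPeriodicPt, IsFixedPt, ← iterate_add_apply, Nat.sub_add_cancel hab.le, hEq]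
  have hpos : 0 < minimalPeriod f (f^[a] v) := hper.minimalPeriod_pos (by omega)
  have h1 := hB f hf a _ hpos (isPeriodicPt_minimalPeriod _ _)
  have h2 : minimalPeriod f (f^[a] v) ≤ n + 1 := hcard ▸ minimalPeriod_le_card
  obtain ⟨g, hg, s, hs⟩ : ∃ g, IsSelection T g ∧ ∃ s, minimalPeriod g (g^[s] v) = n + 1 := by
    by_cases h : minimalPeriod f (f^[a] v) = n + 1
    · exact ⟨f, hf, a, h⟩
    · exact exists_hamiltonian_of_cycle hn hcard hB hX hf (s := a) (by omega)
  exact exists_figure_of_hamiltonian hn hcard hB hX hg hs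

end Classification
end KCone

namespace KCone
open Matrix

section LongExponents

variable {n : ℕ} {ι : Type*} [Fintype ι] {x : ι → Fin n → ℝ} {c : ι → ℝ}
  {A : Matrix (Fin n) (Fin n) ℝ}

local notation "Kx" => PointedCone.hull ℝ (Set.range x)

theorem MinimalSystem.hasLongCycles (S : MinimalSystem x c) (hn : 1 ≤ n)
    (hcard : Fintype.card ι = n + 1) (hA : IsKPrimitive Kx A) {N : ℕ}
    (hN : n + 1 + (n - 1) * (n - 2) ≤ N) {v : ι}
    (hv : A ^ N *ᵥ x v ∉ interior (Kx : Set (Fin n → ℝ))) :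
    HasLongCycles n (fun i j => x j ∈ genFace Kx {A *ᵥ x i}) v := by
  intro f hf s l hl hs
  by_contra! hlt
  obtain ⟨a, b, hab, hb, hEq⟩ : ∃ a b, a < b ∧ b ≤ n + 1 ∧ f^[a] v = f^[b] v := by
    obtain ⟨a, b, hne, h⟩ := Fintype.exists_ne_map_eq_of_card_lt
      (fun k : Fin (n + 2) => f^[(k : ℕ)] v) (by simp [hcard])
    rcases lt_or_gt_of_ne hne with h' | h'
    · exact ⟨a, b, h', by omega, h⟩
    · exact ⟨b, a, h', by omega, h.symm⟩
  have hper : Function.IsPeriodicPt f (b - a) (f^[a] v) := by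
    rw [Function.IsPeriodicPt, Function.IsFixedPt, ← Function.iterate_add_apply,
      Nat.sub_add_cancel hab.le, hEq]
  have hp0 := hper.minimalPeriod_pos (by omega)
  have hp1 := hper.minimalPeriod_le (by omega)
  have hp2 : Function.minimalPeriod f (f^[a] v) = Function.minimalPeriod f (f^[s] v) := by
    rw [← Function.minimalPeriod_apply_iterate (Function.mk_mem_periodicPts (by omega) hper) s,
      ← Function.minimalPeriod_apply_iterate (Function.mk_mem_periodicPts hl hs) a,
      ← Function.iterate_add_apply, ← Function.iterate_add_apply, add_comm]
  have hp3 := hs.minimalPeriod_le hl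
  have h := S.mem_interior_of_iterate hA hf hp0 (Function.isPeriodicPt_minimalPeriod f (f^[a] v))
  refine hv (S.mem_interior_pow_le hA h ?_)
  generalize Function.minimalPeriod f (f^[a] v) = p at *
  refine le_trans ?_ hN
  have h2 : (n - 2) * p ≤ (n - 2) * (n - 1) := Nat.mul_le_mul_left _ (by omega)
  have h3 : (n - 1) * p = (n - 2) * p + p := by
    rw [← Nat.succ_mul]
    congr 1
    omega
  rw [mul_comm (n - 1) (n - 2)]
  omega

theorem MinimalSystem.exists_arc (S : MinimalSystem x c) (hA : IsKPrimitive Kx A) (i : ι) :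
    ∃ j, x j ∈ genFace Kx {A *ᵥ x i} := by
  obtain ⟨M, hM, hMp⟩ := exists_isRep hA.1
  by_contra! hno
  have h0 : A *ᵥ x i = 0 := by
    rw [hM.eq]
    refine Finset.sum_eq_zero fun j _ => ?_
    rw [le_antisymm (not_lt.1 fun h => hno j ((hMp i j).1 h)) (hM.nonneg i j), zero_smul]
  obtain ⟨p, hp, hpos⟩ := hA.2
  refine S.ne_zero_of_mem_interior (hpos _ (mem i) (S.ne_zero i)) ?_
  rw [← Nat.sub_add_cancel hp, pow_succ, ← Matrix.mulVec_mulVec, h0, Matrix.mulVec_zero]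

end LongExponents

section Frames

variable {n : ℕ} {K : PointedCone ℝ (Fin n → ℝ)} {A : Matrix (Fin n) (Fin n) ℝ}

theorem exists_equiv_extremeRays (hK : K ∈ polyCones (n + 1) n) :
    Nonempty (Fin (n + 1) ≃ extremeRays K) := by
  have := hK.2.1.to_subtype
  exact ⟨(Finite.equivFinOfCardEq (by rw [Nat.card_coe_set_eq, hK.2.2])).symm⟩

/-- Vectors on the extreme rays of a minimal cone together with their relation. -/
theorem exists_frame (hK : K ∈ polyCones (n + 1) n) (e : Fin (n + 1) ≃ extremeRays K) :
    ∃ (x : Fin (n + 1) → Fin n → ℝ) (c : Fin (n + 1) → ℝ), IsRaySystem K e x ∧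
      MinimalSystem x c ∧ K = PointedCone.hull ℝ (Set.range x) ∧
      Submodule.span ℝ (Set.range x) = ⊤ := by
  obtain ⟨x, hx⟩ := exists_isRaySystem e
  have hm := isMinimalCone_of_mem_polyCones hK
  obtain ⟨c, S⟩ := hm.exists_minimalSystem hx
  exact ⟨x, c, hx, S, hm.eq_hull hx, span_range_eq_top hK hx⟩

theorem isGivenBy_of_not_le (hn : 3 ≤ n) (hK : K ∈ polyCones (n + 1) n) (hA : IsKPrimitive K A)
    {N : ℕ} (hN : n + 1 + (n - 1) * (n - 2) ≤ N) (h : ¬ matrixExponent K A ≤ N) :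
    IsGivenBy K A (figure1 (n + 1)) ∨ IsGivenBy K A (figure2 (n + 1)) := by
  obtain ⟨e⟩ := exists_equiv_extremeRays hK
  obtain ⟨x, c, hx, S, rfl, hspan⟩ := exists_frame hK e
  rw [S.matrixExponent_le_iff hA (by omega)] at h
  push Not at h
  obtain ⟨v, hv⟩ := h
  have hcard : Fintype.card (Fin (n + 1)) = n + 1 := Fintype.card_fin _
  obtain ⟨g, hg⟩ := exists_figure hn hcard (S.exists_arc hA)
    (S.hasLongCycles (by omega) hcard hA hN hv)
    fun i k hk => S.iterate_outSet_ne hspan hA i hk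
  have hx' : IsRaySystem _ (g.trans e) (x ∘ g) := fun i => hx (g i)
  exact hg.imp (fun h => ⟨g.trans e, (MinimalSystem.isLabelling_iff hx' hA.1).2 h⟩)
    fun h => ⟨g.trans e, (MinimalSystem.isLabelling_iff hx' hA.1).2 h⟩

theorem cycle_bound {n : ℕ} (hn : 3 ≤ n) : n + 1 + (n - 1) * (n - 2) ≤ n ^ 2 - n := by
  obtain ⟨m, rfl⟩ : ∃ m, n = m + 3 := ⟨n - 3, by omega⟩
  have e1 : m + 3 - 1 = m + 2 := by omega
  have e2 : m + 3 - 2 = m + 1 := by omega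
  rw [e1, e2]
  apply Nat.le_sub_of_add_le
  nlinarith

theorem cycle_bound_of_four_le {n : ℕ} (hn : 4 ≤ n) :
    n + 1 + (n - 1) * (n - 2) ≤ n ^ 2 - n - 1 := by
  obtain ⟨m, rfl⟩ : ∃ m, n = m + 4 := ⟨n - 4, by omega⟩
  have e1 : m + 4 - 1 = m + 3 := by omega
  have e2 : m + 4 - 2 = m + 2 := by omega
  rw [e1, e2]
  apply Nat.le_sub_of_add_le
  apply Nat.le_sub_of_add_le
  nlinarith

theorem matrixExponent_of_figure1 (hn : 3 ≤ n) (hK : K ∈ polyCones (n + 1) n)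
    (hA : IsKPrimitive K A) (h : IsGivenBy K A (figure1 (n + 1))) :
    (Odd n → matrixExponent K A = n ^ 2 - n + 1) ∧ (Even n → matrixExponent K A = n ^ 2 - n) := by
  obtain ⟨e, he⟩ := h
  obtain ⟨x, c, hx, S, rfl, hspan⟩ := exists_frame hK e
  rw [MinimalSystem.isLabelling_iff hx hA.1] at he
  exact ⟨fun h => S.matrixExponent_figure1_of_odd hn h hspan hA he,
    fun h => S.matrixExponent_figure1_of_even hn h hspan hA he⟩

theorem matrixExponent_le_of_figure2 (hn : 3 ≤ n) (hK : K ∈ polyCones (n + 1) n)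
    (hA : IsKPrimitive K A) (h : IsGivenBy K A (figure2 (n + 1))) :
    matrixExponent K A ≤ n ^ 2 - n := by
  obtain ⟨e, he⟩ := h
  obtain ⟨x, c, hx, S, rfl, hspan⟩ := exists_frame hK e
  rw [MinimalSystem.isLabelling_iff hx hA.1] at he
  exact S.matrixExponent_figure2_le hn hA he

theorem matrixExponent_le_of_odd (hn : 3 ≤ n) (hodd : Odd n) (hK : K ∈ polyCones (n + 1) n)
    (hA : IsKPrimitive K A) : matrixExponent K A ≤ n ^ 2 - n + 1 := by
  by_contra! h
  rcases isGivenBy_of_not_le hn hK hA (cycle_bound hn) (by omega) with h' | h'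
  · have := (matrixExponent_of_figure1 hn hK hA h').1 hodd
    omega
  · have := matrixExponent_le_of_figure2 hn hK hA h'
    omega

theorem matrixExponent_le_of_even (hn : 3 ≤ n) (hev : Even n) (hK : K ∈ polyCones (n + 1) n)
    (hA : IsKPrimitive K A) : matrixExponent K A ≤ n ^ 2 - n := by
  by_contra! h
  rcases isGivenBy_of_not_le hn hK hA (cycle_bound hn) (by omega) with h' | h'
  · have := (matrixExponent_of_figure1 hn hK hA h').2 hev
    omega
  · have := matrixExponent_le_of_figure2 hn hK hA h'
    omega

theorem matrixExponent_eq_iff_of_odd (hn : 3 ≤ n) (hodd : Odd n) (hK : K ∈ polyCones (n + 1) n)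
    (hA : IsKPrimitive K A) :
    matrixExponent K A = n ^ 2 - n + 1 ↔ IsGivenBy K A (figure1 (n + 1)) := by
  refine ⟨fun h => ?_, fun h => (matrixExponent_of_figure1 hn hK hA h).1 hodd⟩
  refine (isGivenBy_of_not_le hn hK hA (cycle_bound hn) (by omega)).resolve_right fun h' => ?_
  have := matrixExponent_le_of_figure2 hn hK hA h'
  omega

theorem isGivenBy_of_even (hn : 3 ≤ n) (hev : Even n) (hK : K ∈ polyCones (n + 1) n)
    (hA : IsKPrimitive K A) (h : matrixExponent K A = n ^ 2 - n) :
    IsGivenBy K A (figure1 (n + 1)) ∨ IsGivenBy K A (figure2 (n + 1)) := by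
  have hlt := MinimalSystem.lt_sq_sub hn
  have hn4 : 4 ≤ n := by
    obtain ⟨k, hk⟩ := hev
    omega
  exact isGivenBy_of_not_le hn hK hA (cycle_bound_of_four_le hn4) (by omega)

end Frames

section Extremal

variable {n : ℕ} {K : PointedCone ℝ (Fin n → ℝ)} {A : Matrix (Fin n) (Fin n) ℝ}

theorem indecomposable_of_figure1 (hn : 3 ≤ n) (hK : K ∈ polyCones (n + 1) n)
    (hA : IsKPrimitive K A) (h : IsGivenBy K A (figure1 (n + 1))) :
    IsIndecomposable K ∧ HasBalancedRelation K := by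
  have h1 := fin_val_one (n := n) (by omega)
  obtain ⟨e, he⟩ := h
  obtain ⟨x, c, hx, S, rfl, hspan⟩ := exists_frame hK e
  rw [MinimalSystem.isLabelling_iff hx hA.1] at he
  obtain ⟨⟨σ, hσ, hc⟩, h12⟩ := S.figure1_signs hn hA.1 he
  have hc1 : c 1 ≠ 0 := fun h0 => by simp [h0] at h12
  rw [S.isIndecomposable_iff, S.hasBalancedRelation_iff, signSum_of_hasAltSigns (by omega) hc]
  constructor
  · intro i
    by_cases hi : (i : ℕ) = 1
    · rwa [show i = 1 from Fin.ext (hi.trans h1.symm)]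
    · exact hc.ne_zero hi
  · by_cases hev : Even n
    · rw [if_pos hev]
      rcases lt_or_gt_of_ne hc1 with h | h
      · simp [sign_neg h]
      · simp [sign_pos h]
    · rw [if_neg hev]
      have h2 := hc ⟨2, by omega⟩ (by simp)
      simp only [altSign] at h2
      norm_num at h2
      rcases lt_or_gt_of_ne hc1 with h | h
      · have h3 : 0 < c ⟨2, by omega⟩ := pos_of_mul_neg_right h12 h.le
        have h4 : 0 < σ := pos_of_mul_pos_left h2 h3.le
        simp [sign_neg h, sign_pos h4]
      · have h3 : c ⟨2, by omega⟩ < 0 := by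
          by_contra! h3
          have := mul_nonneg h.le h3
          linarith
        have h4 : σ < 0 := by
          by_contra! h4
          have := mul_nonneg h4 (neg_nonneg.2 h3.le)
          linarith
        simp [sign_pos h, sign_neg h4]

theorem cone_of_figure2 (hn : 3 ≤ n) (hev : Even n) (hK : K ∈ polyCones (n + 1) n)
    (hA : IsKPrimitive K A) (h : IsGivenBy K A (figure2 (n + 1))) :
    (IsIndecomposable K ∧ HasBalancedRelation K) ∨
      ∃ R K' : PointedCone ℝ (Fin n → ℝ), IsRay R ∧ IsMinimalCone K' ∧
        IsIndecomposable K' ∧ HasBalancedRelation K' ∧ IsDirectSum K R K' := by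
  have h1 := fin_val_one (n := n) (by omega)
  obtain ⟨e, he⟩ := h
  obtain ⟨x, c, hx, S, rfl, hspan⟩ := exists_frame hK e
  rw [MinimalSystem.isLabelling_iff hx hA.1] at he
  obtain ⟨σ, hσ, hc⟩ := S.figure2_signs hn hA.1 he
  rw [S.isIndecomposable_iff, S.hasBalancedRelation_iff, S.exists_ray_isDirectSum_iff,
    signSum_of_hasAltSigns (by omega) hc, if_pos hev, zero_add]
  have key : ∀ i, c i = 0 → i = 1 := fun i hi => by
    by_contra hne
    exact hc.ne_zero (fun h => hne (Fin.ext (h.trans h1.symm))) hi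
  rcases lt_trichotomy (c 1) 0 with h | h | h
  · exact Or.inl ⟨fun i hi => by rw [← key i hi] at h; exact h.ne hi, by simp [sign_neg h]⟩
  · exact Or.inr ⟨⟨1, fun i => ⟨key i, by rintro rfl; exact h⟩⟩, by simp [h]⟩
  · exact Or.inl ⟨fun i hi => by rw [← key i hi] at h; exact h.ne' hi, by simp [sign_pos h]⟩

theorem exists_isGivenBy_figure1 (hn : 3 ≤ n) (hK : K ∈ polyCones (n + 1) n)
    (h : IsIndecomposable K ∧ HasBalancedRelation K) :
    ∃ A, IsKPrimitive K A ∧ IsGivenBy K A (figure1 (n + 1)) := by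
  obtain ⟨e⟩ := exists_equiv_extremeRays hK
  obtain ⟨x, c, hx, S, rfl, hspan⟩ := exists_frame hK e
  rw [S.isIndecomposable_iff, S.hasBalancedRelation_iff] at h
  obtain ⟨g, ⟨σ, hc⟩, h12⟩ := exists_perm_hasAltSigns hn h.1 h.2
  have hr : Set.range (x ∘ g) = Set.range x := g.surjective.range_comp x
  obtain ⟨A, hA, hL⟩ := (S.comp_equiv g).exists_isKPrimitive hn (by rw [hr, hspan]) hc
    (isBetween_figure1 n) (Or.inl ⟨h12, MinimalSystem.not_figure1_zero_two hn⟩)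
  rw [hr] at hA hL
  have hx' : IsRaySystem _ (g.trans e) (x ∘ g) := fun i => hx (g i)
  exact ⟨A, hA, g.trans e, (MinimalSystem.isLabelling_iff hx' hA.1).2 hL⟩

theorem exists_matrixExponent_eq_of_ray (hn : 3 ≤ n) (hev : Even n)
    (hK : K ∈ polyCones (n + 1) n)
    (h : ∃ R K' : PointedCone ℝ (Fin n → ℝ), IsRay R ∧ IsMinimalCone K' ∧
        IsIndecomposable K' ∧ HasBalancedRelation K' ∧ IsDirectSum K R K') :
    ∃ A, IsKPrimitive K A ∧ matrixExponent K A = n ^ 2 - n := by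
  obtain ⟨e⟩ := exists_equiv_extremeRays hK
  obtain ⟨x, c, hx, S, rfl, hspan⟩ := exists_frame hK e
  rw [S.exists_ray_isDirectSum_iff] at h
  obtain ⟨g, ⟨σ, hc⟩, h1⟩ := exists_perm_hasAltSigns_zero hn hev h.1 h.2
  have hr : Set.range (x ∘ g) = Set.range x := g.surjective.range_comp x
  have hspan' : Submodule.span ℝ (Set.range (x ∘ g)) = ⊤ := by rw [hr, hspan]
  have h1' : (c ∘ g) 1 = 0 := h1
  obtain ⟨A, hA, hL⟩ := (S.comp_equiv g).exists_isKPrimitive hn hspan' hc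
    (isBetween_figure2 n) (Or.inr ⟨hev, h1', MinimalSystem.figure2_zero_two hn⟩)
  have hexp := ((S.comp_equiv g).matrixExponent_figure2_of_even hn hspan' hA hL).2
    (by rw [h1', mul_zero]; exact lt_irrefl 0)
  rw [hr] at hA hexp
  exact ⟨A, hA, hexp⟩

theorem matrixExponent_eq_iff_of_even (hn : 3 ≤ n) (hev : Even n) (hK : K ∈ polyCones (n + 1) n)
    (hi : IsIndecomposable K) (hA : IsKPrimitive K A) :
    matrixExponent K A = n ^ 2 - n ↔ IsGivenBy K A (figure1 (n + 1)) ∨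
      ∃ e : Fin (n + 1) ≃ extremeRays K,
        IsLabelling K A (figure2 (n + 1)) e ∧ OnOppositeSides K e 0 1 := by
  constructor
  · intro h
    refine (isGivenBy_of_even hn hev hK hA h).imp id ?_
    rintro ⟨e, he⟩
    refine ⟨e, he, ?_⟩
    obtain ⟨x, c, hx, S, rfl, hspan⟩ := exists_frame hK e
    rw [MinimalSystem.isLabelling_iff hx hA.1] at he
    rw [S.isIndecomposable_iff] at hi
    have h01 := (S.matrixExponent_figure2_of_even hn hspan hA he).1 h
    exact ⟨x, c, ⟨hx, S.ne_zero_relation, S.rel⟩,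
      lt_of_le_of_ne (not_lt.1 h01) (mul_ne_zero (hi 0) (hi 1))⟩
  · rintro (h | ⟨e, he, x, c, ⟨hx, hc0, hrel⟩, h01⟩)
    · exact (matrixExponent_of_figure1 hn hK hA h).2 hev
    · have hm := isMinimalCone_of_mem_polyCones hK
      have hx : IsRaySystem K e x := hx
      obtain ⟨d, S⟩ := hm.exists_minimalSystem hx
      have hspan := span_range_eq_top hK hx
      obtain rfl := hm.eq_hull hx
      rw [MinimalSystem.isLabelling_iff hx hA.1] at he
      exact ((S.of_relation hc0 hrel).matrixExponent_figure2_of_even hn hspan hA he).2 h01.not_gt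

theorem matrixExponent_eq_iff_of_decomposable (hn : 3 ≤ n) (hev : Even n)
    (hK : K ∈ polyCones (n + 1) n) (hd : IsDecomposable K) (hA : IsKPrimitive K A) :
    matrixExponent K A = n ^ 2 - n ↔ IsGivenBy K A (figure2 (n + 1)) := by
  constructor
  · intro h
    exact (isGivenBy_of_even hn hev hK hA h).resolve_left fun h' =>
      (indecomposable_of_figure1 hn hK hA h').1 hd
  · rintro ⟨e, he⟩
    obtain ⟨x, c, hx, S, rfl, hspan⟩ := exists_frame hK e
    rw [MinimalSystem.isLabelling_iff hx hA.1] at he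
    obtain ⟨σ, hσ, hc⟩ := S.figure2_signs hn hA.1 he
    have hd : ¬ ∀ i, c i ≠ 0 := fun h => (S.isIndecomposable_iff.2 h) hd
    push Not at hd
    obtain ⟨i, hi⟩ := hd
    have hi1 : i = 1 := by
      by_contra hne
      exact hc.ne_zero (fun h => hne (Fin.ext (h.trans (fin_val_one (by omega)).symm))) hi
    rw [S.matrixExponent_figure2_of_even hn hspan hA he, ← hi1, hi, mul_zero]
    exact lt_irrefl 0

/-- Every relation with at least two terms on each side is realized. -/
theorem exists_minimalSystem_of_coeff {c : Fin (n + 1) → ℝ} (hl : c (Fin.last n) ≠ 0)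
    (hpos : ∃ i j, i ≠ j ∧ 0 < c i ∧ 0 < c j) (hneg : ∃ i j, i ≠ j ∧ c i < 0 ∧ c j < 0) :
    ∃ x : Fin (n + 1) → Fin n → ℝ, MinimalSystem x c := by
  let y : Fin n → ℝ := fun k => - (c (Fin.last n))⁻¹ * c k.castSucc
  let x : Fin (n + 1) → Fin n → ℝ :=
    Fin.lastCases y fun i => Pi.single i 1
  have key : ∀ (d : Fin (n + 1) → ℝ) (k : Fin n),
      (∑ i, d i • x i) k = d k.castSucc - d (Fin.last n) * ((c (Fin.last n))⁻¹ * c k.castSucc) := by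
    intro d k
    rw [Fin.sum_univ_castSucc]
    simp only [x, y, Fin.lastCases_castSucc, Fin.lastCases_last, Pi.add_apply, Finset.sum_apply,
      Pi.smul_apply, Pi.single_apply, smul_eq_mul]
    simp
    ring
  refine ⟨x, ?_, fun d hd => ⟨d (Fin.last n) * (c (Fin.last n))⁻¹, fun i => ?_⟩, hpos, hneg⟩
  · funext k
    rw [key, ← mul_assoc, mul_inv_cancel₀ hl, one_mul, sub_self, Pi.zero_apply]
  · refine Fin.lastCases ?_ (fun k => ?_) i
    · rw [mul_assoc, inv_mul_cancel₀ hl, mul_one]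
    · have := key d k
      rw [hd, Pi.zero_apply] at this
      linarith

theorem exists_indecomposable_balanced (hn : 3 ≤ n) : ∃ K ∈ polyCones (n + 1) n,
    IsIndecomposable K ∧ HasBalancedRelation K := by
  have h1 := fin_val_one (n := n) (by omega)
  have hc1 := altModel_one (n := n) (by omega) (-1)
  have halt := hasAltSigns_altModel n (-1)
  have hsum := signSum_of_hasAltSigns (by omega) halt
  generalize altModel n (-1) = c at *
  have hne : ∀ i, c i ≠ 0 := by
    intro i
    by_cases hi : (i : ℕ) = 1
    · rw [show i = 1 from Fin.ext (hi.trans h1.symm), hc1]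
      norm_num
    · exact halt.ne_zero hi
  have hb : |signSum c| ≤ 1 := by
    rw [hsum, hc1]
    split_ifs <;> simp
  have hcard := card_sign_add c
  have h0 : {i | c i = 0} = ∅ := by
    ext i
    simp [hne i]
  rw [h0, Set.ncard_empty, Fintype.card_fin] at hcard
  have hb' := (abs_signSum_le_one_iff c).1 hb
  have hp : 1 < {i | 0 < c i}.ncard := by omega
  have hm : 1 < {i | c i < 0}.ncard := by omega
  rw [Set.one_lt_ncard] at hp hm
  obtain ⟨i, hi, j, hj, hij⟩ := hp
  obtain ⟨k, hk, l, hl, hkl⟩ := hm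
  obtain ⟨x, S⟩ := exists_minimalSystem_of_coeff (hne _) ⟨i, j, hij, hi, hj⟩ ⟨k, l, hkl, hk, hl⟩
  exact ⟨_, S.mem_polyCones (Fintype.card_fin _), S.isIndecomposable_iff.2 hne,
    S.hasBalancedRelation_iff.2 hb⟩

theorem coneExponent_le {N : ℕ} (h : ∀ A, IsKPrimitive K A → matrixExponent K A ≤ N) :
    coneExponent K ≤ N :=
  iSup₂_le fun A hA => Nat.cast_le.2 (h A hA)

theorem coneExponent_eq_iff {N : ℕ} (hN : 0 < N)
    (h : ∀ A, IsKPrimitive K A → matrixExponent K A ≤ N) :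
    coneExponent K = N ↔ ∃ A, IsKPrimitive K A ∧ matrixExponent K A = N := by
  constructor
  · intro he
    by_contra! hno
    have h' : coneExponent K ≤ (N - 1 : ℕ) := coneExponent_le fun A hA => by
      have := lt_of_le_of_ne (h A hA) (hno A hA)
      omega
    rw [he, Nat.cast_le] at h'
    omega
  · rintro ⟨A, hA, he⟩
    refine le_antisymm (coneExponent_le h) ?_
    rw [← he]
    exact le_iSup₂_of_le A hA le_rfl

/-- The exp-maximal cones and matrices, when the largest exponent and the cones for which it is
attained are known. -/
theorem expMaximal_of_bound {m N : ℕ} (hN : 0 < N) {P : PointedCone ℝ (Fin n → ℝ) → Prop}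
    (hle : ∀ K ∈ polyCones m n, ∀ A, IsKPrimitive K A → matrixExponent K A ≤ N)
    (hP : ∀ K ∈ polyCones m n, (∃ A, IsKPrimitive K A ∧ matrixExponent K A = N) ↔ P K)
    (hex : ∃ K ∈ polyCones m n, P K) :
    IsGreatest (coneExponent '' polyCones m n) (N : ℕ∞) ∧
    (∀ K ∈ polyCones m n, IsExpMaximalCone m K ↔ P K) ∧
    ∀ K : PointedCone ℝ (Fin n → ℝ), IsExpMaximalCone m K →
      ∀ A : Matrix (Fin n) (Fin n) ℝ, IsKPrimitive K A →
        (IsExpMaximalMatrix K A ↔ matrixExponent K A = N) := by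
  have heq : ∀ K ∈ polyCones m n, coneExponent K = N ↔ P K := fun K hK => by
    rw [coneExponent_eq_iff hN (hle K hK), hP K hK]
  have hgr : IsGreatest (coneExponent '' polyCones m n) (N : ℕ∞) := by
    obtain ⟨K, hK, hPK⟩ := hex
    refine ⟨⟨K, hK, (heq K hK).2 hPK⟩, ?_⟩
    rintro _ ⟨K', hK', rfl⟩
    exact coneExponent_le (hle K' hK')
  refine ⟨hgr, fun K hK => ?_, fun K hK A hA => ?_⟩
  · rw [← heq K hK]
    exact ⟨fun h => h.2.unique hgr, fun h => ⟨hK, by rw [h]; exact hgr⟩⟩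
  · rw [IsExpMaximalMatrix, hK.2.unique hgr, Nat.cast_inj]
    exact and_iff_right hA

end Extremal

end KCone

open KCone

theorem theorem5p3 (n : ℕ) (hn : 3 ≤ n) :
    ((Odd n → IsGreatest (coneExponent '' polyCones (n + 1) n) ((n ^ 2 - n + 1 : ℕ) : ℕ∞)) ∧
      (Even n → IsGreatest (coneExponent '' polyCones (n + 1) n) ((n ^ 2 - n : ℕ) : ℕ∞))) ∧
    (Odd n →
      (∀ K ∈ polyCones (n + 1) n,
        (IsExpMaximalCone (n + 1) K ↔ IsIndecomposable K ∧ HasBalancedRelation K)) ∧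
      (∀ K : PointedCone ℝ (Fin n → ℝ), IsExpMaximalCone (n + 1) K →
        ∀ A : Matrix (Fin n) (Fin n) ℝ, IsKPrimitive K A →
          (IsExpMaximalMatrix K A ↔ IsGivenBy K A (figure1 (n + 1))))) ∧
    (Even n →
      (∀ K ∈ polyCones (n + 1) n,
        (IsExpMaximalCone (n + 1) K ↔
          (IsIndecomposable K ∧ HasBalancedRelation K) ∨
          ∃ R K' : PointedCone ℝ (Fin n → ℝ), IsRay R ∧ IsMinimalCone K' ∧
            IsIndecomposable K' ∧ HasBalancedRelation K' ∧ IsDirectSum K R K')) ∧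
      (∀ K : PointedCone ℝ (Fin n → ℝ), IsExpMaximalCone (n + 1) K → IsIndecomposable K →
        ∀ A : Matrix (Fin n) (Fin n) ℝ, IsKPrimitive K A →
          (IsExpMaximalMatrix K A ↔
            IsGivenBy K A (figure1 (n + 1)) ∨
            ∃ e : Fin (n + 1) ≃ extremeRays K,
              IsLabelling K A (figure2 (n + 1)) e ∧ OnOppositeSides K e 0 1)) ∧
      (∀ K : PointedCone ℝ (Fin n → ℝ), IsExpMaximalCone (n + 1) K → IsDecomposable K →
        ∀ A : Matrix (Fin n) (Fin n) ℝ, IsKPrimitive K A →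
          (IsExpMaximalMatrix K A ↔ IsGivenBy K A (figure2 (n + 1))))) := by
  have hlt := MinimalSystem.lt_sq_sub hn
  have hodd := fun ho : Odd n => expMaximal_of_bound (n := n) (m := n + 1) (N := n ^ 2 - n + 1)
    (P := fun K => IsIndecomposable K ∧ HasBalancedRelation K) (by omega)
    (fun K hK A hA => matrixExponent_le_of_odd hn ho hK hA)
    (fun K hK => ⟨fun ⟨A, hA, h⟩ => indecomposable_of_figure1 hn hK hA
        ((matrixExponent_eq_iff_of_odd hn ho hK hA).1 h),
      fun h => (exists_isGivenBy_figure1 hn hK h).imp fun A hA =>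
        ⟨hA.1, (matrixExponent_eq_iff_of_odd hn ho hK hA.1).2 hA.2⟩⟩)
    (exists_indecomposable_balanced hn)
  have heven := fun he : Even n => expMaximal_of_bound (n := n) (m := n + 1) (N := n ^ 2 - n)
    (P := fun K => (IsIndecomposable K ∧ HasBalancedRelation K) ∨
      ∃ R K' : PointedCone ℝ (Fin n → ℝ), IsRay R ∧ IsMinimalCone K' ∧
        IsIndecomposable K' ∧ HasBalancedRelation K' ∧ IsDirectSum K R K') (by omega)
    (fun K hK A hA => matrixExponent_le_of_even hn he hK hA)
    (fun K hK => ⟨fun ⟨A, hA, h⟩ => (isGivenBy_of_even hn he hK hA h).elim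
        (fun h' => Or.inl (indecomposable_of_figure1 hn hK hA h'))
        (fun h' => cone_of_figure2 hn he hK hA h'),
      fun h => h.elim
        (fun h => (exists_isGivenBy_figure1 hn hK h).imp fun A hA =>
          ⟨hA.1, (matrixExponent_of_figure1 hn hK hA.1 hA.2).2 he⟩)
        (exists_matrixExponent_eq_of_ray hn he hK)⟩)
    ((exists_indecomposable_balanced hn).imp fun K hK => ⟨hK.1, Or.inl hK.2⟩)
  refine ⟨⟨fun ho => (hodd ho).1, fun he => (heven he).1⟩, fun ho => ⟨(hodd ho).2.1, ?_⟩,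
    fun he => ⟨(heven he).2.1, ?_, ?_⟩⟩
  · intro K hK A hA
    rw [(hodd ho).2.2 K hK A hA, matrixExponent_eq_iff_of_odd hn ho hK.1 hA]
  · intro K hK hi A hA
    rw [(heven he).2.2 K hK A hA, matrixExponent_eq_iff_of_even hn he hK.1 hi hA]
  · intro K hK hd A hA
    rw [(heven he).2.2 K hK A hA, matrixExponent_eq_iff_of_decomposable hn he hK.1 hd hA]
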